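/- Consider the uplink of $L$ cells with $K$ single-antenna users each, received by the base station (BS) of cell $j$ with $N$ antennas, in a coherence block of $T$ channel uses. Of these, $B$ distinct channel uses $\tau_1,\dots,\tau_B$ carry deterministic pilot symbols; $\tilde{\mathbf x}_{lm}=[x_{lm}(\tau_1),\dots,x_{lm}(\tau_B)]^{\mathsf T}\in\mathbb C^{B}$ is the (arbitrary) pilot sequence of user $m$ in cell $l$. At the other channel uses user $m$ of cell $l$ sends data with energy $\mathbb E|x_{lm}(t)|^2=p_{lm}\ge 0$. The received signal at channel use $s$ is $$\mathbf y_j(s)=\mathbf D_{\boldsymbol\phi_j(s)}\sum_{l=1}^{L}\sum_{m=1}^{K}\mathbf h_{jlm}x_{lm}(s)+\boldsymbol\upsilon_j(s)+\boldsymbol\eta_j(s),\qquad \mathbf D_{\boldsymbol\phi_j(s)}=\mathrm{diag}\big(e^{\imath\phi_{j1}(s)},\dots,e^{\imath\phi_{jN}(s)}\big).$$ The channels $\mathbf h_{jlm}\sim\mathcal{CN}(\mathbf 0,\boldsymbol\Lambda_{jlm})$ are independent, with diagonal covariance matrices. Each phase drift is a Wiener process, $\phi_{jn}(s)=\phi_{jn}(s-1)+{}$an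 independent $\mathcal N(0,\delta)$ innovation, $\delta\ge 0$; either all antennas have the same drift (a common local oscillator, CLO), or the innovations are independent over the antennas (separate local oscillators, SLOs). Given the channels, the distortion noise is $\boldsymbol\upsilon_j(s)\sim\mathcal{CN}\big(\mathbf 0,\kappa^2\sum_{l,m}\mathbb E|x_{lm}(s)|^2\,\mathrm{diag}(|h_{jlm}^{(1)}|^2,\dots,|h_{jlm}^{(N)}|^2)\big)$, independent over channel uses, $\kappa\ge 0$. The receiver noise is $\boldsymbol\eta_j(s)\sim\mathcal{CN}(\mathbf 0,\xi\mathbf I_N)$, independent over channel uses, $\xi>0$. Channels, phase drifts and receiver noise are mutually independent, and given the channels the distortion noise is independent of the phase drifts and the receiver noise. Let $t$ be a channel use used for data and $\mathbf h_{jlm}(t)=\mathbf D_{\boldsymbol\phi_j(t)}\mathbf h_{jlm}$. The maximum ratio combining (MRC) filter $\mathbf v_{jk}(t)$ is the linear minimum mean-squared error estimate of $\mathbf h_{jjk}(t)$ from $[\mathbf y_j(\tau_1);\dots;\mathbf y_j(\tau_B)]$, and $$\mathrm{SINR}_{jk}(t)=\frac{p_{jk}|\mathbb E\{\mathbf v_{jk}^{\mathsf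 H}(t)\mathbf h_{jjk}(t)\}|^2}{\sum_{l,m}p_{lm}\mathbb E\{|\mathbf v_{jk}^{\mathsf H}(t)\mathbf h_{jlm}(t)|^2\}-p_{jk}|\mathbb E\{\mathbf v_{jk}^{\mathsf H}(t)\mathbf h_{jjk}(t)\}|^2+\mathbb E\{|\mathbf v_{jk}^{\mathsf H}(t)\boldsymbol\upsilon_j(t)|^2\}+\xi\,\mathbb E\{\|\mathbf v_{jk}(t)\|^2\}}.$$ Suppose that the antennas form $A\ge 1$ subarrays of $N/A$ antennas each, so that $\boldsymbol\Lambda_{jlm}=\tilde{\boldsymbol\Lambda}_{jlm}^{(A)}\otimes\mathbf I_{N/A}$ with $\tilde{\boldsymbol\Lambda}_{jlm}^{(A)}=\mathrm{diag}(\tilde\lambda_{jlm}^{(1)},\dots,\tilde\lambda_{jlm}^{(A)})$, $\tilde\lambda_{jlm}^{(a)}\ge 0$, and let $N\to\infty$ through multiples of $A$ with everything else fixed. Put $\mathbf D_{\boldsymbol\delta(t)}=\mathrm{diag}(e^{-\frac{\delta}{2}|t-\tau_1|},\dots,e^{-\frac{\delta}{2}|t-\tau_B|})$, $[\bar{\mathbf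 X}_{lm}]_{b,c}=x_{lm}(\tau_b)x_{lm}^*(\tau_c)e^{-\frac{\delta}{2}|\tau_b-\tau_c|}$, $\mathbf X_{lm}=\bar{\mathbf X}_{lm}+\kappa^2\mathrm{diag}(|x_{lm}(\tau_1)|^2,\dots,|x_{lm}(\tau_B)|^2)$ and $\widetilde{\boldsymbol\Psi}_j=\sum_{l,m}\mathbf X_{lm}\otimes\tilde{\boldsymbol\Lambda}_{jlm}^{(A)}+\xi\mathbf I_{AB}$, and let $\mathbf e_a$ be the $a$th column of $\mathbf I_A$. Then $$\mathrm{SINR}_{jk}(t)=\frac{p_{jk}\,\mathrm{Sig}_{jk}}{\sum_{l=1}^{L}\sum_{m=1}^{K}p_{lm}\,\mathrm{Int}_{jklm}-p_{jk}\,\mathrm{Sig}_{jk}+\mathcal O(1/N)},$$ where $$\mathrm{Sig}_{jk}=\Big(\mathrm{tr}\Big(\big(\tilde{\mathbf x}_{jk}^{\mathsf H}\mathbf D_{\boldsymbol\delta(t)}\otimes\tilde{\boldsymbol\Lambda}_{jjk}^{(A)}\big)\widetilde{\boldsymbol\Psi}_j^{-1}\big(\mathbf D_{\boldsymbol\delta(t)}^{\mathsf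 H}\tilde{\mathbf x}_{jk}\otimes\tilde{\boldsymbol\Lambda}_{jjk}^{(A)}\big)\Big)\Big)^2,$$ and $\mathrm{Int}_{jklm}$ equals, with a CLO, $$\sum_{a_1=1}^{A}\sum_{a_2=1}^{A}\tilde\lambda_{jjk}^{(a_1)}\tilde\lambda_{jlm}^{(a_1)}\tilde\lambda_{jjk}^{(a_2)}\tilde\lambda_{jlm}^{(a_2)}\big(\tilde{\mathbf x}_{jk}^{\mathsf H}\mathbf D_{\boldsymbol\delta(t)}\otimes\mathbf e_{a_1}^{\mathsf H}\big)\widetilde{\boldsymbol\Psi}_j^{-1}\big(\bar{\mathbf X}_{lm}\otimes\mathbf e_{a_1}\mathbf e_{a_2}^{\mathsf H}\big)\widetilde{\boldsymbol\Psi}_j^{-1}\big(\mathbf D_{\boldsymbol\delta(t)}^{\mathsf H}\tilde{\mathbf x}_{jk}\otimes\mathbf e_{a_2}\big)$$ and, with SLOs, $$\Big|\mathrm{tr}\Big(\big(\tilde{\mathbf x}_{jk}^{\mathsf H}\mathbf D_{\boldsymbol\delta(t)}\otimes\tilde{\boldsymbol\Lambda}_{jjk}^{(A)}\big)\widetilde{\boldsymbol\Psi}_j^{-1}\big(\mathbf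 D_{\boldsymbol\delta(t)}^{\mathsf H}\tilde{\mathbf x}_{lm}\otimes\tilde{\boldsymbol\Lambda}_{jlm}^{(A)}\big)\Big)\Big|^2.$$ Moreover, on the scale $N^2/A^2$ of the signal, distortion noise and receiver noise vanish: $\frac{A^2}{N^2}\mathbb E\{|\mathbf v_{jk}^{\mathsf H}(t)\boldsymbol\upsilon_j(t)|^2\}=\mathcal O(1/N)$ and $\frac{A^2}{N^2}\xi\,\mathbb E\{\|\mathbf v_{jk}(t)\|^2\}=\mathcal O(1/N)$. Consequently, if $\sum_{l,m}p_{lm}\mathrm{Int}_{jklm}\ne p_{jk}\mathrm{Sig}_{jk}$, then $\mathrm{SINR}_{jk}(t)\to p_{jk}\mathrm{Sig}_{jk}/\big(\sum_{l,m}p_{lm}\mathrm{Int}_{jklm}-p_{jk}\mathrm{Sig}_{jk}\big)$ as $N\to\infty$. -/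

import Mathlib

open MeasureTheory ProbabilityTheory Filter Topology Asymptotics
open scoped Kronecker Matrix NNReal ENNReal ComplexConjugate

namespace MassiveMIMO

noncomputable section

/-! ### Complex Gaussian laws -/

/-- The circularly symmetric complex Gaussian law `CN(0, q)` on `ℂ`: real and imaginary parts are
independent `N(0, q / 2)`. -/
def complexGaussian (q : ℝ) : Measure ℂ :=
  ((gaussianReal 0 (q / 2).toNNReal).prod (gaussianReal 0 (q / 2).toNNReal)).map
    Complex.measurableEquivRealProd.symm

instance (q : ℝ) : IsProbabilityMeasure (complexGaussian q) :=
  Measure.isProbabilityMeasure_map Complex.measurableEquivRealProd.symm.measurable.aemeasurable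

/-- The law `CN(0, diag(d))` of a circularly symmetric complex Gaussian vector with diagonal
covariance matrix: its entries are independent and the `i`-th entry has law `CN(0, d i)`. -/
def complexGaussianDiag {I : Type*} [Fintype I] (d : I → ℝ) : Measure (I → ℂ) :=
  Measure.pi fun i => complexGaussian (d i)

instance {I : Type*} [Fintype I] (d : I → ℝ) : IsProbabilityMeasure (complexGaussianDiag d) :=
  inferInstanceAs (IsProbabilityMeasure (Measure.pi fun i => complexGaussian (d i)))

theorem measurable_complexGaussian : Measurable complexGaussian := by
  have h : Measurable fun q : ℝ => gaussianReal 0 (q / 2).toNNReal :=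
    measurable_gaussianReal.comp
      (Measurable.prodMk measurable_const ((measurable_id.div_const 2).real_toNNReal))
  have h2 : Measurable fun q : ℝ =>
      (gaussianReal 0 (q / 2).toNNReal).prod (gaussianReal 0 (q / 2).toNNReal) := by
    refine Measurable.measure_of_isPiSystem_of_isProbabilityMeasure
      generateFrom_prod.symm isPiSystem_prod ?_
    rintro s ⟨u, hu, w, hw, rfl⟩
    have hu : MeasurableSet u := hu
    have hw : MeasurableSet w := hw
    simp only [Measure.prod_prod]
    exact ((Measure.measurable_coe hu).comp h).mul ((Measure.measurable_coe hw).comp h)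
  exact (Measure.measurable_map _ Complex.measurableEquivRealProd.symm.measurable).comp h2

theorem measurable_complexGaussianDiag {I : Type*} [Fintype I] :
    Measurable (complexGaussianDiag : (I → ℝ) → Measure (I → ℂ)) := by
  refine Measurable.measure_of_isPiSystem_of_isProbabilityMeasure
    generateFrom_pi.symm isPiSystem_pi ?_
  rintro s ⟨u, hu, rfl⟩
  simp only [Set.mem_pi, Set.mem_univ, forall_true_left, Set.mem_ofPred_eq] at hu
  simp only [complexGaussianDiag, Measure.pi_pi]
  exact Finset.measurable_prod _ fun i _ =>
    (Measure.measurable_coe (hu i)).comp (measurable_complexGaussian.comp (measurable_pi_apply i))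

/-! ### Parameters and random quantities of the uplink seen by one base station -/

/-- Deterministic parameters: `L` cells with `K` users each, a coherence block of `T` channel uses
(numbered by `Fin T`), and `B` pilot channel uses `tau`. The symbol `x l m s` is the pilot symbol
sent by user `m` of cell `l` at a pilot channel use `s` (its values at other channel uses are
irrelevant). `p` are the energies per data symbol, `kappa`, `delta`, `xi` the levels of distortion
noise, phase drift and receiver noise. -/
structure Params (L K B T : ℕ) where
  p : Fin L → Fin K → ℝ
  x : Fin L → Fin K → Fin T → ℂ
  tau : Fin B → Fin T
  kappa : ℝ
  delta : ℝ
  xi : ℝ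
  p_nonneg : ∀ l m, 0 ≤ p l m
  tau_injective : Function.Injective tau
  kappa_nonneg : 0 ≤ kappa
  delta_nonneg : 0 ≤ delta
  xi_pos : 0 < xi

/-- The random quantities at one base station with antennas `ι`: the channels `h l m` from user `m`
of cell `l`, the phase drifts `phi` (time `0` is the initial phase; channel use `s : Fin T` has
phase `phi s.succ`), the distortion noise `ups` and the receiver noise `eta`. -/
structure Receiver (L K T : ℕ) (ι Ω : Type*) where
  h : Fin L → Fin K → ι → Ω → ℂ
  phi : Fin (T + 1) → ι → Ω → ℝ
  ups : Fin T → ι → Ω → ℂ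
  eta : Fin T → ι → Ω → ℂ

/-- One common local oscillator for all antennas, or separate local oscillators. -/
inductive Oscillators
  | common
  | separate

section Model

variable {L K B T : ℕ} {ι Ω : Type*}

/-- Expected transmit energy `E|x_lm(s)|²`: deterministic pilot symbols at the pilot channel uses,
full power at the data channel uses. -/
def Params.energy (par : Params L K B T) (l : Fin L) (m : Fin K) (s : Fin T) : ℝ :=
  open Classical in if s ∈ Set.range par.tau then ‖par.x l m s‖ ^ 2 else par.p l m

/-- The channel covariance matrix `diag(λ^(1), …, λ^(N))`. -/
def covMatrix [DecidableEq ι] (lam : ι → ℝ) : Matrix ι ι ℂ :=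
  Matrix.diagonal fun n => (lam n : ℂ)

/-- Diagonal entries of the distortion-noise covariance matrices, for given channels. -/
def distortionVar (par : Params L K B T) (hh : Fin L → Fin K → ι → ℂ) (q : Fin T × ι) : ℝ :=
  par.kappa ^ 2 * ∑ l, ∑ m, par.energy l m q.1 * ‖hh l m q.2‖ ^ 2

theorem measurable_distortionVar [Countable ι] (par : Params L K B T) :
    Measurable (distortionVar (ι := ι) par) := by
  unfold distortionVar
  fun_prop

/-- The conditional law of the distortion noise, at all channel uses and antennas, given channels,
phase drifts and receiver noise: it depends on the channels only, is independent over antennas and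
channel uses, and is `CN(0, Υ(s))` at channel use `s`. -/
def distortionKernel [Fintype ι] (par : Params L K B T) :
    Kernel ((Fin L → Fin K → ι → ℂ) × (Fin (T + 1) → ι → ℝ) × (Fin T × ι → ℂ))
      (Fin T × ι → ℂ) where
  toFun z := complexGaussianDiag (distortionVar par z.1)
  measurable' := measurable_complexGaussianDiag.comp
    ((measurable_distortionVar par).comp measurable_fst)

namespace Receiver

variable (R : Receiver L K T ι Ω)

/-- The innovation `φ_n(i + 1) - φ_n(i)` of the phase drift. -/
def step (i : Fin T) (n : ι) (ω : Ω) : ℝ := R.phi i.succ n ω - R.phi i.castSucc n ω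

/-- The phase drifts are (discrete-time) Wiener processes with innovation variance `delta`, equal at
all antennas (common oscillator) or with innovations independent over antennas (separate
oscillators); the initial phases are arbitrary. -/
def IsPhaseDrift [Fintype ι] [MeasurableSpace Ω] (delta : ℝ) (P : Measure Ω) :
    Oscillators → Prop
  | .common =>
      (∀ s n n', R.phi s n =ᵐ[P] R.phi s n') ∧
      ∀ n, HasLaw (fun ω (i : Fin T) => R.step i n ω)
          (Measure.pi fun _ : Fin T => gaussianReal 0 delta.toNNReal) P ∧
        IndepFun (R.phi 0 n) (fun ω (i : Fin T) => R.step i n ω) P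
  | .separate =>
      HasLaw (fun ω (q : Fin T × ι) => R.step q.1 q.2 ω)
          (Measure.pi fun _ : Fin T × ι => gaussianReal 0 delta.toNNReal) P ∧
        IndepFun (fun ω (n : ι) => R.phi 0 n ω)
          (fun ω (q : Fin T × ι) => R.step q.1 q.2 ω) P

/-- The stochastic uplink model with hardware imperfections at one base station, where
`lam l m n` is the average attenuation from user `m` of cell `l` to antenna `n`. -/
structure IsUplink [Fintype ι] [MeasurableSpace Ω] (par : Params L K B T) (osc : Oscillators)
    (lam : Fin L → Fin K → ι → ℝ) (P : Measure Ω) : Prop where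
  /-- Independent channels `h l m ∼ CN(0, diag(lam l m))`. -/
  channel : HasLaw (fun ω (q : Fin L × Fin K × ι) => R.h q.1 q.2.1 q.2.2 ω)
    (complexGaussianDiag fun q => lam q.1 q.2.1 q.2.2) P
  phase_aemeasurable : ∀ s n, AEMeasurable (R.phi s n) P
  phase : R.IsPhaseDrift par.delta P osc
  /-- Receiver noise `CN(0, ξ I)`, independent over channel uses. -/
  noise : HasLaw (fun ω (q : Fin T × ι) => R.eta q.1 q.2 ω)
    (complexGaussianDiag fun _ => par.xi) P
  /-- Channels, phase drifts and receiver noise are mutually independent. -/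
  indep_channel : IndepFun (fun ω l m n => R.h l m n ω)
    (fun ω => ((fun s n => R.phi s n ω : Fin (T + 1) → ι → ℝ),
      (fun q => R.eta q.1 q.2 ω : Fin T × ι → ℂ))) P
  indep_phase_noise : IndepFun (fun ω s n => R.phi s n ω)
    (fun ω (q : Fin T × ι) => R.eta q.1 q.2 ω) P
  /-- Given everything else, the distortion noise is `CN(0, Υ(s))`, independent over `s`. -/
  distortion : HasCondDistrib (fun ω (q : Fin T × ι) => R.ups q.1 q.2 ω)
    (fun ω => ((fun l m n => R.h l m n ω : Fin L → Fin K → ι → ℂ),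
      (fun s n => R.phi s n ω : Fin (T + 1) → ι → ℝ),
      (fun q => R.eta q.1 q.2 ω : Fin T × ι → ℂ)))
    (distortionKernel par) P

/-- The effective channel `h_lm(t) = D_φ(t) h_lm`. -/
def effChannel (l : Fin L) (m : Fin K) (t : Fin T) (n : ι) (ω : Ω) : ℂ :=
  Complex.exp (Complex.I * (R.phi t.succ n ω : ℂ)) * R.h l m n ω

/-- The signal received at the pilot channel uses:
`ψ = [y(τ_1); …; y(τ_B)]` with `y(s) = D_φ(s) ∑_l H_l x_l(s) + υ(s) + η(s)`. -/
def pilotSignal (par : Params L K B T) (ω : Ω) (q : Fin B × ι) : ℂ :=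
  Complex.exp (Complex.I * (R.phi (par.tau q.1).succ q.2 ω : ℂ)) *
      (∑ l, ∑ m, R.h l m q.2 ω * par.x l m (par.tau q.1)) +
    R.ups (par.tau q.1) q.2 ω + R.eta (par.tau q.1) q.2 ω

/-- The linear estimate `W ψ` based on the received pilot signal. -/
def linEst [Fintype ι] (par : Params L K B T) (W : Matrix ι (Fin B × ι) ℂ) (n : ι) (ω : Ω) : ℂ :=
  (W *ᵥ R.pilotSignal par ω) n

/-- Mean-squared error of the linear estimate `W ψ` of the effective channel `h_lm(t)`. -/
def mse [Fintype ι] [MeasurableSpace Ω] (par : Params L K B T) (P : Measure Ω)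
    (l : Fin L) (m : Fin K) (t : Fin T) (W : Matrix ι (Fin B × ι) ℂ) : ℝ :=
  ∫ ω, ∑ n, ‖R.effChannel l m t n ω - R.linEst par W n ω‖ ^ 2 ∂P

/-- `W ψ` is the linear minimum mean-squared error (LMMSE) estimate of `h_lm(t)`. -/
def IsLMMSE [Fintype ι] [MeasurableSpace Ω] (par : Params L K B T) (P : Measure Ω)
    (l : Fin L) (m : Fin K) (t : Fin T) (W : Matrix ι (Fin B × ι) ℂ) : Prop :=
  ∀ W' : Matrix ι (Fin B × ι) ℂ, R.mse par P l m t W ≤ R.mse par P l m t W'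

/-- The inner product `vᴴ u` of two random vectors. -/
def _root_.MassiveMIMO.herm [Fintype ι] (v u : ι → Ω → ℂ) (ω : Ω) : ℂ :=
  ∑ n, conj (v n ω) * u n ω

/-- `E{vᴴ h_lm(t)}`. -/
def meanGain [Fintype ι] [MeasurableSpace Ω] (P : Measure Ω) (v : ι → Ω → ℂ)
    (l : Fin L) (m : Fin K) (t : Fin T) : ℂ :=
  ∫ ω, herm v (R.effChannel l m t) ω ∂P

/-- `E{|vᴴ h_lm(t)|²}`. -/
def interference [Fintype ι] [MeasurableSpace Ω] (P : Measure Ω) (v : ι → Ω → ℂ)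
    (l : Fin L) (m : Fin K) (t : Fin T) : ℝ :=
  ∫ ω, ‖herm v (R.effChannel l m t) ω‖ ^ 2 ∂P

/-- `E{|vᴴ υ(t)|²}`. -/
def distortionPower [Fintype ι] [MeasurableSpace Ω] (P : Measure Ω) (v : ι → Ω → ℂ)
    (t : Fin T) : ℝ :=
  ∫ ω, ‖herm v (R.ups t) ω‖ ^ 2 ∂P

/-- `E{‖v‖²}`. -/
def _root_.MassiveMIMO.filterPower [Fintype ι] [MeasurableSpace Ω] (P : Measure Ω)
    (v : ι → Ω → ℂ) : ℝ :=
  ∫ ω, ∑ n, ‖v n ω‖ ^ 2 ∂P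

/-- The SINR at channel use `t` of user `k` in the base station's own cell `j`, for the receive
filter `v`. -/
def sinr [Fintype ι] [MeasurableSpace Ω] (par : Params L K B T) (P : Measure Ω) (v : ι → Ω → ℂ)
    (j : Fin L) (k : Fin K) (t : Fin T) : ℝ :=
  par.p j k * ‖R.meanGain P v j k t‖ ^ 2 /
    ((∑ l, ∑ m, par.p l m * R.interference P v l m t) - par.p j k * ‖R.meanGain P v j k t‖ ^ 2 +
      R.distortionPower P v t + par.xi * filterPower P v)

end Receiver

end Model

/-! ### Closed-form signal and interference terms -/

section ClosedForm

variable {L K B T A : ℕ} (par : Params L K B T)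

/-- `D_δ(t) = diag(e^{-δ|t-τ_1|/2}, …, e^{-δ|t-τ_B|/2})`. -/
def Ddelta (t : Fin T) : Matrix (Fin B) (Fin B) ℂ :=
  Matrix.diagonal fun b =>
    (Real.exp (-(par.delta / 2) * |((t : ℕ) : ℝ) - ((par.tau b : ℕ) : ℝ)|) : ℂ)

/-- The pilot sequence of user `m` in cell `l`, as a column. -/
def pilotCol (l : Fin L) (m : Fin K) : Matrix (Fin B) Unit ℂ :=
  Matrix.replicateCol Unit fun b => par.x l m (par.tau b)

/-- The row `x̃_lmᴴ D_δ(t)`. -/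
def rowD (l : Fin L) (m : Fin K) (t : Fin T) : Matrix Unit (Fin B) ℂ :=
  (pilotCol par l m)ᴴ * Ddelta par t

/-- The column `D_δ(t)ᴴ x̃_lm`. -/
def colD (l : Fin L) (m : Fin K) (t : Fin T) : Matrix (Fin B) Unit ℂ :=
  (Ddelta par t)ᴴ * pilotCol par l m

/-- `X̄_lm`, with entries `x(τ_b) x(τ_c)^* e^{-δ|τ_b-τ_c|/2}` (so `|x(τ_b)|²` on the diagonal). -/
def Xbar (l : Fin L) (m : Fin K) : Matrix (Fin B) (Fin B) ℂ :=
  Matrix.of fun b c => par.x l m (par.tau b) * conj (par.x l m (par.tau c)) *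
    (Real.exp (-(par.delta / 2) * |((par.tau b : ℕ) : ℝ) - ((par.tau c : ℕ) : ℝ)|) : ℂ)

/-- `X_lm = X̄_lm + κ² diag(|x(τ_1)|², …, |x(τ_B)|²)`. -/
def Xmat (l : Fin L) (m : Fin K) : Matrix (Fin B) (Fin B) ℂ :=
  Xbar par l m + ((par.kappa ^ 2 : ℝ) : ℂ) •
    Matrix.diagonal fun b => ((‖par.x l m (par.tau b)‖ ^ 2 : ℝ) : ℂ)

/-- `Ψ̃ = ∑ X_lm ⊗ Λ̃_lm + ξ I`. -/
def PsiT (lamT : Fin L → Fin K → Fin A → ℝ) : Matrix (Fin B × Fin A) (Fin B × Fin A) ℂ :=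
  (∑ l, ∑ m, Xmat par l m ⊗ₖ covMatrix (lamT l m)) + (par.xi : ℂ) • 1

/-- `tr((x̃_jkᴴ D_δ(t) ⊗ Λ̃_jk) Ψ̃⁻¹ (D_δ(t)ᴴ x̃_lm ⊗ Λ̃_lm))`. -/
def crossTrace (lamT : Fin L → Fin K → Fin A → ℝ) (t : Fin T)
    (j : Fin L) (k : Fin K) (l : Fin L) (m : Fin K) : ℂ :=
  Matrix.trace ((rowD par j k t ⊗ₖ covMatrix (lamT j k)) * (PsiT par lamT)⁻¹ *
    (colD par l m t ⊗ₖ covMatrix (lamT l m)))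

/-- The signal part; the trace is a nonnegative real number here. -/
def Sig (lamT : Fin L → Fin K → Fin A → ℝ) (t : Fin T) (j : Fin L) (k : Fin K) : ℝ :=
  ‖crossTrace par lamT t j k j k‖ ^ 2

/-- The column `e_a`. -/
def unitCol (a : Fin A) : Matrix (Fin A) Unit ℂ :=
  Matrix.replicateCol Unit (Pi.single a 1)

/-- The interference terms. For a common oscillator each summand is a `1 × 1` matrix product (read
as a number through its trace), and the double sum is real. -/
def Interf (lamT : Fin L → Fin K → Fin A → ℝ) (t : Fin T) (j : Fin L) (k : Fin K)
    (l : Fin L) (m : Fin K) : Oscillators → ℝ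
  | .common =>
      (∑ a₁ : Fin A, ∑ a₂ : Fin A,
        ((lamT j k a₁ * lamT l m a₁ * lamT j k a₂ * lamT l m a₂ : ℝ) : ℂ) *
          Matrix.trace ((rowD par j k t ⊗ₖ (unitCol a₁)ᴴ) * (PsiT par lamT)⁻¹ *
            (Xbar par l m ⊗ₖ (unitCol a₁ * (unitCol a₂)ᴴ)) * (PsiT par lamT)⁻¹ *
            (colD par j k t ⊗ₖ unitCol a₂))).re
  | .separate => ‖crossTrace par lamT t j k l m‖ ^ 2

end ClosedForm

end

end MassiveMIMO

/-! Write `n = N / A`. Given the phase drifts, the random quantities at different antennas are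
independent, and the LMMSE filter combines only the pilot observations of the antenna in question,
with weights depending on its subarray. So `vᴴ h` and `vᴴ υ` are sums of `A * n` terms that are
independent given the phases and have second moments bounded uniformly in `n` and in the phases. The
second moment of such a sum is that of the sum of the conditional means, up to `O(n)`
(`integral_norm_sum_sq_condIndep`). Divided by `n²`, only the conditional means survive.

For the distortion noise the conditional means vanish, because `t` is not a pilot use. For `vᴴ h_lm`
they are linear combinations of the rotations `e^{i(φ(t) - φ(τ_b))}` with coefficients `gainCoeff`
(`integral_conj_antennaFilter_mul_antennaChannel`). With a common oscillator all antennas see the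
same rotations, so the second moment is exactly `n²` times a quadratic form; `φ(t)` cancels in it,
leaving the correlations between pilot uses that enter `Xbar`. With separate oscillators the
rotations are independent over the antennas, a second averaging replaces them by their means
`e^{-δ|t-τ_b|/2}`, and a squared modulus remains (`exists_bound_integral_rotation_sums`). The mean
gain `E{vᴴ h_jk}` needs no approximation.

The filter is given only as a minimizer of the mean-squared error. The antenna-wise estimate with
weights `antennaWeight` has an error orthogonal to every pilot observation: at the same antenna by
the normal equations, at another antenna because the pilot signal has conditional mean zero. By
Pythagoras every minimizer yields the same estimate almost surely (`ae_eq_of_orthogonal`,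
`ae_linEst_eq_antennaFilter`). The closed forms match because `PsiT` is block diagonal over the
subarrays, with the invertible blocks `antennaPsi` (`inv_PsiT`).

The probability spaces are arbitrary, but the model determines the joint law of all quantities up to
the law of the phases (`map_joint`), and every performance measure depends on that joint law alone.
Hence one may compute on a product space where the distortion noise is a standard deviation, given
by the channels, times an independent normalized noise. -/

namespace MassiveMIMO

noncomputable section

/-! ### Functions with finite moments of all orders -/

section AllMoments

variable {α β F : Type*} [MeasurableSpace α] [MeasurableSpace β] [NormedAddCommGroup F]

/-- All moments of `f` are finite. -/
def HasAllMoments (f : α → F) (μ : Measure α) : Prop := ∀ p : ℝ≥0, MemLp f p μ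

namespace HasAllMoments

variable {μ : Measure α} {ν : Measure β}

theorem memLp_two {f : α → F} (hf : HasAllMoments f μ) : MemLp f 2 μ := hf 2

theorem integrable {f : α → F} (hf : HasAllMoments f μ) : Integrable f μ :=
  memLp_one_iff_integrable.1 (hf 1)

theorem aestronglyMeasurable {f : α → F} (hf : HasAllMoments f μ) : AEStronglyMeasurable f μ :=
  (hf 1).1

theorem const [IsFiniteMeasure μ] (c : F) : HasAllMoments (fun _ => c) μ := fun _ => memLp_const c

theorem add {f g : α → F} (hf : HasAllMoments f μ) (hg : HasAllMoments g μ) :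
    HasAllMoments (fun x => f x + g x) μ := fun p => (hf p).add (hg p)

theorem sum {κ : Type*} {s : Finset κ} {f : κ → α → F}
    (hf : ∀ i ∈ s, HasAllMoments (f i) μ) : HasAllMoments (fun x => ∑ i ∈ s, f i x) μ :=
  fun p => memLp_finsetSum s fun i hi => hf i hi p

theorem mono {G : Type*} [NormedAddCommGroup G] {f : α → F} {g : α → G}
    (hg : HasAllMoments g μ) (hf : AEStronglyMeasurable f μ) (h : ∀ x, ‖f x‖ ≤ ‖g x‖) :
    HasAllMoments f μ :=
  fun p => (hg p).mono hf (ae_of_all _ h)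

theorem norm {f : α → F} (hf : HasAllMoments f μ) : HasAllMoments (fun x => ‖f x‖) μ :=
  fun p => (hf p).norm

/-- Hölder's inequality with both exponents `2 * p`. This closure under products is why all moments
are required: with a fixed finite exponent each product would lose integrability. -/
theorem mul {R : Type*} [NormedRing R] {f g : α → R} (hf : HasAllMoments f μ)
    (hg : HasAllMoments g μ) : HasAllMoments (fun x => f x * g x) μ := by
  intro p
  have h2 : ENNReal.HolderTriple ((2 * p : ℝ≥0) : ℝ≥0∞) ((2 * p : ℝ≥0) : ℝ≥0∞) (p : ℝ≥0∞) := by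
    constructor
    rcases eq_or_ne p 0 with rfl | hp
    · simp
    · rw [← ENNReal.coe_inv (by positivity), ← ENNReal.coe_inv hp]
      norm_cast
      field_simp
      norm_num
  exact (hg (2 * p)).mul' (hf (2 * p))

theorem const_mul {R : Type*} [NormedRing R] {f : α → R} (c : R) (hf : HasAllMoments f μ) :
    HasAllMoments (fun x => c * f x) μ := fun p => (hf p).const_mul c

theorem pow {f : α → ℝ} (hf : HasAllMoments f μ) [IsFiniteMeasure μ] (n : ℕ) :
    HasAllMoments (fun x => f x ^ n) μ := by
  induction n with
  | zero => simpa using const (μ := μ) (1 : ℝ)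
  | succ n ih => simpa [pow_succ] using ih.mul hf

theorem conj_comp {f : α → ℂ} (hf : HasAllMoments f μ) : HasAllMoments (fun x => conj (f x)) μ :=
  fun p => (hf p).star

theorem comp_measurePreserving {f : β → F} {g : α → β} (hf : HasAllMoments f ν)
    (hg : MeasurePreserving g μ ν) : HasAllMoments (fun x => f (g x)) μ :=
  fun p => (hf p).comp_measurePreserving hg

theorem comp_fst {f : α → F} (hf : HasAllMoments f μ) [IsFiniteMeasure ν] :
    HasAllMoments (fun z : α × β => f z.1) (μ.prod ν) := fun p => (hf p).comp_fst ν

theorem comp_snd {f : β → F} (hf : HasAllMoments f ν) [IsFiniteMeasure μ] [SFinite ν] :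
    HasAllMoments (fun z : α × β => f z.2) (μ.prod ν) := fun p => (hf p).comp_snd μ

end HasAllMoments

end AllMoments

/-! ### Moments of complex Gaussian laws -/

/-- Scaling turns a Gaussian law with a random variance into a function of a fixed normalized noise.
For `q ≤ 0` both sides degenerate to the point mass at zero, since `√` and `Real.toNNReal` both
truncate. -/
theorem complexGaussian_eq_map (q : ℝ) :
    complexGaussian q = (complexGaussian 1).map fun z => ((√q : ℝ) : ℂ) * z := by
  have key : gaussianReal 0 (q / 2).toNNReal =
      (gaussianReal 0 (1 / 2 : ℝ).toNNReal).map (√q * ·) := by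
    rw [gaussianReal_map_const_mul, mul_zero]
    congr 1
    apply NNReal.eq
    rcases le_total 0 q with hq | hq
    · simp [Real.sq_sqrt hq, Real.coe_toNNReal _ (show 0 ≤ q / 2 by linarith)]
      ring
    · simp [Real.sqrt_eq_zero_of_nonpos hq]
      linarith
  unfold complexGaussian
  rw [key, Measure.map_prod_map _ _ (by fun_prop) (by fun_prop),
    Measure.map_map (by fun_prop) (by fun_prop), Measure.map_map (by fun_prop) (by fun_prop)]
  congr 1
  ext z
  simp [Complex.measurableEquivRealProd, Complex.ext_iff]

theorem hasAllMoments_complexGaussian (q : ℝ) :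
    HasAllMoments (fun z : ℂ => z) (complexGaussian q) := by
  intro p
  unfold complexGaussian
  rw [memLp_map_measure_iff (by fun_prop) (by fun_prop)]
  have h1 : HasAllMoments (fun x : ℝ => (x : ℂ)) (gaussianReal 0 (q / 2).toNNReal) :=
    HasAllMoments.mono (g := fun x : ℝ => x) (fun p => memLp_id_gaussianReal p) (by fun_prop)
      (by simp)
  have := (h1.comp_fst (ν := gaussianReal 0 (q / 2).toNNReal)).add
    ((h1.comp_snd (μ := gaussianReal 0 (q / 2).toNNReal)).const_mul Complex.I) p
  convert this using 1
  ext z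
  simp [Complex.measurableEquivRealProd, Complex.ext_iff]

theorem integral_complexGaussian (q : ℝ) : ∫ z, z ∂complexGaussian q = 0 := by
  unfold complexGaussian
  rw [integral_map (by fun_prop) (by fun_prop)]
  have h1 : Integrable (fun x : ℝ => x) (gaussianReal 0 (q / 2).toNNReal) :=
    memLp_one_iff_integrable.1 (by exact_mod_cast memLp_id_gaussianReal 1)
  have : ∀ z : ℝ × ℝ, Complex.measurableEquivRealProd.symm z = (z.1 : ℂ) + Complex.I * z.2 := by
    intro z; simp [Complex.measurableEquivRealProd, Complex.ext_iff]
  simp_rw [this]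
  have hi : Integrable (fun x : ℝ => (x : ℂ)) (gaussianReal 0 (q / 2).toNNReal) := h1.ofReal
  rw [integral_add (hi.comp_fst _) ((hi.comp_snd _).const_mul _), integral_const_mul,
    integral_fun_fst (fun x : ℝ => (x : ℂ)), integral_fun_snd (fun x : ℝ => (x : ℂ)),
    integral_complex_ofReal]
  simp

theorem integral_mul_conj_complexGaussian {q : ℝ} (hq : 0 ≤ q) :
    ∫ z, z * conj z ∂complexGaussian q = q := by
  unfold complexGaussian
  rw [integral_map (by fun_prop) (by fun_prop)]
  have hv : ∫ x, x ^ 2 ∂gaussianReal 0 (q / 2).toNNReal = q / 2 := by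
    have := variance_fun_id_gaussianReal (μ := 0) (v := (q / 2).toNNReal)
    rw [variance_of_integral_eq_zero (by fun_prop) (by simp)] at this
    rw [this, Real.coe_toNNReal _ (by linarith)]
  have h2 : Integrable (fun x : ℝ => x ^ 2) (gaussianReal 0 (q / 2).toNNReal) :=
    (memLp_id_gaussianReal 2).integrable_sq
  have : ∀ z : ℝ × ℝ, Complex.measurableEquivRealProd.symm z *
      conj (Complex.measurableEquivRealProd.symm z) = ((z.1 ^ 2 + z.2 ^ 2 : ℝ) : ℂ) := by
    intro z
    rw [Complex.mul_conj]
    simp [Complex.measurableEquivRealProd, Complex.normSq]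
    ring
  simp_rw [this]
  rw [integral_complex_ofReal, integral_add (h2.comp_fst _) (h2.comp_snd _),
    integral_fun_fst (fun x : ℝ => x ^ 2), integral_fun_snd (fun x : ℝ => x ^ 2), hv]
  simp

section Diag

variable {I : Type*} [Fintype I] (d : I → ℝ)

theorem measurePreserving_eval_complexGaussianDiag (i : I) :
    MeasurePreserving (fun z : I → ℂ => z i) (complexGaussianDiag d) (complexGaussian (d i)) :=
  measurePreserving_eval (fun i => complexGaussian (d i)) i

theorem hasAllMoments_complexGaussianDiag (i : I) :
    HasAllMoments (fun z : I → ℂ => z i) (complexGaussianDiag d) :=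
  (hasAllMoments_complexGaussian (d i)).comp_measurePreserving
    (measurePreserving_eval_complexGaussianDiag d i)

theorem integral_complexGaussianDiag (i : I) : ∫ z, z i ∂complexGaussianDiag d = 0 := by
  have h := measurePreserving_eval_complexGaussianDiag d i
  rw [← integral_complexGaussian (d i), ← h.map_eq,
    integral_map h.measurable.aemeasurable (by fun_prop)]

theorem integral_conj_complexGaussianDiag (i : I) :
    ∫ z, conj (z i) ∂complexGaussianDiag d = 0 := by
  rw [integral_conj, integral_complexGaussianDiag, map_zero]

theorem integral_mul_conj_complexGaussianDiag [DecidableEq I] (hd : ∀ i, 0 ≤ d i) (i i' : I) :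
    ∫ z, z i * conj (z i') ∂complexGaussianDiag d = if i = i' then (d i : ℂ) else 0 := by
  split_ifs with hii
  · subst hii
    have h := measurePreserving_eval_complexGaussianDiag d i
    rw [← integral_mul_conj_complexGaussian (hd i), ← h.map_eq,
      integral_map h.measurable.aemeasurable (by fun_prop)]
  · have hind : iIndepFun (fun i (z : I → ℂ) => z i) (complexGaussianDiag d) :=
      iIndepFun_pi (X := fun i (z : ℂ) => z) (μ := fun i => complexGaussian (d i))
        fun i => measurable_id.aemeasurable
    have h2 : IndepFun (fun z : I → ℂ => z i) (fun z : I → ℂ => conj (z i'))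
        (complexGaussianDiag d) :=
      (hind.indepFun hii).comp measurable_id (Complex.continuous_conj.measurable)
    rw [h2.integral_fun_mul_eq_mul_integral (measurable_pi_apply i).aestronglyMeasurable
      (Complex.continuous_conj.measurable.comp (measurable_pi_apply i')).aestronglyMeasurable,
      integral_complexGaussianDiag, zero_mul]

end Diag

/-! ### A canonical model, with independent antennas given the phase drifts -/

section Rearrangement

/-- Both measures are products of the same factors in two groupings, so comparing them on boxes is
enough. The equivalence `e` separates the antenna from the remaining indices, for pairs and triples
alike. -/
theorem measurePreserving_uncurry {κ ι Q X : Type*} [Fintype κ] [Fintype ι] [Fintype Q]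
    [MeasurableSpace X] (e : Q ≃ κ × ι) (μ : Q → Measure X) [∀ q, IsProbabilityMeasure (μ q)] :
    MeasurePreserving (fun (y : ι → κ → X) q => y (e q).2 (e q).1)
      (Measure.pi fun n : ι => Measure.pi fun k => μ (e.symm (k, n))) (Measure.pi μ) where
  measurable := by fun_prop
  map_eq := by
    refine (Measure.pi_eq fun s hs => ?_).symm
    rw [Measure.map_apply (by fun_prop) (MeasurableSet.univ_pi hs)]
    have : (fun (y : ι → κ → X) q => y (e q).2 (e q).1) ⁻¹' Set.univ.pi s =
        Set.univ.pi fun n => Set.univ.pi fun k => s (e.symm (k, n)) := by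
      ext y
      simp only [Set.mem_preimage, Set.mem_pi, Set.mem_univ, forall_true_left]
      exact ⟨fun h n k => by simpa using h (e.symm (k, n)),
        fun h q => by simpa using h (e q).2 (e q).1⟩
    rw [this, Measure.pi_pi]
    simp_rw [Measure.pi_pi]
    rw [← Fintype.prod_prod_type_right' (fun k n => μ (e.symm (k, n)) (s (e.symm (k, n))))]
    exact Fintype.prod_equiv e.symm _ _ fun _ => rfl

end Rearrangement

variable {L K B T : ℕ} {ι Ω : Type*}

/-- Channels, receiver noise and normalized distortion noise at one antenna. -/
abbrev AntennaSpace (L K T : ℕ) : Type := (Fin L × Fin K → ℂ) × ((Fin T → ℂ) × (Fin T → ℂ))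

/-- The law of independent channels, receiver noise and normalized distortion noise at one
antenna. -/
def antennaLaw (T : ℕ) (lam1 : Fin L → Fin K → ℝ) (xi : ℝ) : Measure (AntennaSpace L K T) :=
  (complexGaussianDiag fun q : Fin L × Fin K => lam1 q.1 q.2).prod
    ((complexGaussianDiag fun _ => xi).prod (complexGaussianDiag fun _ => 1))

instance (lam1 : Fin L → Fin K → ℝ) (xi : ℝ) : IsProbabilityMeasure (antennaLaw T lam1 xi) :=
  inferInstanceAs (IsProbabilityMeasure (Measure.prod _ _))

/-- Phase drifts together with the random quantities at each antenna. -/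
abbrev CanonicalSpace (L K T : ℕ) (ι : Type*) : Type _ :=
  (Fin (T + 1) → ι → ℝ) × (ι → AntennaSpace L K T)

/-- Phase drifts with law `μ`, and independent antennas. -/
def canonicalLaw [Fintype ι] (μ : Measure (Fin (T + 1) → ι → ℝ)) (lam : Fin L → Fin K → ι → ℝ)
    (xi : ℝ) : Measure (CanonicalSpace L K T ι) :=
  μ.prod (Measure.pi fun n => antennaLaw T (fun l m => lam l m n) xi)

instance [Fintype ι] (μ : Measure (Fin (T + 1) → ι → ℝ)) [IsProbabilityMeasure μ]
    (lam : Fin L → Fin K → ι → ℝ) (xi : ℝ) : IsProbabilityMeasure (canonicalLaw μ lam xi) :=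
  inferInstanceAs (IsProbabilityMeasure (Measure.prod _ _))

/-- The distortion noise at one antenna as a function of the channels and the normalized
noise. -/
def antennaDistortion (par : Params L K B T) (s : Fin T) (y : AntennaSpace L K T) : ℂ :=
  (√(par.kappa ^ 2 * ∑ l, ∑ m, par.energy l m s * ‖y.1 (l, m)‖ ^ 2) : ℝ) * y.2.2 s

/-- The receiver on the canonical space. -/
def canonicalReceiver (par : Params L K B T) (ι : Type*) :
    Receiver L K T ι (CanonicalSpace L K T ι) where
  h l m n ω := (ω.2 n).1 (l, m)
  phi s n ω := ω.1 s n
  ups s n ω := antennaDistortion par s (ω.2 n)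
  eta s n ω := (ω.2 n).2.1 s

namespace Receiver

/-- Values of channels, phase drifts and receiver noise. -/
abbrev PrimarySpace (L K T : ℕ) (ι : Type*) : Type _ :=
  (Fin L → Fin K → ι → ℂ) × (Fin (T + 1) → ι → ℝ) × (Fin T × ι → ℂ)

/-- Channels, phase drifts and receiver noise. -/
def primary (R : Receiver L K T ι Ω) (ω : Ω) : PrimarySpace L K T ι :=
  (fun l m n => R.h l m n ω, fun s n => R.phi s n ω, fun q => R.eta q.1 q.2 ω)

/-- All random quantities of the receiver. -/
def joint (R : Receiver L K T ι Ω) (ω : Ω) : PrimarySpace L K T ι × (Fin T × ι → ℂ) :=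
  (R.primary ω, fun q => R.ups q.1 q.2 ω)

end Receiver

/-- The receiver that reads off its random quantities from their joint value. -/
def stateReceiver (L K T : ℕ) (ι : Type*) :
    Receiver L K T ι (Receiver.PrimarySpace L K T ι × (Fin T × ι → ℂ)) where
  h l m n ω := ω.1.1 l m n
  phi s n ω := ω.1.2.1 s n
  ups s n ω := ω.2 (s, n)
  eta s n ω := ω.1.2.2 (s, n)

/-- Channels indexed by triples, in curried form. -/
def channelsOf (f : Fin L × Fin K × ι → ℂ) (l : Fin L) (m : Fin K) (n : ι) : ℂ := f (l, m, n)

theorem measurable_channelsOf : Measurable (channelsOf : (Fin L × Fin K × ι → ℂ) → _) := by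
  unfold channelsOf
  fun_prop

/-- The law of channels, phase drifts and receiver noise. -/
def primaryLaw [Fintype ι] (μ : Measure (Fin (T + 1) → ι → ℝ)) (lam : Fin L → Fin K → ι → ℝ)
    (xi : ℝ) : Measure (Receiver.PrimarySpace L K T ι) :=
  ((complexGaussianDiag fun q : Fin L × Fin K × ι => lam q.1 q.2.1 q.2.2).map channelsOf).prod
    (μ.prod (complexGaussianDiag fun _ => xi))

instance [Fintype ι] (par : Params L K B T) :
    IsMarkovKernel (distortionKernel (ι := ι) par) where
  isProbabilityMeasure _ := inferInstanceAs (IsProbabilityMeasure (complexGaussianDiag _))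

/-- Given the channels, the distortion noise is a normalized Gaussian vector scaled entrywise. The
kernel can therefore be replaced by a deterministic function of the channels and an independent
noise. -/
theorem compProd_distortionKernel [Fintype ι] (par : Params L K B T)
    (Q : Measure (Receiver.PrimarySpace L K T ι)) [SFinite Q] :
    Q ⊗ₘ distortionKernel par = (Q.prod (complexGaussianDiag fun _ : Fin T × ι => 1)).map
      fun z => (z.1, fun q => ((√(distortionVar par z.1.1 q) : ℝ) : ℂ) * z.2 q) := by
  have hm : Measurable fun z : Receiver.PrimarySpace L K T ι × (Fin T × ι → ℂ) =>
      ((z.1, fun q => ((√(distortionVar par z.1.1 q) : ℝ) : ℂ) * z.2 q) :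
        Receiver.PrimarySpace L K T ι × (Fin T × ι → ℂ)) := by
    unfold distortionVar
    fun_prop
  ext s hs
  rw [Measure.compProd_apply hs, Measure.map_apply hm hs, Measure.prod_apply (hm hs)]
  refine lintegral_congr fun z => ?_
  have h1 : (distortionKernel par z : Measure (Fin T × ι → ℂ)) =
      (complexGaussianDiag fun _ : Fin T × ι => 1).map
        fun w q => ((√(distortionVar par z.1 q) : ℝ) : ℂ) * w q := by
    change Measure.pi _ = (Measure.pi _).map _
    rw [Measure.pi_map_pi (μ := fun _ => complexGaussian 1)
      (f := fun q (w : ℂ) => ((√(distortionVar par z.1 q) : ℝ) : ℂ) * w)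
      fun _ => by fun_prop]
    congr 1
    ext1 q
    exact complexGaussian_eq_map _
  rw [h1, Measure.map_apply (by fun_prop) (measurable_prodMk_left hs)]
  rfl

variable [Fintype ι] (par : Params L K B T)

theorem Receiver.IsUplink.aemeasurable_h [MeasurableSpace Ω] {P : Measure Ω}
    {R : Receiver L K T ι Ω} {osc : Oscillators} {lam : Fin L → Fin K → ι → ℝ}
    (hR : R.IsUplink par osc lam P) : AEMeasurable (fun ω l m n => R.h l m n ω) P :=
  measurable_channelsOf.comp_aemeasurable hR.channel.aemeasurable

/-- The two independence assumptions factor the law of channels, phases and receiver noise, and the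
conditional law of the distortion supplies the last factor. Only the law of the phases stays
unspecified. -/
theorem Receiver.IsUplink.map_joint [MeasurableSpace Ω] {P : Measure Ω} [IsProbabilityMeasure P]
    {R : Receiver L K T ι Ω} {osc : Oscillators} {lam : Fin L → Fin K → ι → ℝ}
    (hR : R.IsUplink par osc lam P) :
    HasLaw R.joint (primaryLaw (P.map fun ω s n => R.phi s n ω) lam par.xi ⊗ₘ
      distortionKernel par) P := by
  have hphi : AEMeasurable (fun ω s n => R.phi s n ω) P :=
    aemeasurable_pi_lambda _ fun s => aemeasurable_pi_lambda _ fun n => hR.phase_aemeasurable s n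
  have hprim : P.map R.primary = primaryLaw (P.map fun ω s n => R.phi s n ω) lam par.xi := by
    have h1 := (indepFun_iff_map_prod_eq_prod_map_map (hR.aemeasurable_h)
      (hphi.prodMk hR.noise.aemeasurable)).1 hR.indep_channel
    have h2 := (indepFun_iff_map_prod_eq_prod_map_map hphi
      hR.noise.aemeasurable).1 hR.indep_phase_noise
    rw [h2, hR.noise.map_eq] at h1
    unfold primaryLaw
    rw [← hR.channel.map_eq, AEMeasurable.map_map_of_aemeasurable
      measurable_channelsOf.aemeasurable hR.channel.aemeasurable]
    exact h1
  have h := hR.distortion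
  unfold HasCondDistrib at h
  rw [← hprim]
  exact h

theorem measurable_antennaDistortion (s : Fin T) :
    Measurable (antennaDistortion (K := K) (L := L) par s) := by
  unfold antennaDistortion
  fun_prop

/-- The normalized random quantities of all antennas have independent laws. -/
theorem measurePreserving_antennas (lam : Fin L → Fin K → ι → ℝ) (xi : ℝ) :
    MeasurePreserving (fun y : ι → AntennaSpace L K T =>
      ((fun q : Fin L × Fin K × ι => (y q.2.2).1 (q.1, q.2.1)),
        ((fun q : Fin T × ι => (y q.2).2.1 q.1), (fun q : Fin T × ι => (y q.2).2.2 q.1))))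
      (Measure.pi fun n => antennaLaw T (fun l m => lam l m n) xi)
      ((complexGaussianDiag fun q : Fin L × Fin K × ι => lam q.1 q.2.1 q.2.2).prod
        ((complexGaussianDiag fun _ => xi).prod (complexGaussianDiag fun _ => 1))) := by
  have h1 := measurePreserving_arrowProdEquivProdArrow (Fin L × Fin K → ℂ)
    ((Fin T → ℂ) × (Fin T → ℂ)) ι
    (fun n => complexGaussianDiag fun q : Fin L × Fin K => lam q.1 q.2 n)
    (fun _ => (complexGaussianDiag fun _ => xi).prod (complexGaussianDiag fun _ => 1))
  have h2 := measurePreserving_arrowProdEquivProdArrow (Fin T → ℂ) (Fin T → ℂ) ι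
    (fun _ => complexGaussianDiag fun _ => xi) (fun _ => complexGaussianDiag fun _ => 1)
  have e1 := measurePreserving_uncurry (Equiv.prodAssoc (Fin L) (Fin K) ι).symm
    (fun q : Fin L × Fin K × ι => complexGaussian (lam q.1 q.2.1 q.2.2))
  have e2 := measurePreserving_uncurry (Equiv.refl (Fin T × ι))
    (fun q : Fin T × ι => complexGaussian xi)
  have e3 := measurePreserving_uncurry (Equiv.refl (Fin T × ι))
    (fun q : Fin T × ι => complexGaussian 1)
  exact ((e1.prod ((e2.prod e3).comp h2))).comp h1

theorem measurePreserving_shuffle {α β γ δ : Type*} [MeasurableSpace α] [MeasurableSpace β]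
    [MeasurableSpace γ] [MeasurableSpace δ] (μ : Measure α) (ν : Measure β) (ρ : Measure γ)
    (τ : Measure δ) [SFinite μ] [SFinite ν] [SFinite ρ] [SFinite τ] :
    MeasurePreserving (fun z : α × (β × (γ × δ)) => ((z.2.1, (z.1, z.2.2.1)), z.2.2.2))
      (μ.prod (ν.prod (ρ.prod τ))) ((ν.prod (μ.prod ρ)).prod τ) := by
  have h1 := (measurePreserving_prodAssoc μ ν (ρ.prod τ)).symm
  have h2 := (Measure.measurePreserving_swap (μ := μ) (ν := ν)).prod
    (MeasurePreserving.id (ρ.prod τ))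
  have h3 := (measurePreserving_prodAssoc (ν.prod μ) ρ τ).symm
  have h4 := (measurePreserving_prodAssoc ν μ ρ).prod (MeasurePreserving.id τ)
  exact h4.comp (h3.comp (h2.comp h1))

/-- Together with `map_joint`, this allows any uplink to be replaced by the canonical one with the
same phase law. -/
theorem hasLaw_joint_canonicalReceiver (μ : Measure (Fin (T + 1) → ι → ℝ))
    [IsProbabilityMeasure μ] (lam : Fin L → Fin K → ι → ℝ) :
    HasLaw (canonicalReceiver par ι).joint
      (primaryLaw μ lam par.xi ⊗ₘ distortionKernel par) (canonicalLaw μ lam par.xi) := by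
  have hc : MeasurePreserving channelsOf
      (complexGaussianDiag fun q : Fin L × Fin K × ι => lam q.1 q.2.1 q.2.2)
      ((complexGaussianDiag fun q : Fin L × Fin K × ι => lam q.1 q.2.1 q.2.2).map channelsOf) :=
    measurable_channelsOf.measurePreserving _
  have := Measure.isProbabilityMeasure_map (μ := complexGaussianDiag fun q : Fin L × Fin K × ι =>
    lam q.1 q.2.1 q.2.2) measurable_channelsOf.aemeasurable
  have h1 := (measurePreserving_shuffle μ _ (complexGaussianDiag fun _ : Fin T × ι => par.xi)
    (complexGaussianDiag fun _ : Fin T × ι => 1)).comp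
    ((MeasurePreserving.id μ).prod ((hc.prod (MeasurePreserving.id _)).comp
      (measurePreserving_antennas (T := T) lam par.xi)))
  have : SFinite (primaryLaw μ lam par.xi) := by unfold primaryLaw; infer_instance
  rw [compProd_distortionKernel]
  have hm : Measurable fun z : Receiver.PrimarySpace L K T ι × (Fin T × ι → ℂ) =>
      ((z.1, fun q => ((√(distortionVar par z.1.1 q) : ℝ) : ℂ) * z.2 q) :
        Receiver.PrimarySpace L K T ι × (Fin T × ι → ℂ)) := by
    unfold distortionVar
    fun_prop
  have h2 := (hm.measurePreserving _).comp h1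
  -- The composite of regrouping, reordering and scaling is by definition `joint` of the canonical
  -- receiver.
  exact ⟨h2.measurable.aemeasurable, h2.map_eq⟩

/-! ### The performance measures depend on the joint law only -/

section Transfer

variable {L K B T : ℕ} {ι Ω Ω' : Type*}

theorem measurable_effChannel_stateReceiver (l : Fin L) (m : Fin K) (t : Fin T) (n : ι) :
    Measurable ((stateReceiver L K T ι).effChannel l m t n) := by
  unfold Receiver.effChannel stateReceiver
  fun_prop

theorem measurable_ups_stateReceiver (t : Fin T) (n : ι) :
    Measurable ((stateReceiver L K T ι).ups t n) := by
  unfold stateReceiver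
  fun_prop

variable [Fintype ι] [MeasurableSpace Ω] [MeasurableSpace Ω']

theorem measurable_linEst_stateReceiver (par : Params L K B T) (W : Matrix ι (Fin B × ι) ℂ)
    (n : ι) : Measurable ((stateReceiver L K T ι).linEst par W n) := by
  unfold Receiver.linEst Receiver.pilotSignal stateReceiver Matrix.mulVec dotProduct
  fun_prop

theorem measurable_herm {u v : ι → Ω → ℂ} (hu : ∀ n, Measurable (u n))
    (hv : ∀ n, Measurable (v n)) : Measurable (herm u v) := by
  unfold herm
  exact Finset.measurable_fun_sum _ fun n _ =>
    (Complex.continuous_conj.measurable.comp (hu n)).mul (hv n)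

variable {R : Receiver L K T ι Ω} {R' : Receiver L K T ι Ω'} {P : Measure Ω} {P' : Measure Ω'}
  {Q : Measure (Receiver.PrimarySpace L K T ι × (Fin T × ι → ℂ))} (par : Params L K B T)
  (W : Matrix ι (Fin B × ι) ℂ) (l : Fin L) (m : Fin K) (t : Fin T)

/-- The integrand is a measurable function of `joint`, the one that `stateReceiver` computes, so
this is a change of variables. The same holds for the other performance measures. -/
theorem mse_eq_of_hasLaw (h : HasLaw R.joint Q P) :
    R.mse par P l m t W = (stateReceiver L K T ι).mse par Q l m t W := by
  refine h.integral_comp (f := fun ω => ∑ n, ‖(stateReceiver L K T ι).effChannel l m t n ω -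
    (stateReceiver L K T ι).linEst par W n ω‖ ^ 2) (Measurable.aestronglyMeasurable ?_)
  exact Finset.measurable_fun_sum _ fun n _ =>
    ((measurable_effChannel_stateReceiver l m t n).sub
      (measurable_linEst_stateReceiver par W n)).norm.pow_const 2

theorem meanGain_eq_of_hasLaw (h : HasLaw R.joint Q P) :
    R.meanGain P (R.linEst par W) l m t =
      (stateReceiver L K T ι).meanGain Q ((stateReceiver L K T ι).linEst par W) l m t :=
  h.integral_comp (measurable_herm (measurable_linEst_stateReceiver par W)
    (measurable_effChannel_stateReceiver l m t)).aestronglyMeasurable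

theorem interference_eq_of_hasLaw (h : HasLaw R.joint Q P) :
    R.interference P (R.linEst par W) l m t =
      (stateReceiver L K T ι).interference Q ((stateReceiver L K T ι).linEst par W) l m t :=
  h.integral_comp ((measurable_herm (measurable_linEst_stateReceiver par W)
    (measurable_effChannel_stateReceiver l m t)).norm.pow_const 2).aestronglyMeasurable

theorem distortionPower_eq_of_hasLaw (h : HasLaw R.joint Q P) :
    R.distortionPower P (R.linEst par W) t =
      (stateReceiver L K T ι).distortionPower Q ((stateReceiver L K T ι).linEst par W) t :=
  h.integral_comp ((measurable_herm (measurable_linEst_stateReceiver par W)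
    (measurable_ups_stateReceiver t)).norm.pow_const 2).aestronglyMeasurable

theorem filterPower_eq_of_hasLaw (h : HasLaw R.joint Q P) :
    filterPower P (R.linEst par W) =
      filterPower Q ((stateReceiver L K T ι).linEst par W) :=
  h.integral_comp (f := fun ω => ∑ n, ‖(stateReceiver L K T ι).linEst par W n ω‖ ^ 2)
    (Finset.measurable_fun_sum _ fun n _ =>
      (measurable_linEst_stateReceiver par W n).norm.pow_const 2).aestronglyMeasurable

theorem Receiver.IsLMMSE.of_hasLaw (h : HasLaw R.joint Q P) (h' : HasLaw R'.joint Q P')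
    (hW : R.IsLMMSE par P l m t W) : R'.IsLMMSE par P' l m t W := fun W' => by
  rw [mse_eq_of_hasLaw par _ l m t h', mse_eq_of_hasLaw par _ l m t h',
    ← mse_eq_of_hasLaw par _ l m t h, ← mse_eq_of_hasLaw par _ l m t h]
  exact hW W'

end Transfer

/-! ### Sums of uncorrelated random variables -/

section Uncorrelated

variable {ι Ω : Type*} [Fintype ι] [MeasurableSpace Ω] {P : Measure Ω}

theorem ofReal_norm_sq (z : ℂ) : ((‖z‖ ^ 2 : ℝ) : ℂ) = z * conj z := by
  rw [Complex.mul_conj, Complex.normSq_eq_norm_sq]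

theorem integrable_mul_conj {f g : Ω → ℂ} (hf : MemLp f 2 P) (hg : MemLp g 2 P) :
    Integrable (fun ω => f ω * conj (g ω)) P :=
  MemLp.integrable_mul hf hg.star

theorem norm_integral_sq_le [IsProbabilityMeasure P] {f : Ω → ℂ} (hf : MemLp f 2 P) :
    ‖∫ ω, f ω ∂P‖ ^ 2 ≤ ∫ ω, ‖f ω‖ ^ 2 ∂P := by
  have h1 := norm_integral_le_integral_norm (μ := P) f
  have h2 := variance_nonneg (fun ω => ‖f ω‖) P
  rw [variance_eq_sub hf.norm] at h2
  simp only [Pi.pow_apply] at h2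
  have := pow_le_pow_left₀ (norm_nonneg _) h1 2
  linarith

theorem integral_norm_sum_sq {X : ι → Ω → ℂ} (hX : ∀ n, MemLp (X n) 2 P) :
    ((∫ ω, ‖∑ n, X n ω‖ ^ 2 ∂P : ℝ) : ℂ) = ∑ n, ∑ n', ∫ ω, X n ω * conj (X n' ω) ∂P := by
  rw [← integral_complex_ofReal]
  simp_rw [ofReal_norm_sq, map_sum, Finset.sum_mul_sum]
  rw [integral_finsetSum _ fun n _ => integrable_finsetSum _ fun n' _ =>
    integrable_mul_conj (hX n) (hX n')]
  exact Finset.sum_congr rfl fun n _ => integral_finsetSum _ fun n' _ =>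
    integrable_mul_conj (hX n) (hX n')

/-- In the double sum over pairs, all off-diagonal terms cancel. Only as many terms as there are
summands remain instead of the square of that number; this is the source of the `1/N` rate. -/
theorem integral_norm_sum_sq_sub [DecidableEq ι] {X : ι → Ω → ℂ} (hX : ∀ n, MemLp (X n) 2 P)
    (hc : ∀ n n', n ≠ n' →
      ∫ ω, X n ω * conj (X n' ω) ∂P = (∫ ω, X n ω ∂P) * conj (∫ ω, X n' ω ∂P)) :
    ∫ ω, ‖∑ n, X n ω‖ ^ 2 ∂P - ‖∑ n, ∫ ω, X n ω ∂P‖ ^ 2 =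
      ∑ n, (∫ ω, ‖X n ω‖ ^ 2 ∂P - ‖∫ ω, X n ω ∂P‖ ^ 2) := by
  apply Complex.ofReal_injective
  rw [Complex.ofReal_sub, integral_norm_sum_sq hX, ofReal_norm_sq, map_sum, Finset.sum_mul_sum,
    ← Finset.sum_sub_distrib, Complex.ofReal_sum]
  refine Finset.sum_congr rfl fun n _ => ?_
  rw [← Finset.sum_sub_distrib, Finset.sum_eq_single n]
  · rw [Complex.ofReal_sub, ofReal_norm_sq, ← integral_complex_ofReal]
    simp_rw [ofReal_norm_sq]
  · intro n' _ hn'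
    rw [hc n n' hn'.symm, sub_self]
  · simp

theorem integral_norm_sum_sq_sub_mem [IsProbabilityMeasure P] {X : ι → Ω → ℂ}
    (hX : ∀ n, MemLp (X n) 2 P)
    (hc : ∀ n n', n ≠ n' →
      ∫ ω, X n ω * conj (X n' ω) ∂P = (∫ ω, X n ω ∂P) * conj (∫ ω, X n' ω ∂P))
    {C : ℝ} (hC : ∀ n, ∫ ω, ‖X n ω‖ ^ 2 ∂P ≤ C) :
    ∫ ω, ‖∑ n, X n ω‖ ^ 2 ∂P - ‖∑ n, ∫ ω, X n ω ∂P‖ ^ 2 ∈ Set.Icc 0 (Fintype.card ι * C) := by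
  classical
  rw [integral_norm_sum_sq_sub hX hc]
  constructor
  · exact Finset.sum_nonneg fun n _ => sub_nonneg.2 (norm_integral_sq_le (hX n))
  · refine (Finset.sum_le_card_nsmul _ _ C fun n _ => ?_).trans (by simp)
    have := hC n
    have : 0 ≤ ‖∫ ω, X n ω ∂P‖ ^ 2 := by positivity
    linarith

end Uncorrelated

/-! ### Sums of random variables that are independent given a common one -/

section CondIndep

variable {ι Φ E : Type*} [MeasurableSpace Φ] [MeasurableSpace E] {ν : ι → Measure E}
  {f : ι → Φ → E → ℂ} {F : ι → E → ℝ}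

theorem memLp_two_of_bound (hf : ∀ n, Measurable (Function.uncurry (f n)))
    (hF : ∀ n, MemLp (F n) 2 (ν n)) (hfF : ∀ n φ z, ‖f n φ z‖ ≤ F n z) (n : ι) (φ : Φ) :
    MemLp (f n φ) 2 (ν n) :=
  (hF n).mono ((hf n).comp measurable_prodMk_left).aestronglyMeasurable
    (ae_of_all _ fun z => (hfF n φ z).trans (le_abs_self _))

variable [Fintype ι] {μ : Measure Φ} [IsProbabilityMeasure μ] [∀ n, IsProbabilityMeasure (ν n)]

theorem integral_pi_eval {f : E → ℂ} (hf : Measurable f) (n : ι) :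
    ∫ y, f (y n) ∂Measure.pi ν = ∫ z, f z ∂ν n := by
  have h := measurePreserving_eval ν n
  rw [← h.map_eq, integral_map h.measurable.aemeasurable hf.aestronglyMeasurable]

theorem integral_pi_eval_mul_conj {f g : E → ℂ} (hf : Measurable f) (hg : Measurable g)
    {n n' : ι} (h : n ≠ n') :
    ∫ y, f (y n) * conj (g (y n')) ∂Measure.pi ν =
      (∫ z, f z ∂ν n) * conj (∫ z, g z ∂ν n') := by
  have hind : iIndepFun (fun n (y : ι → E) => y n) (Measure.pi ν) :=
    iIndepFun_pi (X := fun _ (y : E) => y) fun i => measurable_id.aemeasurable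
  have hg' : Measurable fun z => conj (g z) := Complex.continuous_conj.measurable.comp hg
  have h2 := (hind.indepFun h).comp hf hg'
  have h3 := h2.integral_fun_mul_eq_mul_integral
    (hf.comp (measurable_pi_apply n)).aestronglyMeasurable
    (hg'.comp (measurable_pi_apply n')).aestronglyMeasurable
  rw [← integral_pi_eval hf, ← integral_conj, ← integral_pi_eval hg' n']
  exact h3

theorem memLp_two_prod_of_bound (hf : ∀ n, Measurable (Function.uncurry (f n)))
    (hF : ∀ n, MemLp (F n) 2 (ν n)) (hfF : ∀ n φ z, ‖f n φ z‖ ≤ F n z) (n : ι) :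
    MemLp (fun ω : Φ × (ι → E) => f n ω.1 (ω.2 n)) 2 (μ.prod (Measure.pi ν)) :=
  (((hF n).comp_measurePreserving (measurePreserving_eval ν n)).comp_snd μ).mono
    ((hf n).comp (measurable_fst.prodMk
      ((measurable_pi_apply n).comp measurable_snd))).aestronglyMeasurable
    (ae_of_all _ fun ω => (hfF n ω.1 (ω.2 n)).trans (le_abs_self _))

theorem integral_prod_eval (hf : ∀ n, Measurable (Function.uncurry (f n)))
    (hF : ∀ n, MemLp (F n) 2 (ν n)) (hfF : ∀ n φ z, ‖f n φ z‖ ≤ F n z) (n : ι) :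
    ∫ ω : Φ × (ι → E), f n ω.1 (ω.2 n) ∂μ.prod (Measure.pi ν) = ∫ φ, ∫ z, f n φ z ∂ν n ∂μ := by
  rw [integral_prod _ ((memLp_two_prod_of_bound hf hF hfF n).integrable one_le_two)]
  exact integral_congr_ae (ae_of_all _ fun φ =>
    integral_pi_eval ((hf n).comp measurable_prodMk_left) n)

/-- The second moment of a sum of random variables that are independent given `φ` differs from that
of the sum of their conditional means by at most the sum of their second moments. -/
theorem integral_norm_sum_sq_condIndep (hf : ∀ n, Measurable (Function.uncurry (f n)))
    (hF : ∀ n, MemLp (F n) 2 (ν n)) (hfF : ∀ n φ z, ‖f n φ z‖ ≤ F n z) {C : ℝ}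
    (hC : ∀ n, ∫ z, F n z ^ 2 ∂ν n ≤ C) :
    ∫ ω : Φ × (ι → E), ‖∑ n, f n ω.1 (ω.2 n)‖ ^ 2 ∂μ.prod (Measure.pi ν) -
      ∫ φ, ‖∑ n, ∫ z, f n φ z ∂ν n‖ ^ 2 ∂μ ∈ Set.Icc 0 (Fintype.card ι * C) := by
  have hint : Integrable (fun ω : Φ × (ι → E) => ‖∑ n, f n ω.1 (ω.2 n)‖ ^ 2)
      (μ.prod (Measure.pi ν)) :=
    (memLp_finsetSum Finset.univ fun n _ =>
      memLp_two_prod_of_bound (μ := μ) hf hF hfF n).norm.integrable_sq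
  -- For fixed `φ` the summands are independent, so the unconditional bound applies; it is
  -- integrated over `φ` at the end.
  have hpoint : ∀ φ, ∫ y : ι → E, ‖∑ n, f n φ (y n)‖ ^ 2 ∂Measure.pi ν -
      ‖∑ n, ∫ z, f n φ z ∂ν n‖ ^ 2 ∈ Set.Icc 0 (Fintype.card ι * C) := by
    intro φ
    have hm : ∀ n, Measurable (f n φ) := fun n => (hf n).comp measurable_prodMk_left
    have h := integral_norm_sum_sq_sub_mem (P := Measure.pi ν) (X := fun n y => f n φ (y n))
      (C := C)
      (fun n => (memLp_two_of_bound hf hF hfF n φ).comp_measurePreserving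
        (measurePreserving_eval ν n))
      (fun n n' hn => by
        rw [integral_pi_eval_mul_conj (hm n) (hm n') hn, integral_pi_eval (hm n),
          integral_pi_eval (hm n')])
      (fun n => by
        have h := measurePreserving_eval ν n
        have h1 : ∫ y : ι → E, ‖f n φ (y n)‖ ^ 2 ∂Measure.pi ν = ∫ z, ‖f n φ z‖ ^ 2 ∂ν n := by
          rw [← h.map_eq, integral_map h.measurable.aemeasurable
            ((hm n).norm.pow_const 2).aestronglyMeasurable]
        rw [h1]
        refine (integral_mono (memLp_two_of_bound hf hF hfF n φ).norm.integrable_sq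
          (hF n).integrable_sq fun z => ?_).trans (hC n)
        exact pow_le_pow_left₀ (norm_nonneg _) (hfF n φ z) 2)
    simp_rw [fun n => integral_pi_eval (ν := ν) (hm n) n] at h
    exact h
  have hmeas : AEStronglyMeasurable (fun φ => ‖∑ n, ∫ z, f n φ z ∂ν n‖ ^ 2) μ := by
    refine (StronglyMeasurable.pow ?_ 2).aestronglyMeasurable
    refine StronglyMeasurable.norm (Finset.stronglyMeasurable_fun_sum _ fun n _ => ?_)
    exact (hf n).stronglyMeasurable.integral_prod_right
  -- By the lower bound in `hpoint`, the squared sum of the conditional means is dominated by the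
  -- conditional second moment, which is integrable.
  have hint2 : Integrable (fun φ => ‖∑ n, ∫ z, f n φ z ∂ν n‖ ^ 2) μ := by
    refine hint.integral_prod_left.mono hmeas (ae_of_all _ fun φ => ?_)
    have := (hpoint φ).1
    rw [Real.norm_of_nonneg (by positivity), Real.norm_of_nonneg
      (integral_nonneg fun _ => by positivity)]
    linarith
  rw [integral_prod _ hint, ← integral_sub hint.integral_prod_left hint2]
  constructor
  · exact integral_nonneg fun φ => (hpoint φ).1
  · refine (integral_mono (hint.integral_prod_left.sub hint2) (integrable_const _)
      fun φ => (hpoint φ).2).trans ?_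
    simp

end CondIndep

/-! ### Moments at one antenna -/

section Antenna

variable {L K B T : ℕ} (par : Params L K B T) {lam1 : Fin L → Fin K → ℝ} {xi : ℝ}

/-- The pilot signal received at one antenna with phase drift `θ`. -/
def antennaPilot (b : Fin B) (θ : Fin (T + 1) → ℝ) (y : AntennaSpace L K T) : ℂ :=
  Complex.exp (Complex.I * (θ (par.tau b).succ : ℂ)) *
      (∑ l, ∑ m, y.1 (l, m) * par.x l m (par.tau b)) +
    antennaDistortion par (par.tau b) y + y.2.1 (par.tau b)

/-- A bound of the received pilot signal that does not depend on the phase drift. -/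
def antennaPilotBound (b : Fin B) (y : AntennaSpace L K T) : ℝ :=
  ‖∑ l, ∑ m, y.1 (l, m) * par.x l m (par.tau b)‖ +
    ‖antennaDistortion par (par.tau b) y‖ + ‖y.2.1 (par.tau b)‖

instance {I : Type*} [Fintype I] (d : I → ℝ) : SFinite (complexGaussianDiag d) :=
  @instSFiniteOfSigmaFinite _ _ _ inferInstance

theorem norm_exp_I_mul (r : ℝ) : ‖Complex.exp (Complex.I * (r : ℂ))‖ = 1 := by
  rw [mul_comm]
  exact Complex.norm_exp_ofReal_mul_I r

theorem norm_antennaPilot_le (b : Fin B) (θ : Fin (T + 1) → ℝ) (y : AntennaSpace L K T) :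
    ‖antennaPilot par b θ y‖ ≤ antennaPilotBound par b y := by
  unfold antennaPilot antennaPilotBound
  refine (norm_add₃_le).trans ?_
  rw [norm_mul, norm_exp_I_mul, one_mul]

theorem measurable_antennaPilot (b : Fin B) :
    Measurable fun z : (Fin (T + 1) → ℝ) × AntennaSpace L K T => antennaPilot par b z.1 z.2 := by
  unfold antennaPilot antennaDistortion
  fun_prop

theorem hasAllMoments_channel (q : Fin L × Fin K) :
    HasAllMoments (fun y : AntennaSpace L K T => y.1 q) (antennaLaw T lam1 xi) :=
  (hasAllMoments_complexGaussianDiag _ q).comp_fst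

theorem hasAllMoments_noise (s : Fin T) :
    HasAllMoments (fun y : AntennaSpace L K T => y.2.1 s) (antennaLaw T lam1 xi) :=
  ((hasAllMoments_complexGaussianDiag _ s).comp_fst).comp_snd

theorem hasAllMoments_normalizedDistortion (s : Fin T) :
    HasAllMoments (fun y : AntennaSpace L K T => y.2.2 s) (antennaLaw T lam1 xi) :=
  ((hasAllMoments_complexGaussianDiag _ s).comp_snd).comp_snd

theorem hasAllMoments_antennaDistortion (s : Fin T) :
    HasAllMoments (antennaDistortion par s) (antennaLaw T lam1 xi) := by
  unfold antennaDistortion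
  refine HasAllMoments.mul ?_ (hasAllMoments_normalizedDistortion s)
  have h : HasAllMoments (fun y : AntennaSpace L K T =>
      par.kappa ^ 2 * ∑ l, ∑ m, par.energy l m s * ‖y.1 (l, m)‖ ^ 2) (antennaLaw T lam1 xi) :=
    (HasAllMoments.sum fun l _ => HasAllMoments.sum fun m _ =>
      ((hasAllMoments_channel (l, m)).norm.pow 2).const_mul _).const_mul _
  -- The standard deviation is controlled by the variance through `√x ≤ 1 + |x|`.
  refine ((HasAllMoments.const (1 : ℝ)).add h.norm).mono (by fun_prop) fun y => ?_
  rw [Complex.norm_real, Real.norm_of_nonneg (Real.sqrt_nonneg _),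
    Real.norm_of_nonneg (by positivity), Real.sqrt_le_left (by positivity)]
  refine (le_abs_self _).trans ?_
  rw [← Real.norm_eq_abs]
  nlinarith [norm_nonneg (par.kappa ^ 2 * ∑ l, ∑ m, par.energy l m s * ‖y.1 (l, m)‖ ^ 2)]

theorem hasAllMoments_channelSum (s : Fin T) :
    HasAllMoments (fun y : AntennaSpace L K T => ∑ l, ∑ m, y.1 (l, m) * par.x l m s)
      (antennaLaw T lam1 xi) :=
  HasAllMoments.sum fun l _ => HasAllMoments.sum fun m _ =>
    (hasAllMoments_channel (l, m)).mul (HasAllMoments.const _)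

theorem hasAllMoments_antennaPilotBound (b : Fin B) :
    HasAllMoments (antennaPilotBound par b) (antennaLaw T lam1 xi) :=
  (((hasAllMoments_channelSum par _).norm).add
    (hasAllMoments_antennaDistortion par _).norm).add (hasAllMoments_noise _).norm

/-- Channels, receiver noise and normalized distortion are independent blocks; the cross moments
below follow by choosing one factor for each. No integrability is needed for the product formula. -/
theorem integral_antennaLaw_mul (F : (Fin L × Fin K → ℂ) → ℂ) (G H : (Fin T → ℂ) → ℂ) :
    ∫ y, F y.1 * (G y.2.1 * H y.2.2) ∂antennaLaw T lam1 xi =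
      (∫ z, F z ∂complexGaussianDiag fun q : Fin L × Fin K => lam1 q.1 q.2) *
        ((∫ z, G z ∂complexGaussianDiag fun _ => xi) *
          ∫ z, H z ∂complexGaussianDiag fun _ => 1) := by
  unfold antennaLaw
  rw [integral_prod_mul F (fun z : (Fin T → ℂ) × (Fin T → ℂ) => G z.1 * H z.2),
    integral_prod_mul]

theorem integral_antennaLaw_channel (F : (Fin L × Fin K → ℂ) → ℂ) :
    ∫ y, F y.1 ∂antennaLaw T lam1 xi =
      ∫ z, F z ∂complexGaussianDiag fun q : Fin L × Fin K => lam1 q.1 q.2 := by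
  simpa using integral_antennaLaw_mul (T := T) (lam1 := lam1) (xi := xi) F (fun _ => 1) fun _ => 1

theorem integral_channel_mul_noise (F : (Fin L × Fin K → ℂ) → ℂ) (s : Fin T) :
    ∫ y, F y.1 * y.2.1 s ∂antennaLaw T lam1 xi = 0 := by
  have h := integral_antennaLaw_mul (T := T) (lam1 := lam1) (xi := xi) F (fun z => z s) fun _ => 1
  rw [integral_complexGaussianDiag] at h
  simpa using h

theorem integral_channel_mul_conj_noise (F : (Fin L × Fin K → ℂ) → ℂ) (s : Fin T) :
    ∫ y, F y.1 * conj (y.2.1 s) ∂antennaLaw T lam1 xi = 0 := by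
  have h := integral_antennaLaw_mul (T := T) (lam1 := lam1) (xi := xi) F
    (fun z => conj (z s)) fun _ => 1
  rw [integral_conj_complexGaussianDiag] at h
  simpa using h

/-- The distortion depends on the channels only through its scale. The centered normalized factor
makes it uncorrelated with every function of the channels, although not independent of them. -/
theorem integral_channel_mul_antennaDistortion (F : (Fin L × Fin K → ℂ) → ℂ) (s : Fin T) :
    ∫ y, F y.1 * antennaDistortion par s y ∂antennaLaw T lam1 xi = 0 := by
  have h := integral_antennaLaw_mul (T := T) (lam1 := lam1) (xi := xi)
    (fun z => F z * (√(par.kappa ^ 2 * ∑ l, ∑ m, par.energy l m s * ‖z (l, m)‖ ^ 2) : ℝ))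
    (fun _ => 1) (fun z => z s)
  rw [integral_complexGaussianDiag] at h
  simpa [antennaDistortion, mul_assoc] using h

theorem integral_channel_mul_conj_antennaDistortion (F : (Fin L × Fin K → ℂ) → ℂ) (s : Fin T) :
    ∫ y, F y.1 * conj (antennaDistortion par s y) ∂antennaLaw T lam1 xi = 0 := by
  have h := integral_antennaLaw_mul (T := T) (lam1 := lam1) (xi := xi)
    (fun z => F z * (√(par.kappa ^ 2 * ∑ l, ∑ m, par.energy l m s * ‖z (l, m)‖ ^ 2) : ℝ))
    (fun _ => 1) (fun z => conj (z s))
  rw [integral_conj_complexGaussianDiag] at h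
  simpa [antennaDistortion, mul_assoc] using h

theorem integral_antennaDistortion_mul_conj_noise (s s' : Fin T) :
    ∫ y, antennaDistortion par s y * conj (y.2.1 s') ∂antennaLaw T lam1 xi = 0 := by
  have h := integral_antennaLaw_mul (T := T) (lam1 := lam1) (xi := xi)
    (fun z => (√(par.kappa ^ 2 * ∑ l, ∑ m, par.energy l m s * ‖z (l, m)‖ ^ 2) : ℝ))
    (fun z => conj (z s')) (fun z => z s)
  rw [integral_conj_complexGaussianDiag, zero_mul, mul_zero] at h
  refine (integral_congr_ae (ae_of_all _ fun y => ?_)).trans h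
  simp only [antennaDistortion]
  ring

theorem integral_noise_mul_conj_antennaDistortion (s s' : Fin T) :
    ∫ y, y.2.1 s * conj (antennaDistortion par s' y) ∂antennaLaw T lam1 xi = 0 := by
  have h := integral_antennaDistortion_mul_conj_noise par (lam1 := lam1) (xi := xi) s' s
  have h' := congrArg conj h
  rw [← integral_conj] at h'
  simpa [mul_comm] using h'

theorem integral_channel_mul_conj_channel (hlam : ∀ l m, 0 ≤ lam1 l m) (q q' : Fin L × Fin K) :
    ∫ y, y.1 q * conj (y.1 q') ∂antennaLaw T lam1 xi =
      if q = q' then (lam1 q.1 q.2 : ℂ) else 0 := by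
  rw [integral_antennaLaw_channel fun z => z q * conj (z q'),
    integral_mul_conj_complexGaussianDiag (fun q : Fin L × Fin K => lam1 q.1 q.2)
      fun q => hlam q.1 q.2]

theorem integral_noise_mul_conj_noise (hxi : 0 ≤ xi) (s s' : Fin T) :
    ∫ y, y.2.1 s * conj (y.2.1 s') ∂antennaLaw (L := L) (K := K) T lam1 xi =
      if s = s' then (xi : ℂ) else 0 := by
  have h := integral_antennaLaw_mul (T := T) (lam1 := lam1) (xi := xi) (fun _ => 1)
    (fun z => z s * conj (z s')) (fun _ => 1)
  rw [integral_mul_conj_complexGaussianDiag _ fun _ => hxi] at h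
  simpa using h

theorem energy_nonneg (l : Fin L) (m : Fin K) (s : Fin T) : 0 ≤ par.energy l m s := by
  unfold Params.energy
  split_ifs
  · positivity
  · exact par.p_nonneg l m

/-- At different channel uses the normalized factors are uncorrelated. At the same use the two
square roots multiply to the conditional variance, whose mean follows from `E|h|² = λ`. -/
theorem integral_antennaDistortion_mul_conj (hlam : ∀ l m, 0 ≤ lam1 l m) (s s' : Fin T) :
    ∫ y, antennaDistortion par s y * conj (antennaDistortion par s' y) ∂antennaLaw T lam1 xi =
      if s = s' then ((par.kappa ^ 2 * ∑ l, ∑ m, par.energy l m s * lam1 l m : ℝ) : ℂ) else 0 := by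
  have h := integral_antennaLaw_mul (T := T) (lam1 := lam1) (xi := xi)
    (fun z => ((√(par.kappa ^ 2 * ∑ l, ∑ m, par.energy l m s * ‖z (l, m)‖ ^ 2) : ℝ) : ℂ) *
      (√(par.kappa ^ 2 * ∑ l, ∑ m, par.energy l m s' * ‖z (l, m)‖ ^ 2) : ℝ))
    (fun _ => 1) (fun z => z s * conj (z s'))
  rw [integral_mul_conj_complexGaussianDiag _ fun _ => zero_le_one] at h
  have h1 : ∫ y, antennaDistortion par s y * conj (antennaDistortion par s' y)
      ∂antennaLaw T lam1 xi = (∫ z : Fin L × Fin K → ℂ,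
        ((√(par.kappa ^ 2 * ∑ l, ∑ m, par.energy l m s * ‖z (l, m)‖ ^ 2) : ℝ) : ℂ) *
      (√(par.kappa ^ 2 * ∑ l, ∑ m, par.energy l m s' * ‖z (l, m)‖ ^ 2) : ℝ)
        ∂complexGaussianDiag fun q : Fin L × Fin K => lam1 q.1 q.2) *
        if s = s' then 1 else 0 := by
    convert h using 1
    · refine integral_congr_ae (ae_of_all _ fun y => ?_)
      simp only [antennaDistortion, map_mul, Complex.conj_ofReal]
      ring
    · simp
  rw [h1]
  split_ifs with hs
  · subst hs
    rw [mul_one]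
    have h2 : ∀ z : Fin L × Fin K → ℂ,
        ((√(par.kappa ^ 2 * ∑ l, ∑ m, par.energy l m s * ‖z (l, m)‖ ^ 2) : ℝ) : ℂ) *
        (√(par.kappa ^ 2 * ∑ l, ∑ m, par.energy l m s * ‖z (l, m)‖ ^ 2) : ℝ) =
        ((par.kappa ^ 2 : ℝ) : ℂ) *
          ∑ l, ∑ m, (par.energy l m s : ℂ) * (z (l, m) * conj (z (l, m))) := by
      intro z
      rw [← Complex.ofReal_mul, Real.mul_self_sqrt (mul_nonneg (sq_nonneg _)
        (Finset.sum_nonneg fun l _ => Finset.sum_nonneg fun m _ =>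
          mul_nonneg (energy_nonneg par l m s) (sq_nonneg _)))]
      simp only [← ofReal_norm_sq]
      push_cast
      rfl
    have hi : ∀ q, Integrable (fun z : Fin L × Fin K → ℂ => z q * conj (z q))
        (complexGaussianDiag fun q : Fin L × Fin K => lam1 q.1 q.2) := fun q =>
      integrable_mul_conj (hasAllMoments_complexGaussianDiag _ q).memLp_two
        (hasAllMoments_complexGaussianDiag _ q).memLp_two
    simp_rw [h2]
    rw [integral_const_mul, integral_finsetSum _ fun l _ => integrable_finsetSum _ fun m _ =>
      (hi (l, m)).const_mul _]
    push_cast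
    congr 1
    refine Finset.sum_congr rfl fun l _ => ?_
    rw [integral_finsetSum _ fun m _ => (hi (l, m)).const_mul _]
    refine Finset.sum_congr rfl fun m _ => ?_
    rw [integral_const_mul,
      integral_mul_conj_complexGaussianDiag (fun q : Fin L × Fin K => lam1 q.1 q.2)
      fun q => hlam q.1 q.2,
      if_pos rfl]
  · simp

/-- The second moments of sums of three uncorrelated parts. -/
theorem integral_add_three_mul_conj {Ω : Type*} [MeasurableSpace Ω] {P : Measure Ω}
    {a d e a' d' e' : Ω → ℂ} (ha : MemLp a 2 P) (hd : MemLp d 2 P) (he : MemLp e 2 P)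
    (ha' : MemLp a' 2 P) (hd' : MemLp d' 2 P) (he' : MemLp e' 2 P)
    (had : ∫ ω, a ω * conj (d' ω) ∂P = 0) (hae : ∫ ω, a ω * conj (e' ω) ∂P = 0)
    (hda : ∫ ω, d ω * conj (a' ω) ∂P = 0) (hde : ∫ ω, d ω * conj (e' ω) ∂P = 0)
    (hea : ∫ ω, e ω * conj (a' ω) ∂P = 0) (hed : ∫ ω, e ω * conj (d' ω) ∂P = 0) :
    ∫ ω, (a ω + d ω + e ω) * conj (a' ω + d' ω + e' ω) ∂P =
      ∫ ω, a ω * conj (a' ω) ∂P + ∫ ω, d ω * conj (d' ω) ∂P + ∫ ω, e ω * conj (e' ω) ∂P := by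
  have h : ∀ ω, (a ω + d ω + e ω) * conj (a' ω + d' ω + e' ω) =
      (a ω * conj (a' ω) + (a ω * conj (d' ω) + a ω * conj (e' ω))) +
      ((d ω * conj (d' ω) + (d ω * conj (a' ω) + d ω * conj (e' ω))) +
      (e ω * conj (e' ω) + (e ω * conj (a' ω) + e ω * conj (d' ω)))) := by
    intro ω
    simp only [map_add]
    ring
  have i1 := integrable_mul_conj ha ha'
  have i2 := integrable_mul_conj ha hd'
  have i3 := integrable_mul_conj ha he'
  have i4 := integrable_mul_conj hd ha'
  have i5 := integrable_mul_conj hd hd'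
  have i6 := integrable_mul_conj hd he'
  have i7 := integrable_mul_conj he ha'
  have i8 := integrable_mul_conj he hd'
  have i9 := integrable_mul_conj he he'
  have i23 : Integrable (fun ω => a ω * conj (d' ω) + a ω * conj (e' ω)) P := i2.add i3
  have i46 : Integrable (fun ω => d ω * conj (a' ω) + d ω * conj (e' ω)) P := i4.add i6
  have i78 : Integrable (fun ω => e ω * conj (a' ω) + e ω * conj (d' ω)) P := i7.add i8
  have j1 : Integrable (fun ω => a ω * conj (a' ω) +
    (a ω * conj (d' ω) + a ω * conj (e' ω))) P := i1.add i23
  have j2 : Integrable (fun ω => d ω * conj (d' ω) +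
    (d ω * conj (a' ω) + d ω * conj (e' ω))) P := i5.add i46
  have j3 : Integrable (fun ω => e ω * conj (e' ω) +
    (e ω * conj (a' ω) + e ω * conj (d' ω))) P := i9.add i78
  have j23 : Integrable (fun ω => (d ω * conj (d' ω) +
    (d ω * conj (a' ω) + d ω * conj (e' ω))) + (e ω * conj (e' ω) +
    (e ω * conj (a' ω) + e ω * conj (d' ω)))) P := j2.add j3
  simp_rw [h]
  rw [integral_add j1 j23, integral_add j2 j3, integral_add i1 i23, integral_add i2 i3,
    integral_add i5 i46, integral_add i4 i6, integral_add i9 i78, integral_add i7 i8,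
    had, hae, hda, hde, hea, hed]
  ring

theorem integral_antennaPilot (b : Fin B) (θ : Fin (T + 1) → ℝ) :
    ∫ y, antennaPilot par b θ y ∂antennaLaw T lam1 xi = 0 := by
  have h1 : ∫ y : AntennaSpace L K T, ∑ l, ∑ m, y.1 (l, m) * par.x l m (par.tau b)
      ∂antennaLaw T lam1 xi = 0 := by
    rw [integral_finsetSum _ fun l _ => integrable_finsetSum _ fun m _ =>
      ((hasAllMoments_channel (l, m)).integrable.mul_const _)]
    refine Finset.sum_eq_zero fun l _ => ?_
    rw [integral_finsetSum _ fun m _ =>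
      ((hasAllMoments_channel (l, m)).integrable.mul_const _)]
    refine Finset.sum_eq_zero fun m _ => ?_
    rw [integral_mul_const, integral_antennaLaw_channel fun z => z (l, m),
      integral_complexGaussianDiag, zero_mul]
  have h2 := integral_channel_mul_antennaDistortion par (lam1 := lam1) (xi := xi)
    (fun _ => 1) (par.tau b)
  have h3 := integral_channel_mul_noise (L := L) (K := K) (T := T) (lam1 := lam1) (xi := xi)
    (fun _ => 1) (par.tau b)
  simp only [one_mul] at h2 h3
  unfold antennaPilot
  rw [integral_add (((hasAllMoments_channelSum par _).const_mul _).add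
    (hasAllMoments_antennaDistortion par _)).integrable (hasAllMoments_noise _).integrable,
    integral_add ((hasAllMoments_channelSum par _).const_mul _).integrable
      (hasAllMoments_antennaDistortion par _).integrable, integral_const_mul, h1, h2, h3]
  simp

theorem integral_channel_mul_conj_antennaPilot (hlam : ∀ l m, 0 ≤ lam1 l m) (l : Fin L)
    (m : Fin K) (c : Fin B) (θ : Fin (T + 1) → ℝ) :
    ∫ y, y.1 (l, m) * conj (antennaPilot par c θ y) ∂antennaLaw T lam1 xi =
      lam1 l m * conj (par.x l m (par.tau c)) *
        conj (Complex.exp (Complex.I * (θ (par.tau c).succ : ℂ))) := by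
  -- The channel is treated as a three-part signal whose distortion and noise parts are zero.
  have h0 : MemLp (fun _ : AntennaSpace L K T => (0 : ℂ)) 2 (antennaLaw T lam1 xi) := by simp
  have h := integral_add_three_mul_conj (P := antennaLaw T lam1 xi)
    (hasAllMoments_channel (l, m)).memLp_two h0 h0
    ((hasAllMoments_channelSum par (par.tau c)).const_mul
      (Complex.exp (Complex.I * (θ (par.tau c).succ : ℂ)))).memLp_two
    (hasAllMoments_antennaDistortion par (par.tau c)).memLp_two
    (hasAllMoments_noise (par.tau c)).memLp_two
    (integral_channel_mul_conj_antennaDistortion par (fun z => z (l, m)) _)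
    (integral_channel_mul_conj_noise (fun z => z (l, m)) _) (by simp) (by simp) (by simp) (by simp)
  simp only [zero_mul, add_zero, integral_zero] at h
  refine h.trans ?_
  have hi : ∀ q, Integrable (fun y : AntennaSpace L K T => y.1 (l, m) * conj (y.1 q))
      (antennaLaw T lam1 xi) := fun q =>
    integrable_mul_conj (hasAllMoments_channel _).memLp_two (hasAllMoments_channel q).memLp_two
  have h1 : ∀ y : AntennaSpace L K T, y.1 (l, m) *
      conj (Complex.exp (Complex.I * (θ (par.tau c).succ : ℂ)) *
        ∑ l, ∑ m, y.1 (l, m) * par.x l m (par.tau c)) =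
      ∑ q : Fin L × Fin K, y.1 (l, m) * conj (y.1 q) *
        (conj (par.x q.1 q.2 (par.tau c)) *
          conj (Complex.exp (Complex.I * (θ (par.tau c).succ : ℂ)))) := by
    intro y
    rw [Fintype.sum_prod_type, map_mul, map_sum]
    simp only [map_sum, map_mul, Finset.mul_sum]
    refine Finset.sum_congr rfl fun _ _ => Finset.sum_congr rfl fun _ _ => ?_
    ring
  simp_rw [h1]
  rw [integral_finsetSum _ fun q _ => (hi q).mul_const _]
  simp_rw [integral_mul_const, integral_channel_mul_conj_channel hlam]
  simp [mul_assoc]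

/-- With the phases frozen, the rotations factor out of the channel part; distortion and receiver
noise are uncorrelated over channel uses and contribute only for `b = c`. -/
theorem integral_antennaPilot_mul_conj (hlam : ∀ l m, 0 ≤ lam1 l m) (hxi : 0 ≤ xi) (b c : Fin B)
    (θ : Fin (T + 1) → ℝ) :
    ∫ y, antennaPilot par b θ y * conj (antennaPilot par c θ y) ∂antennaLaw T lam1 xi =
      Complex.exp (Complex.I * (θ (par.tau b).succ : ℂ)) *
        conj (Complex.exp (Complex.I * (θ (par.tau c).succ : ℂ))) *
        ∑ l, ∑ m, (lam1 l m : ℂ) * (par.x l m (par.tau b) * conj (par.x l m (par.tau c))) +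
      if b = c then
        ((par.kappa ^ 2 * ∑ l, ∑ m, ‖par.x l m (par.tau b)‖ ^ 2 * lam1 l m + xi : ℝ) : ℂ)
      else 0 := by
  have h := integral_add_three_mul_conj (P := antennaLaw T lam1 xi)
    ((hasAllMoments_channelSum par (par.tau b)).const_mul
      (Complex.exp (Complex.I * (θ (par.tau b).succ : ℂ)))).memLp_two
    (hasAllMoments_antennaDistortion par (par.tau b)).memLp_two
    (hasAllMoments_noise (par.tau b)).memLp_two
    ((hasAllMoments_channelSum par (par.tau c)).const_mul
      (Complex.exp (Complex.I * (θ (par.tau c).succ : ℂ)))).memLp_two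
    (hasAllMoments_antennaDistortion par (par.tau c)).memLp_two
    (hasAllMoments_noise (par.tau c)).memLp_two
    (integral_channel_mul_conj_antennaDistortion par
      (fun z => Complex.exp (Complex.I * (θ (par.tau b).succ : ℂ)) *
        ∑ l, ∑ m, z (l, m) * par.x l m (par.tau b)) _)
    (integral_channel_mul_conj_noise
      (fun z => Complex.exp (Complex.I * (θ (par.tau b).succ : ℂ)) *
        ∑ l, ∑ m, z (l, m) * par.x l m (par.tau b)) _)
    ?_ (integral_antennaDistortion_mul_conj_noise par _ _) ?_
    (integral_noise_mul_conj_antennaDistortion par _ _)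
  · refine h.trans ?_
    rw [integral_antennaDistortion_mul_conj par hlam, integral_noise_mul_conj_noise hxi, add_assoc]
    congr 1
    · have h1 : ∀ y : AntennaSpace L K T,
          Complex.exp (Complex.I * (θ (par.tau b).succ : ℂ)) *
            (∑ l, ∑ m, y.1 (l, m) * par.x l m (par.tau b)) *
          conj (Complex.exp (Complex.I * (θ (par.tau c).succ : ℂ)) *
            ∑ l, ∑ m, y.1 (l, m) * par.x l m (par.tau c)) =
          (Complex.exp (Complex.I * (θ (par.tau b).succ : ℂ)) *
            conj (Complex.exp (Complex.I * (θ (par.tau c).succ : ℂ)))) *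
          ∑ q : Fin L × Fin K, ∑ q' : Fin L × Fin K, y.1 q * conj (y.1 q') *
            (par.x q.1 q.2 (par.tau b) * conj (par.x q'.1 q'.2 (par.tau c))) := by
        intro y
        rw [← Fintype.sum_prod_type' fun l m => y.1 (l, m) * par.x l m (par.tau b),
          ← Fintype.sum_prod_type' fun l m => y.1 (l, m) * par.x l m (par.tau c)]
        simp only [map_sum, map_mul]
        rw [mul_mul_mul_comm, Finset.sum_mul_sum]
        congr 1
        refine Finset.sum_congr rfl fun _ _ => Finset.sum_congr rfl fun _ _ => ?_
        ring
      have hi : ∀ q q', Integrable (fun y : AntennaSpace L K T => y.1 q * conj (y.1 q'))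
          (antennaLaw T lam1 xi) := fun q q' =>
        integrable_mul_conj (hasAllMoments_channel _).memLp_two
          (hasAllMoments_channel q').memLp_two
      simp_rw [h1]
      rw [integral_const_mul, integral_finsetSum _ fun q _ => integrable_finsetSum _ fun q' _ =>
        (hi q q').mul_const _, ← Fintype.sum_prod_type' fun l m =>
          (lam1 l m : ℂ) * (par.x l m (par.tau b) * conj (par.x l m (par.tau c)))]
      congr 1
      refine Finset.sum_congr rfl fun q _ => ?_
      rw [integral_finsetSum _ fun q' _ => (hi q q').mul_const _]
      simp_rw [integral_mul_const, integral_channel_mul_conj_channel hlam]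
      simp
    -- At a pilot use `Params.energy` is the squared modulus of the pilot symbol. Distinct pilot
    -- indices are distinct channel uses because `tau` is injective.
    · rcases eq_or_ne b c with rfl | hbc
      · simp [Params.energy]
      · simp [hbc, par.tau_injective.ne hbc]
  · have h := integral_channel_mul_antennaDistortion par (lam1 := lam1) (xi := xi)
      (fun z => conj (Complex.exp (Complex.I * (θ (par.tau c).succ : ℂ)) *
        ∑ l, ∑ m, z (l, m) * par.x l m (par.tau c))) (par.tau b)
    simpa only [mul_comm] using h
  · have h := integral_channel_mul_noise (lam1 := lam1) (xi := xi)
      (fun z => conj (Complex.exp (Complex.I * (θ (par.tau c).succ : ℂ)) *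
        ∑ l, ∑ m, z (l, m) * par.x l m (par.tau c))) (par.tau b)
    simpa only [mul_comm] using h

/-- Only the distortion part of the pilot signal could correlate with the distortion at `t`, and it
belongs to another channel use since `t` is not a pilot use. -/
theorem integral_antennaDistortion_mul_conj_antennaPilot (hlam : ∀ l m, 0 ≤ lam1 l m) (c : Fin B)
    (θ : Fin (T + 1) → ℝ) {t : Fin T} (ht : t ∉ Set.range par.tau) :
    ∫ y, antennaDistortion par t y * conj (antennaPilot par c θ y) ∂antennaLaw T lam1 xi = 0 := by
  have h0 : MemLp (fun _ : AntennaSpace L K T => (0 : ℂ)) 2 (antennaLaw T lam1 xi) := by simp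
  have h := integral_add_three_mul_conj (P := antennaLaw T lam1 xi) h0
    (hasAllMoments_antennaDistortion par t).memLp_two h0
    ((hasAllMoments_channelSum par (par.tau c)).const_mul
      (Complex.exp (Complex.I * (θ (par.tau c).succ : ℂ)))).memLp_two
    (hasAllMoments_antennaDistortion par (par.tau c)).memLp_two
    (hasAllMoments_noise (par.tau c)).memLp_two (by simp) (by simp) ?_
    (integral_antennaDistortion_mul_conj_noise par _ _) (by simp) (by simp)
  · simp only [zero_mul, add_zero, zero_add, integral_zero] at h
    refine h.trans ?_
    rw [integral_antennaDistortion_mul_conj par hlam, if_neg fun h => ht ⟨c, h.symm⟩]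
  · have h := integral_channel_mul_antennaDistortion par (lam1 := lam1) (xi := xi)
      (fun z => conj (Complex.exp (Complex.I * (θ (par.tau c).succ : ℂ)) *
        ∑ l, ∑ m, z (l, m) * par.x l m (par.tau c))) t
    simpa only [mul_comm] using h

end Antenna

/-! ### Phase drifts -/

section Phase

variable {L K B T : ℕ}

/-- The correlation `e^{-δ|s-s'|/2}` of a phase drift at two channel uses. -/
def phaseCorr (delta : ℝ) (s s' : Fin T) : ℝ :=
  Real.exp (-(delta / 2) * |((s : ℕ) : ℝ) - ((s' : ℕ) : ℝ)|)

theorem phaseCorr_comm (delta : ℝ) (s s' : Fin T) :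
    phaseCorr delta s s' = phaseCorr delta s' s := by
  unfold phaseCorr
  rw [abs_sub_comm]

/-- The coefficient of the `i`-th innovation in the phase change between two channel uses. -/
def stepCoeff (s s' i : Fin T) : ℝ := (if i ≤ s then 1 else 0) - if i ≤ s' then 1 else 0

theorem sum_ite_le (s : Fin T) : ∑ i : Fin T, (if i ≤ s then (1 : ℝ) else 0) = (s : ℕ) + 1 := by
  rw [Finset.sum_boole]
  have : (Finset.univ.filter fun i : Fin T => i ≤ s) = Finset.Iic s := by ext; simp
  rw [this, Fin.card_Iic]
  push_cast
  rfl

/-- The coefficients are `0` or `1`, so squaring changes nothing, and the sum counts the innovations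
`i` with `s' < i ≤ s`. -/
theorem sum_stepCoeff_sq_of_le {s s' : Fin T} (h : s' ≤ s) :
    ∑ i, stepCoeff s s' i ^ 2 = |((s : ℕ) : ℝ) - ((s' : ℕ) : ℝ)| := by
  have h1 : ∀ i, stepCoeff s s' i ^ 2 =
      (if i ≤ s then (1 : ℝ) else 0) - if i ≤ s' then (1 : ℝ) else 0 := by
    intro i
    unfold stepCoeff
    by_cases hi : i ≤ s'
    · simp [hi, hi.trans h]
    · by_cases hi' : i ≤ s <;> simp [hi, hi']
  simp_rw [h1]
  have h2 : ((s' : ℕ) : ℝ) ≤ ((s : ℕ) : ℝ) := by exact_mod_cast h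
  rw [Finset.sum_sub_distrib, sum_ite_le, sum_ite_le, abs_of_nonneg (by linarith)]
  ring

theorem sum_stepCoeff_sq (s s' : Fin T) :
    ∑ i, stepCoeff s s' i ^ 2 = |((s : ℕ) : ℝ) - ((s' : ℕ) : ℝ)| := by
  rcases le_total s' s with h | h
  · exact sum_stepCoeff_sq_of_le h
  · rw [abs_sub_comm, ← sum_stepCoeff_sq_of_le h]
    exact Finset.sum_congr rfl fun i _ => by unfold stepCoeff; ring

theorem eq_add_sum_steps (f : Fin (T + 1) → ℝ) (s : Fin (T + 1)) :
    f s = f 0 + ∑ i : Fin T, if i.castSucc < s then f i.succ - f i.castSucc else 0 := by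
  induction s using Fin.induction with
  | zero => simp
  | succ j ih =>
    have h1 : ∀ i : Fin T, (if i.castSucc < j.succ then f i.succ - f i.castSucc else 0) =
        (if i.castSucc < j.castSucc then f i.succ - f i.castSucc else 0) +
          if i = j then f i.succ - f i.castSucc else 0 := by
      intro i
      rcases lt_trichotomy i j with h | h | h
      · have h' : i.castSucc < j.succ := by
          rw [Fin.lt_def] at *; simp; omega
        simp [h, h.ne, h']
      · subst h
        simp
      · have h' : ¬ i.castSucc < j.succ := by
          rw [Fin.lt_def] at *; simp; omega
        simp [h.not_gt, h.ne', h']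
    simp_rw [h1]
    rw [Finset.sum_add_distrib, ← add_assoc, ← ih]
    simp

/-- The initial phase cancels, which is why its law never matters. -/
theorem sub_eq_sum_stepCoeff (f : Fin (T + 1) → ℝ) (s s' : Fin T) :
    f s.succ - f s'.succ = ∑ i : Fin T, stepCoeff s s' i * (f i.succ - f i.castSucc) := by
  rw [eq_add_sum_steps f s.succ, eq_add_sum_steps f s'.succ, add_sub_add_left_eq_sub,
    ← Finset.sum_sub_distrib]
  refine Finset.sum_congr rfl fun i _ => ?_
  unfold stepCoeff
  -- The phase at channel use `s` is `phi s.succ`, so it contains the innovations `i ≤ s`, including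
  -- the `s`-th.
  simp only [Fin.castSucc_lt_succ_iff]
  split_ifs <;> ring

theorem integral_exp_linear_gaussian {Q : Type*} [Fintype Q] (c : Q → ℝ) (v : ℝ≥0) :
    ∫ x : Q → ℝ, Complex.exp (Complex.I * ((∑ q, c q * x q : ℝ) : ℂ))
      ∂Measure.pi (fun _ => gaussianReal 0 v) = (Real.exp (-(v / 2) * ∑ q, c q ^ 2) : ℂ) := by
  have h1 : ∀ x : Q → ℝ, Complex.exp (Complex.I * ((∑ q, c q * x q : ℝ) : ℂ)) =
      ∏ q, Complex.exp ((c q : ℂ) * (x q : ℂ) * Complex.I) := by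
    intro x
    rw [← Complex.exp_sum]
    push_cast
    rw [Finset.mul_sum]
    congr 1
    exact Finset.sum_congr rfl fun q _ => by ring
  simp_rw [h1]
  rw [integral_fintype_prod_eq_prod
    (fun q (y : ℝ) => Complex.exp ((c q : ℂ) * (y : ℂ) * Complex.I))]
  have h2 : ∀ q, ∫ y, Complex.exp ((c q : ℂ) * (y : ℂ) * Complex.I) ∂gaussianReal 0 v =
      Complex.exp (-((v : ℝ) / 2) * (c q : ℂ) ^ 2) := by
    intro q
    rw [← charFun_apply_real, charFun_gaussianReal]
    congr 1
    push_cast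
    ring
  simp_rw [h2]
  rw [← Complex.exp_sum, ← Finset.mul_sum]
  push_cast
  rfl

theorem exp_mul_conj_exp (a b : ℝ) :
    Complex.exp (Complex.I * (a : ℂ)) * conj (Complex.exp (Complex.I * (b : ℂ))) =
      Complex.exp (Complex.I * ((a - b : ℝ) : ℂ)) := by
  rw [← Complex.exp_conj, ← Complex.exp_add]
  congr 1
  simp
  ring

variable {ι : Type*}

/-- The factor `e^{i(φ_n(s) - φ_n(s'))}`. -/
def rotation (s s' : Fin T) (n : ι) (φ : Fin (T + 1) → ι → ℝ) : ℂ :=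
  Complex.exp (Complex.I * (φ s.succ n : ℂ)) * conj (Complex.exp (Complex.I * (φ s'.succ n : ℂ)))

theorem norm_rotation (s s' : Fin T) (n : ι) (φ : Fin (T + 1) → ι → ℝ) :
    ‖rotation s s' n φ‖ = 1 := by
  unfold rotation
  rw [norm_mul, RCLike.norm_conj, norm_exp_I_mul, norm_exp_I_mul, one_mul]

theorem measurable_rotation (s s' : Fin T) (n : ι) :
    Measurable (rotation (ι := ι) s s' n) := by
  unfold rotation
  exact (by fun_prop : Measurable _).mul (Complex.continuous_conj.measurable.comp (by fun_prop))

theorem integrable_rotation {μ : Measure (Fin (T + 1) → ι → ℝ)} [IsFiniteMeasure μ]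
    (s s' : Fin T) (n : ι) : Integrable (rotation s s' n) μ :=
  (integrable_const (1 : ℝ)).mono (measurable_rotation s s' n).aestronglyMeasurable
    (ae_of_all _ fun φ => by rw [norm_rotation]; simp)

theorem measurable_rotation_mul_conj (s s' r r' : Fin T) (n n' : ι) :
    Measurable fun φ : Fin (T + 1) → ι → ℝ => rotation s s' n φ * conj (rotation r r' n' φ) :=
  (measurable_rotation s s' n).mul
    (Complex.continuous_conj.measurable.comp (measurable_rotation r r' n'))

theorem integrable_rotation_mul_conj {μ : Measure (Fin (T + 1) → ι → ℝ)} [IsFiniteMeasure μ]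
    (s s' r r' : Fin T) (n n' : ι) :
    Integrable (fun φ => rotation s s' n φ * conj (rotation r r' n' φ)) μ :=
  (integrable_const (1 : ℝ)).mono
    (measurable_rotation_mul_conj s s' r r' n n').aestronglyMeasurable
    (ae_of_all _ fun φ => by rw [norm_mul, RCLike.norm_conj, norm_rotation, norm_rotation]; simp)

theorem rotation_eq_exp_step {Ω : Type*} (R : Receiver L K T ι Ω) (s s' : Fin T) (n : ι) (ω : Ω) :
    rotation s s' n (fun s n => R.phi s n ω) =
      Complex.exp (Complex.I * ((∑ i, stepCoeff s s' i * R.step i n ω : ℝ) : ℂ)) := by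
  unfold rotation Receiver.step
  rw [exp_mul_conj_exp, sub_eq_sum_stepCoeff fun s => R.phi s n ω]

/-- The properties of the law of the phase drifts that matter. -/
structure IsPhaseLaw (delta : ℝ) (osc : Oscillators) (μ : Measure (Fin (T + 1) → ι → ℝ)) :
    Prop where
  corr : ∀ s s' n, ∫ φ, rotation s s' n φ ∂μ = phaseCorr delta s s'
  common : osc = .common → ∀ s n n', ∀ᵐ φ ∂μ, φ s n = φ s n'
  separate : osc = .separate → ∀ s s' r r' n n', n ≠ n' →
    ∫ φ, rotation s s' n φ * conj (rotation r r' n' φ) ∂μ =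
      phaseCorr delta s s' * phaseCorr delta r r'

theorem integral_exp_steps {Ω Q : Type*} [MeasurableSpace Ω] [Fintype Q] {P : Measure Ω}
    {X : Q → Ω → ℝ} {delta : ℝ} (hdelta : 0 ≤ delta)
    (h : HasLaw (fun ω q => X q ω) (Measure.pi fun _ : Q => gaussianReal 0 delta.toNNReal) P)
    (c : Q → ℝ) :
    ∫ ω, Complex.exp (Complex.I * ((∑ q, c q * X q ω : ℝ) : ℂ)) ∂P =
      (Real.exp (-(delta / 2) * ∑ q, c q ^ 2) : ℂ) := by
  have h1 := h.integral_comp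
    (f := fun x : Q → ℝ => Complex.exp (Complex.I * ((∑ q, c q * x q : ℝ) : ℂ)))
    (Measurable.aestronglyMeasurable (by fun_prop))
  rw [integral_exp_linear_gaussian, Real.coe_toNNReal _ hdelta] at h1
  exact h1

/-- Rotations are exponentials of linear forms in the Gaussian innovations, so their means are
values of a characteristic function, determined by the sum of squared coefficients. -/
theorem Receiver.IsUplink.isPhaseLaw [Fintype ι] {Ω : Type*} [MeasurableSpace Ω] {P : Measure Ω}
    [IsProbabilityMeasure P] {par : Params L K B T} {R : Receiver L K T ι Ω} {osc : Oscillators}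
    {lam : Fin L → Fin K → ι → ℝ} (hR : R.IsUplink par osc lam P) :
    IsPhaseLaw par.delta osc (P.map fun ω s n => R.phi s n ω) := by
  classical
  have hphi : AEMeasurable (fun ω s n => R.phi s n ω) P :=
    aemeasurable_pi_lambda _ fun s => aemeasurable_pi_lambda _ fun n => hR.phase_aemeasurable s n
  have hd := par.delta_nonneg
  have hph := hR.phase
  refine ⟨fun s s' n => ?_, fun ho s n n' => ?_, fun ho s s' r r' n n' hn => ?_⟩
  · rw [integral_map hphi (measurable_rotation s s' n).aestronglyMeasurable]
    simp_rw [rotation_eq_exp_step R]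
    cases osc with
    | common =>
      rw [integral_exp_steps (X := fun i ω => R.step i n ω) hd (hph.2 n).1, sum_stepCoeff_sq]
      rfl
    | separate =>
      have h := integral_exp_steps (X := fun (q : Fin T × ι) ω => R.step q.1 q.2 ω) hd hph.1
        (fun q => if q.2 = n then stepCoeff s s' q.1 else 0)
      simp only [Fintype.sum_prod_type, ite_mul, zero_mul, ite_pow, Finset.sum_ite_eq',
        Finset.mem_univ, if_true, ne_eq, OfNat.ofNat_ne_zero, not_false_eq_true, zero_pow,
          sum_stepCoeff_sq] at h
      exact h
  · subst ho
    rw [ae_map_iff hphi (measurableSet_eq_fun (by fun_prop) (by fun_prop))]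
    exact hph.1 s n n'
  · subst ho
    rw [integral_map hphi
      (measurable_rotation_mul_conj s s' r r' n n').aestronglyMeasurable]
    simp_rw [rotation_eq_exp_step R, exp_mul_conj_exp]
    have h := integral_exp_steps (X := fun (q : Fin T × ι) ω => R.step q.1 q.2 ω) hd hph.1
      (fun q => (if q.2 = n then stepCoeff s s' q.1 else 0) -
        if q.2 = n' then stepCoeff r r' q.1 else 0)
    -- The two rotations involve innovations at different antennas. No coordinate carries both
    -- coefficients, so the cross term vanishes and the exponents add.
    have h2 : ∀ q : Fin T × ι, ((if q.2 = n then stepCoeff s s' q.1 else 0) -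
        if q.2 = n' then stepCoeff r r' q.1 else 0) ^ 2 =
        (if q.2 = n then stepCoeff s s' q.1 ^ 2 else 0) +
        if q.2 = n' then stepCoeff r r' q.1 ^ 2 else 0 := by
      intro q
      by_cases h1 : q.2 = n
      · have : q.2 ≠ n' := fun h' => hn (h1.symm.trans h')
        simp [h1, hn]
      · by_cases h3 : q.2 = n' <;> simp [h1, h3, hn.symm]
    simp only [h2] at h
    simp only [Fintype.sum_prod_type, sub_mul, ite_mul, zero_mul, Finset.sum_sub_distrib,
      Finset.sum_add_distrib, Finset.sum_ite_eq', Finset.mem_univ, if_true,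
      sum_stepCoeff_sq] at h
    rw [h]
    unfold phaseCorr
    rw [← Complex.ofReal_mul, ← Real.exp_add]
    congr 2
    ring

/-- The matrix of phase correlations is positive semidefinite. -/
theorem sum_phaseCorr_nonneg {delta : ℝ} (hdelta : 0 ≤ delta) (s : Fin B → Fin T) (c : Fin B → ℂ) :
    0 ≤ (∑ b, ∑ b', c b * conj (c b') * (phaseCorr delta (s b) (s b') : ℂ)).re := by
  -- The correlations are realized by unimodular variables `e^{iφ}`, for a phase started at zero;
  -- the quadratic form becomes the second moment of `∑ b, c b * w b`.
  let w : Fin B → (Fin T → ℝ) → ℂ := fun b x =>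
    Complex.exp (Complex.I * ((∑ i, (if i ≤ s b then 1 else 0) * x i : ℝ) : ℂ))
  let μ : Measure (Fin T → ℝ) := Measure.pi fun _ => gaussianReal 0 delta.toNNReal
  have hw : ∀ b, MemLp (fun x => c b * w b x) 2 μ := fun b =>
    (memLp_const ‖c b‖).mono (by fun_prop) (ae_of_all _ fun x => by
      simp only [w]
      rw [norm_mul, norm_exp_I_mul, mul_one, norm_norm])
  have h1 : ∀ b b', ∫ x, c b * w b x * conj (c b' * w b' x) ∂μ =
      c b * conj (c b') * (phaseCorr delta (s b) (s b') : ℂ) := by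
    intro b b'
    have h2 : ∀ x, c b * w b x * conj (c b' * w b' x) = c b * conj (c b') *
        Complex.exp (Complex.I * ((∑ i, stepCoeff (s b) (s b') i * x i : ℝ) : ℂ)) := by
      intro x
      rw [map_mul, mul_mul_mul_comm]
      simp only [w]
      rw [exp_mul_conj_exp, ← Finset.sum_sub_distrib]
      simp only [stepCoeff, sub_mul]
    simp_rw [h2]
    rw [integral_const_mul, integral_exp_linear_gaussian, Real.coe_toNNReal _ hdelta,
      sum_stepCoeff_sq]
    rfl
  have h3 := integral_norm_sum_sq hw
  simp_rw [h1] at h3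
  rw [← h3, Complex.ofReal_re]
  exact integral_nonneg fun x => by positivity

end Phase

/-! ### Random variables with moments bounded uniformly in a parameter -/

section UniformMoments

variable {Θ E : Type*} [MeasurableSpace Θ] [MeasurableSpace E]

/-- `g θ` is bounded, uniformly in the parameter `θ`, by a function with finite moments. -/
def UniformMoments (g : Θ → E → ℂ) (ν : Measure E) : Prop :=
  Measurable (Function.uncurry g) ∧
    ∃ F : E → ℝ, HasAllMoments F ν ∧ ∀ θ y, ‖g θ y‖ ≤ F y

namespace UniformMoments

variable {g g' : Θ → E → ℂ} {ν : Measure E}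

theorem measurable_apply (hg : UniformMoments g ν) (θ : Θ) : Measurable (g θ) :=
  hg.1.comp measurable_prodMk_left

theorem hasAllMoments (hg : UniformMoments g ν) (θ : Θ) : HasAllMoments (g θ) ν := by
  obtain ⟨F, hF, h⟩ := hg.2
  exact hF.mono (hg.measurable_apply θ).aestronglyMeasurable
    fun y => (h θ y).trans (le_abs_self _)

theorem add (hg : UniformMoments g ν) (hg' : UniformMoments g' ν) :
    UniformMoments (fun θ y => g θ y + g' θ y) ν := by
  obtain ⟨F, hF, h⟩ := hg.2
  obtain ⟨F', hF', h'⟩ := hg'.2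
  exact ⟨hg.1.add hg'.1, _, hF.add hF',
    fun θ y => (norm_add_le _ _).trans (add_le_add (h θ y) (h' θ y))⟩

theorem mul (hg : UniformMoments g ν) (hg' : UniformMoments g' ν) :
    UniformMoments (fun θ y => g θ y * g' θ y) ν := by
  obtain ⟨F, hF, h⟩ := hg.2
  obtain ⟨F', hF', h'⟩ := hg'.2
  refine ⟨hg.1.mul hg'.1, _, hF.mul hF', fun θ y => ?_⟩
  rw [norm_mul]
  exact mul_le_mul (h θ y) (h' θ y) (norm_nonneg _) ((norm_nonneg _).trans (h θ y))

theorem conj_comp (hg : UniformMoments g ν) : UniformMoments (fun θ y => conj (g θ y)) ν := by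
  obtain ⟨F, hF, h⟩ := hg.2
  refine ⟨Complex.continuous_conj.measurable.comp hg.1, F, hF, fun θ y => ?_⟩
  rw [RCLike.norm_conj]
  exact h θ y

theorem const [IsFiniteMeasure ν] (c : ℂ) : UniformMoments (fun (_ : Θ) (_ : E) => c) ν :=
  ⟨measurable_const, fun _ => ‖c‖, HasAllMoments.const _, fun _ _ => le_rfl⟩

theorem const_mul [IsFiniteMeasure ν] (c : ℂ) (hg : UniformMoments g ν) :
    UniformMoments (fun θ y => c * g θ y) ν := (const c).mul hg

theorem sub [IsFiniteMeasure ν] (hg : UniformMoments g ν) (hg' : UniformMoments g' ν) :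
    UniformMoments (fun θ y => g θ y - g' θ y) ν := by
  convert hg.add (hg'.const_mul (-1)) using 3
  ring

theorem sum [IsFiniteMeasure ν] {κ : Type*} [Fintype κ] {g : κ → Θ → E → ℂ}
    (hg : ∀ i, UniformMoments (g i) ν) : UniformMoments (fun θ y => ∑ i, g i θ y) ν := by
  choose hm F hF h using hg
  exact ⟨Finset.measurable_fun_sum _ fun i _ => hm i, _, HasAllMoments.sum fun i _ => hF i,
    fun θ y => (norm_sum_le _ _).trans (Finset.sum_le_sum fun i _ => h i θ y)⟩

theorem of_hasAllMoments {f : E → ℂ} (hf : HasAllMoments f ν) (hm : Measurable f) :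
    UniformMoments (fun (_ : Θ) y => f y) ν :=
  ⟨hm.comp measurable_snd, _, hf.norm, fun _ _ => le_rfl⟩

end UniformMoments

end UniformMoments

/-! ### Antenna terms with uniformly bounded moments -/

theorem UniformMoments.measurable_uncurry_antenna {ι E : Type*} [MeasurableSpace E] {S : ℕ}
    {g : (Fin S → ℝ) → E → ℂ} {ν : Measure E}
    (hg : UniformMoments g ν) (n : ι) :
    Measurable (Function.uncurry fun (φ : Fin S → ι → ℝ) y => g (fun s => φ s n) y) :=
  hg.1.comp (by fun_prop :
    Measurable fun z : (Fin S → ι → ℝ) × E => ((fun s => z.1 s n), z.2))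

section AntennaSums

variable {ι E : Type*} [Fintype ι] [MeasurableSpace E] {S : ℕ}
  {μ : Measure (Fin S → ι → ℝ)} [IsProbabilityMeasure μ] {ν : ι → Measure E}
  [∀ n, IsProbabilityMeasure (ν n)]

theorem memLp_antenna {g : ι → (Fin S → ℝ) → E → ℂ} (hg : ∀ n, UniformMoments (g n) (ν n))
    (n : ι) : MemLp (fun ω : (Fin S → ι → ℝ) × (ι → E) => g n (fun s => ω.1 s n) (ω.2 n)) 2
      (μ.prod (Measure.pi ν)) := by
  have hm := fun n => (hg n).measurable_uncurry_antenna n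
  choose _ F hF h using hg
  exact memLp_two_prod_of_bound hm (fun n => (hF n).memLp_two) (fun n φ y => h n _ y) n

theorem integral_antenna {g : ι → (Fin S → ℝ) → E → ℂ} (hg : ∀ n, UniformMoments (g n) (ν n))
    (n : ι) : ∫ ω : (Fin S → ι → ℝ) × (ι → E), g n (fun s => ω.1 s n) (ω.2 n)
      ∂μ.prod (Measure.pi ν) = ∫ φ, ∫ y, g n (fun s => φ s n) y ∂ν n ∂μ := by
  have hm := fun n => (hg n).measurable_uncurry_antenna n
  choose _ F hF h using hg
  exact integral_prod_eval hm (fun n => (hF n).memLp_two) (fun n φ y => h n _ y) n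

/-- Given the phases, the integral factors over the two antennas, and one factor is a vanishing
conditional mean. -/
theorem integral_antenna_mul_conj_of_ne {g g' : ι → (Fin S → ℝ) → E → ℂ}
    (hg : ∀ n, UniformMoments (g n) (ν n)) (hg' : ∀ n, UniformMoments (g' n) (ν n))
    (h0 : ∀ n θ, ∫ y, g' n θ y ∂ν n = 0) {n n' : ι} (hn : n ≠ n') :
    ∫ ω : (Fin S → ι → ℝ) × (ι → E), g n (fun s => ω.1 s n) (ω.2 n) *
      conj (g' n' (fun s => ω.1 s n') (ω.2 n')) ∂μ.prod (Measure.pi ν) = 0 := by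
  rw [integral_prod _ (integrable_mul_conj (memLp_antenna hg n) (memLp_antenna hg' n'))]
  simp only
  simp_rw [fun φ : Fin S → ι → ℝ => integral_pi_eval_mul_conj (ν := ν)
    ((hg n).measurable_apply fun s => φ s n) ((hg' n').measurable_apply fun s => φ s n') hn, h0]
  simp

end AntennaSums

/-- The second moment of a sum over the antennas of `A` subarrays with `n` antennas each, up to
terms of order `n`. -/
theorem exists_bound_integral_norm_sum_sq {A S : ℕ} {E : Type*} [MeasurableSpace E]
    {ν : Fin A → Measure E} [∀ a, IsProbabilityMeasure (ν a)] {g : Fin A → (Fin S → ℝ) → E → ℂ}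
    (hg : ∀ a, UniformMoments (g a) (ν a)) :
    ∃ C : ℝ, ∀ (n : ℕ) (μ : Measure (Fin S → Fin A × Fin n → ℝ)) [IsProbabilityMeasure μ],
      |∫ ω : (Fin S → Fin A × Fin n → ℝ) × (Fin A × Fin n → E),
          ‖∑ q, g q.1 (fun s => ω.1 s q) (ω.2 q)‖ ^ 2 ∂μ.prod (Measure.pi fun q => ν q.1) -
        ∫ φ, ‖∑ q : Fin A × Fin n, ∫ y, g q.1 (fun s => φ s q) y ∂ν q.1‖ ^ 2 ∂μ| ≤ C * n := by
  have hm := fun (n : ℕ) (q : Fin A × Fin n) => (hg q.1).measurable_uncurry_antenna q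
  choose _ F hF h using hg
  -- There are `A * n` antennas, and the sum over the subarrays bounds the second moment in each of
  -- them. The constant depends neither on `n` nor on the law of the phases.
  refine ⟨A * ∑ a, ∫ z, F a z ^ 2 ∂ν a, fun n μ _ => ?_⟩
  have h1 := integral_norm_sum_sq_condIndep (μ := μ) (ν := fun q : Fin A × Fin n => ν q.1)
    (F := fun q => F q.1) (C := ∑ a, ∫ z, F a z ^ 2 ∂ν a) (hm n) (fun q => (hF q.1).memLp_two)
    (fun q φ y => h q.1 _ y)
    (fun q => Finset.single_le_sum (f := fun a => ∫ z, F a z ^ 2 ∂ν a)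
      (fun a _ => integral_nonneg fun z => sq_nonneg _) (Finset.mem_univ q.1))
  rw [abs_of_nonneg h1.1]
  refine h1.2.trans (le_of_eq ?_)
  simp only [Fintype.card_prod, Fintype.card_fin]
  push_cast
  ring

/-! ### Linear minimum mean-squared error estimation -/

/-- An estimate that is at least as good as one with orthogonal error coincides with it. -/
theorem ae_eq_of_orthogonal {ι κ Ω : Type*} [Fintype ι] [Fintype κ] [MeasurableSpace Ω]
    {P : Measure Ω} {X : ι → Ω → ℂ} {ψ : Ω → κ → ℂ} (hX : ∀ n, MemLp (X n) 2 P)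
    (hψ : ∀ q, MemLp (fun ω => ψ ω q) 2 P) {W W₀ : Matrix ι κ ℂ}
    (h₀ : ∀ n q, ∫ ω, (X n ω - (W₀ *ᵥ ψ ω) n) * conj (ψ ω q) ∂P = 0)
    (hW : ∫ ω, ∑ n, ‖X n ω - (W *ᵥ ψ ω) n‖ ^ 2 ∂P ≤
      ∫ ω, ∑ n, ‖X n ω - (W₀ *ᵥ ψ ω) n‖ ^ 2 ∂P) :
    ∀ᵐ ω ∂P, ∀ n, (W *ᵥ ψ ω) n = (W₀ *ᵥ ψ ω) n := by
  have hlin : ∀ (V : Matrix ι κ ℂ) n, MemLp (fun ω => (V *ᵥ ψ ω) n) 2 P := fun V n =>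
    memLp_finsetSum Finset.univ fun q _ => (hψ q).const_mul (V n q)
  have he : ∀ n, MemLp (fun ω => X n ω - (W₀ *ᵥ ψ ω) n) 2 P := fun n => (hX n).sub (hlin W₀ n)
  have hd : ∀ n, MemLp (fun ω => ((W - W₀) *ᵥ ψ ω) n) 2 P := hlin (W - W₀)
  -- The error is orthogonal to each observation, hence to the linear combination by which the two
  -- estimates differ.
  have horth : ∀ n, ∫ ω, (X n ω - (W₀ *ᵥ ψ ω) n) * conj (((W - W₀) *ᵥ ψ ω) n) ∂P = 0 := by
    intro n
    have h1 : ∀ ω, (X n ω - (W₀ *ᵥ ψ ω) n) * conj (((W - W₀) *ᵥ ψ ω) n) =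
        ∑ q, conj ((W - W₀) n q) * ((X n ω - (W₀ *ᵥ ψ ω) n) * conj (ψ ω q)) := by
      intro ω
      rw [show ((W - W₀) *ᵥ ψ ω) n = ∑ q, (W - W₀) n q * ψ ω q from rfl, map_sum, Finset.mul_sum]
      refine Finset.sum_congr rfl fun q _ => ?_
      rw [map_mul]
      ring
    simp_rw [h1]
    rw [integral_finsetSum _ fun q _ => (integrable_mul_conj (he n) (hψ q)).const_mul _]
    refine Finset.sum_eq_zero fun q _ => ?_
    rw [integral_const_mul, h₀, mul_zero]
  -- Pythagoras: the excess error of `W` is the mean square of the difference of the estimates,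
  -- which `hW` then forces to vanish.
  have hpt : ∀ n, ∫ ω, ‖X n ω - (W *ᵥ ψ ω) n‖ ^ 2 ∂P =
      ∫ ω, ‖X n ω - (W₀ *ᵥ ψ ω) n‖ ^ 2 ∂P + ∫ ω, ‖((W - W₀) *ᵥ ψ ω) n‖ ^ 2 ∂P := by
    intro n
    have h1 : ∀ ω, ‖X n ω - (W *ᵥ ψ ω) n‖ ^ 2 =
        (‖X n ω - (W₀ *ᵥ ψ ω) n‖ ^ 2 + ‖((W - W₀) *ᵥ ψ ω) n‖ ^ 2) -
        2 * ((X n ω - (W₀ *ᵥ ψ ω) n) * conj (((W - W₀) *ᵥ ψ ω) n)).re := by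
      intro ω
      have : X n ω - (W *ᵥ ψ ω) n = (X n ω - (W₀ *ᵥ ψ ω) n) - ((W - W₀) *ᵥ ψ ω) n := by
        rw [Matrix.sub_mulVec]
        simp
      rw [this, ← Complex.normSq_eq_norm_sq, ← Complex.normSq_eq_norm_sq,
        ← Complex.normSq_eq_norm_sq, Complex.normSq_sub]
    have hi := integrable_mul_conj (he n) (hd n)
    have hi' : Integrable (fun ω =>
        ((X n ω - (W₀ *ᵥ ψ ω) n) * conj (((W - W₀) *ᵥ ψ ω) n)).re) P := hi.re
    have hs : Integrable (fun ω =>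
        ‖X n ω - (W₀ *ᵥ ψ ω) n‖ ^ 2 + ‖((W - W₀) *ᵥ ψ ω) n‖ ^ 2) P :=
      (he n).norm.integrable_sq.add (hd n).norm.integrable_sq
    have hre : ∫ ω, ((X n ω - (W₀ *ᵥ ψ ω) n) * conj (((W - W₀) *ᵥ ψ ω) n)).re ∂P = 0 := by
      have := integral_re hi
      rw [horth] at this
      simpa using this
    simp_rw [h1]
    rw [integral_sub hs (hi'.const_mul 2), integral_const_mul, hre,
      integral_add (he n).norm.integrable_sq (hd n).norm.integrable_sq]
    ring
  have hXW : ∀ n, MemLp (fun ω => X n ω - (W *ᵥ ψ ω) n) 2 P := fun n => (hX n).sub (hlin W n)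
  rw [integral_finsetSum _ fun n _ => (hXW n).norm.integrable_sq,
    integral_finsetSum _ fun n _ => (he n).norm.integrable_sq] at hW
  have hsum : ∑ n, ∫ ω, ‖((W - W₀) *ᵥ ψ ω) n‖ ^ 2 ∂P ≤ 0 := by
    have h2 := Finset.sum_congr (rfl : (Finset.univ : Finset ι) = Finset.univ) fun n _ => hpt n
    rw [Finset.sum_add_distrib] at h2
    have h3 : ∑ n, ∫ ω, ‖X n ω - (W *ᵥ ψ ω) n‖ ^ 2 ∂P ≤
      ∑ n, ∫ ω, ‖X n ω - (W₀ *ᵥ ψ ω) n‖ ^ 2 ∂P := hW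
    linarith
  have hnn : ∀ n, 0 ≤ ∫ ω, ‖((W - W₀) *ᵥ ψ ω) n‖ ^ 2 ∂P :=
    fun n => integral_nonneg fun ω => sq_nonneg _
  rw [ae_all_iff]
  intro n
  have hz : ∫ ω, ‖((W - W₀) *ᵥ ψ ω) n‖ ^ 2 ∂P = 0 :=
    le_antisymm ((Finset.single_le_sum (fun n _ => hnn n) (Finset.mem_univ n)).trans hsum) (hnn n)
  rw [integral_eq_zero_iff_of_nonneg (fun ω => sq_nonneg _) (hd n).norm.integrable_sq] at hz
  filter_upwards [hz] with ω hω
  have h4 : ((W - W₀) *ᵥ ψ ω) n = 0 := by simpa using hω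
  rw [Matrix.sub_mulVec] at h4
  exact sub_eq_zero.1 h4

/-- There are no cross terms, so no independence is needed to get linear growth. This handles the
filter power `E{‖v‖²}`. -/
theorem exists_bound_integral_sum_norm_sq {A S : ℕ} {E : Type*} [MeasurableSpace E]
    {ν : Fin A → Measure E} [∀ a, IsProbabilityMeasure (ν a)] {g : Fin A → (Fin S → ℝ) → E → ℂ}
    (hg : ∀ a, UniformMoments (g a) (ν a)) :
    ∃ C : ℝ, ∀ (n : ℕ) (μ : Measure (Fin S → Fin A × Fin n → ℝ)) [IsProbabilityMeasure μ],
      |∫ ω : (Fin S → Fin A × Fin n → ℝ) × (Fin A × Fin n → E),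
          ∑ q, ‖g q.1 (fun s => ω.1 s q) (ω.2 q)‖ ^ 2 ∂μ.prod (Measure.pi fun q => ν q.1)| ≤
        C * n := by
  have hL := fun (n : ℕ) (μ : Measure (Fin S → Fin A × Fin n → ℝ)) [IsProbabilityMeasure μ] =>
    memLp_antenna (μ := μ) (ν := fun q : Fin A × Fin n => ν q.1) (g := fun q => g q.1)
      fun q => hg q.1
  choose _ F hF h using hg
  refine ⟨∑ a, ∫ z, F a z ^ 2 ∂ν a, fun n μ _ => ?_⟩
  have hp : ∀ q : Fin A × Fin n, MeasurePreserving
      (fun ω : (Fin S → Fin A × Fin n → ℝ) × (Fin A × Fin n → E) => ω.2 q)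
      (μ.prod (Measure.pi fun q => ν q.1)) (ν q.1) := fun q =>
    (measurePreserving_eval (fun q : Fin A × Fin n => ν q.1) q).comp measurePreserving_snd
  have hFi : ∀ q : Fin A × Fin n, Integrable
      (fun ω : (Fin S → Fin A × Fin n → ℝ) × (Fin A × Fin n → E) => F q.1 (ω.2 q) ^ 2)
      (μ.prod (Measure.pi fun q => ν q.1)) := fun q =>
    ((hF q.1).memLp_two.comp_measurePreserving (hp q)).integrable_sq
  rw [abs_of_nonneg (integral_nonneg fun ω => Finset.sum_nonneg fun q _ => sq_nonneg _)]
  refine (integral_mono (integrable_finsetSum _ fun q _ => (hL n μ q).norm.integrable_sq)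
    (integrable_finsetSum Finset.univ fun q _ => hFi q) fun ω => Finset.sum_le_sum fun q _ =>
      pow_le_pow_left₀ (norm_nonneg _) (h q.1 _ (ω.2 q)) 2).trans ?_
  rw [integral_finsetSum _ fun q _ => hFi q]
  have he : ∀ q : Fin A × Fin n,
      ∫ ω : (Fin S → Fin A × Fin n → ℝ) × (Fin A × Fin n → E), F q.1 (ω.2 q) ^ 2
        ∂μ.prod (Measure.pi fun q => ν q.1) = ∫ z, F q.1 z ^ 2 ∂ν q.1 := by
    intro q
    have hm : AEStronglyMeasurable (fun z => F q.1 z ^ 2)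
        (Measure.map (fun ω : (Fin S → Fin A × Fin n → ℝ) × (Fin A × Fin n → E) => ω.2 q)
          (μ.prod (Measure.pi fun q => ν q.1))) := by
      rw [(hp q).map_eq]
      exact (hF q.1).memLp_two.integrable_sq.aestronglyMeasurable
    rw [← integral_map (hp q).measurable.aemeasurable hm, (hp q).map_eq]
  simp_rw [he]
  rw [Fintype.sum_prod_type]
  simp only [Finset.sum_const, Finset.card_univ, Fintype.card_fin, nsmul_eq_mul]
  rw [← Finset.mul_sum, mul_comm]

/-! ### Sums of phase rotations over the antennas -/

section RotationSums

variable {A B T : ℕ}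

/-- The limit, relative to the squared subarray size, of the second moment of a sum over the
antennas of linear combinations of phase rotations. -/
def rotationLimit (delta : ℝ) (tau : Fin B → Fin T) (t : Fin T) (κ : Fin A → Fin B → ℂ) :
    Oscillators → ℝ
  | .common => (∑ a, ∑ a', ∑ b, ∑ c,
      κ a b * conj (κ a' c) * (phaseCorr delta (tau c) (tau b) : ℂ)).re
  | .separate => ‖∑ a, ∑ b, κ a b * (phaseCorr delta t (tau b) : ℂ)‖ ^ 2

theorem memLp_sum_rotation {ι : Type*} {μ : Measure (Fin (T + 1) → ι → ℝ)} [IsFiniteMeasure μ]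
    (tau : Fin B → Fin T) (t : Fin T) (κ : Fin B → ℂ) (n : ι) :
    MemLp (fun φ => ∑ b, κ b * rotation t (tau b) n φ) 2 μ :=
  memLp_finsetSum Finset.univ fun b _ => MemLp.const_mul
    ((memLp_const (1 : ℝ)).mono (measurable_rotation t (tau b) n).aestronglyMeasurable
      (ae_of_all _ fun φ => by rw [norm_rotation]; simp)) _

theorem norm_sum_rotation_le {ι : Type*} (tau : Fin B → Fin T) (t : Fin T) (κ : Fin B → ℂ) (n : ι)
    (φ : Fin (T + 1) → ι → ℝ) : ‖∑ b, κ b * rotation t (tau b) n φ‖ ≤ ∑ b, ‖κ b‖ := by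
  refine (norm_sum_le _ _).trans (Finset.sum_le_sum fun b _ => ?_)
  rw [norm_mul, norm_rotation, mul_one]

theorem integral_sum_rotation {ι : Type*} {μ : Measure (Fin (T + 1) → ι → ℝ)} [IsFiniteMeasure μ]
    {delta : ℝ} {osc : Oscillators} (hμ : IsPhaseLaw delta osc μ)
    (tau : Fin B → Fin T) (t : Fin T) (κ : Fin B → ℂ) (n : ι) :
    ∫ φ, ∑ b, κ b * rotation t (tau b) n φ ∂μ =
      ∑ b, κ b * (phaseCorr delta t (tau b) : ℂ) := by
  rw [integral_finsetSum _ fun b _ => (integrable_rotation t (tau b) n).const_mul _]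
  simp_rw [integral_const_mul, hμ.corr]

theorem integral_sum_rotation_mul_conj {ι : Type*} {μ : Measure (Fin (T + 1) → ι → ℝ)}
    [IsFiniteMeasure μ] (tau : Fin B → Fin T) (t : Fin T) (κ κ' : Fin B → ℂ) (n n' : ι) :
    ∫ φ, (∑ b, κ b * rotation t (tau b) n φ) * conj (∑ b, κ' b * rotation t (tau b) n' φ) ∂μ =
      ∑ b, ∑ c, κ b * conj (κ' c) *
        ∫ φ, rotation t (tau b) n φ * conj (rotation t (tau c) n' φ) ∂μ := by
  have h1 : ∀ φ : Fin (T + 1) → ι → ℝ, (∑ b, κ b * rotation t (tau b) n φ) *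
      conj (∑ b, κ' b * rotation t (tau b) n' φ) =
      ∑ b, ∑ c, κ b * conj (κ' c) * (rotation t (tau b) n φ * conj (rotation t (tau c) n' φ)) := by
    intro φ
    rw [map_sum, Finset.sum_mul_sum]
    refine Finset.sum_congr rfl fun b _ => Finset.sum_congr rfl fun c _ => ?_
    rw [map_mul]
    ring
  simp_rw [h1]
  have hi := fun b c => (integrable_rotation_mul_conj (μ := μ) t (tau b) t (tau c) n n').const_mul
    (κ b * conj (κ' c))
  rw [integral_finsetSum _ fun b _ => integrable_finsetSum _ fun c _ => hi b c]
  refine Finset.sum_congr rfl fun b _ => ?_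
  rw [integral_finsetSum _ fun c _ => hi b c]
  simp_rw [integral_const_mul]

/-- Both antennas share the phase at `t`, so `e^{iφ(t)}` meets its own conjugate and drops out. What
is left is the rotation between the uses `s'` and `s`. -/
theorem IsPhaseLaw.integral_rotation_mul_conj_common {ι : Type*}
    {μ : Measure (Fin (T + 1) → ι → ℝ)} {delta : ℝ} (hμ : IsPhaseLaw delta .common μ)
    (t s s' : Fin T) (n n' : ι) :
    ∫ φ, rotation t s n φ * conj (rotation t s' n' φ) ∂μ = phaseCorr delta s' s := by
  rw [← hμ.corr s' s n]
  refine integral_congr_ae ?_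
  filter_upwards [hμ.common rfl t.succ n' n, hμ.common rfl s'.succ n' n] with φ h1 h2
  unfold rotation
  rw [h1, h2]
  have h : Complex.exp (Complex.I * (φ t.succ n : ℂ)) *
      conj (Complex.exp (Complex.I * (φ t.succ n : ℂ))) = 1 := by
    rw [exp_mul_conj_exp]
    simp
  simp only [map_mul, Complex.conj_conj]
  linear_combination (Complex.exp (Complex.I * (φ s'.succ n : ℂ)) *
    conj (Complex.exp (Complex.I * (φ s.succ n : ℂ)))) * h

theorem exists_bound_integral_rotation_sums (delta : ℝ) (tau : Fin B → Fin T) (t : Fin T)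
    (κ : Fin A → Fin B → ℂ) (osc : Oscillators) :
    ∃ C : ℝ, ∀ (n : ℕ) (μ : Measure (Fin (T + 1) → Fin A × Fin n → ℝ)) [IsProbabilityMeasure μ],
      IsPhaseLaw delta osc μ →
      |∫ φ, ‖∑ q : Fin A × Fin n, ∑ b, κ q.1 b * rotation t (tau b) q φ‖ ^ 2 ∂μ -
        (n : ℝ) ^ 2 * rotationLimit delta tau t κ osc| ≤ C * n := by
  cases osc with
  | common =>
    -- With a common oscillator the correlations do not depend on the antennas, so summation over
    -- pairs gives the factor `n²` exactly, without error.
    refine ⟨0, fun n μ _ hμ => ?_⟩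
    rw [zero_mul, abs_nonpos_iff, sub_eq_zero]
    have h1 := integral_norm_sum_sq (P := μ)
      (fun q : Fin A × Fin n => memLp_sum_rotation tau t (κ q.1) q)
    simp_rw [integral_sum_rotation_mul_conj, hμ.integral_rotation_mul_conj_common] at h1
    rw [← Complex.ofReal_re (∫ φ, _ ∂μ), h1]
    unfold rotationLimit
    simp only [Fintype.sum_prod_type, Finset.sum_const, Finset.card_univ, Fintype.card_fin,
      nsmul_eq_mul]
    rw [← Complex.re_ofReal_mul]
    congr 1
    push_cast
    simp_rw [← Finset.mul_sum]
    ring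
  | separate =>
    -- With separate oscillators the terms are uncorrelated over the antennas, so the second moment
    -- exceeds the squared mean by at most `A * n` times a bound for one term; rotations have
    -- modulus one.
    refine ⟨A * ∑ a, (∑ b, ‖κ a b‖) ^ 2, fun n μ _ hμ => ?_⟩
    have h1 := integral_norm_sum_sq_sub_mem (P := μ)
      (X := fun (q : Fin A × Fin n) φ => ∑ b, κ q.1 b * rotation t (tau b) q φ)
      (C := ∑ a, (∑ b, ‖κ a b‖) ^ 2)
      (fun q => memLp_sum_rotation tau t (κ q.1) q)
      (fun q q' hq => by
        rw [integral_sum_rotation_mul_conj, integral_sum_rotation hμ, integral_sum_rotation hμ,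
          map_sum, Finset.sum_mul_sum]
        refine Finset.sum_congr rfl fun b _ => Finset.sum_congr rfl fun c _ => ?_
        rw [hμ.separate rfl _ _ _ _ _ _ hq, map_mul, Complex.conj_ofReal]
        ring)
      (fun q => by
        refine (integral_mono_of_nonneg (ae_of_all _ fun φ => sq_nonneg _)
          (integrable_const ((∑ b, ‖κ q.1 b‖) ^ 2)) (ae_of_all _ fun φ =>
            pow_le_pow_left₀ (norm_nonneg _) (norm_sum_rotation_le tau t (κ q.1) q φ) 2)).trans ?_
        rw [integral_const, probReal_univ, one_smul]
        exact Finset.single_le_sum (f := fun a => (∑ b, ‖κ a b‖) ^ 2)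
          (fun a _ => sq_nonneg _) (Finset.mem_univ q.1))
    simp_rw [integral_sum_rotation hμ] at h1
    have h2 : ‖∑ q : Fin A × Fin n, ∑ b, κ q.1 b * (phaseCorr delta t (tau b) : ℂ)‖ ^ 2 =
        (n : ℝ) ^ 2 * rotationLimit delta tau t κ .separate := by
      unfold rotationLimit
      simp only [Fintype.sum_prod_type, Finset.sum_const, Finset.card_univ, Fintype.card_fin,
        nsmul_eq_mul]
      rw [← Finset.mul_sum, norm_mul, mul_pow, Complex.norm_natCast]
    rw [h2] at h1
    rw [abs_of_nonneg h1.1]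
    refine h1.2.trans (le_of_eq ?_)
    simp only [Fintype.card_prod, Fintype.card_fin]
    push_cast
    ring

end RotationSums

/-! ### Filters acting separately on each antenna -/

section Filter

variable {L K B T : ℕ} (par : Params L K B T) {lam1 : Fin L → Fin K → ℝ} {xi : ℝ}

/-- A linear combination of the pilot signals received at one antenna. -/
def antennaFilter (w : Fin B → ℂ) (θ : Fin (T + 1) → ℝ) (y : AntennaSpace L K T) : ℂ :=
  ∑ b, w b * antennaPilot par b θ y

/-- The effective channel at one antenna. -/
def antennaChannel (l : Fin L) (m : Fin K) (t : Fin T) (θ : Fin (T + 1) → ℝ)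
    (y : AntennaSpace L K T) : ℂ :=
  Complex.exp (Complex.I * (θ t.succ : ℂ)) * y.1 (l, m)

theorem uniformMoments_antennaPilot (b : Fin B) :
    UniformMoments (antennaPilot par b) (antennaLaw T lam1 xi) :=
  ⟨measurable_antennaPilot par b, _, hasAllMoments_antennaPilotBound par b,
    norm_antennaPilot_le par b⟩

theorem uniformMoments_antennaFilter (w : Fin B → ℂ) :
    UniformMoments (antennaFilter par w) (antennaLaw T lam1 xi) :=
  UniformMoments.sum fun b => (uniformMoments_antennaPilot par b).const_mul (w b)

theorem uniformMoments_antennaChannel (l : Fin L) (m : Fin K) (t : Fin T) :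
    UniformMoments (antennaChannel l m t) (antennaLaw T lam1 xi) := by
  refine ⟨?_, _, (hasAllMoments_channel (l, m)).norm, fun θ y => ?_⟩
  · unfold antennaChannel Function.uncurry
    fun_prop
  · unfold antennaChannel
    rw [norm_mul, norm_exp_I_mul, one_mul]

theorem uniformMoments_antennaDistortion (s : Fin T) :
    UniformMoments (fun (_ : Fin (T + 1) → ℝ) => antennaDistortion par s)
      (antennaLaw T lam1 xi) :=
  UniformMoments.of_hasAllMoments (hasAllMoments_antennaDistortion par s)
    (measurable_antennaDistortion par s)

theorem integral_antennaChannel_mul_conj_antennaPilot (hlam : ∀ l m, 0 ≤ lam1 l m) (l : Fin L)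
    (m : Fin K) (t : Fin T) (c : Fin B) (θ : Fin (T + 1) → ℝ) :
    ∫ y, antennaChannel l m t θ y * conj (antennaPilot par c θ y) ∂antennaLaw T lam1 xi =
      lam1 l m * conj (par.x l m (par.tau c)) * (Complex.exp (Complex.I * (θ t.succ : ℂ)) *
        conj (Complex.exp (Complex.I * (θ (par.tau c).succ : ℂ)))) := by
  unfold antennaChannel
  simp_rw [mul_assoc (Complex.exp (Complex.I * (θ t.succ : ℂ)))]
  rw [integral_const_mul, integral_channel_mul_conj_antennaPilot par hlam]
  ring

theorem integral_conj_antennaFilter_mul {u : AntennaSpace L K T → ℂ}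
    (hu : MemLp u 2 (antennaLaw T lam1 xi)) (w : Fin B → ℂ) (θ : Fin (T + 1) → ℝ) :
    ∫ y, conj (antennaFilter par w θ y) * u y ∂antennaLaw T lam1 xi =
      ∑ b, conj (w b) * ∫ y, u y * conj (antennaPilot par b θ y) ∂antennaLaw T lam1 xi := by
  have h1 : ∀ y, conj (antennaFilter par w θ y) * u y =
      ∑ b, conj (w b) * (u y * conj (antennaPilot par b θ y)) := by
    intro y
    unfold antennaFilter
    rw [map_sum, Finset.sum_mul]
    refine Finset.sum_congr rfl fun b _ => ?_
    rw [map_mul]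
    ring
  simp_rw [h1]
  rw [integral_finsetSum _ fun b _ => (integrable_mul_conj hu
    ((uniformMoments_antennaPilot par b).hasAllMoments θ).memLp_two).const_mul _]
  simp_rw [integral_const_mul]

/-- Among all contributions to the pilot signal, only that of user `(l, m)` itself correlates with
its channel. -/
theorem integral_conj_antennaFilter_mul_antennaChannel (hlam : ∀ l m, 0 ≤ lam1 l m)
    (w : Fin B → ℂ) (l : Fin L) (m : Fin K) (t : Fin T) (θ : Fin (T + 1) → ℝ) :
    ∫ y, conj (antennaFilter par w θ y) * antennaChannel l m t θ y ∂antennaLaw T lam1 xi =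
      ∑ b, lam1 l m * conj (w b * par.x l m (par.tau b)) *
        (Complex.exp (Complex.I * (θ t.succ : ℂ)) *
          conj (Complex.exp (Complex.I * (θ (par.tau b).succ : ℂ)))) := by
  rw [integral_conj_antennaFilter_mul par
    ((uniformMoments_antennaChannel l m t).hasAllMoments θ).memLp_two]
  refine Finset.sum_congr rfl fun b _ => ?_
  rw [integral_antennaChannel_mul_conj_antennaPilot par hlam, map_mul]
  ring

theorem integral_conj_antennaFilter_mul_antennaDistortion (hlam : ∀ l m, 0 ≤ lam1 l m)
    (w : Fin B → ℂ) {t : Fin T} (ht : t ∉ Set.range par.tau) (θ : Fin (T + 1) → ℝ) :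
    ∫ y, conj (antennaFilter par w θ y) * antennaDistortion par t y ∂antennaLaw T lam1 xi = 0 := by
  rw [integral_conj_antennaFilter_mul par (hasAllMoments_antennaDistortion par t).memLp_two]
  exact Finset.sum_eq_zero fun b _ => by
    rw [integral_antennaDistortion_mul_conj_antennaPilot par hlam b θ ht, mul_zero]

/-- The covariance matrix of the pilot signal received at one antenna. -/
def antennaPsi (lam1 : Fin L → Fin K → ℝ) : Matrix (Fin B) (Fin B) ℂ :=
  (∑ l, ∑ m, (lam1 l m : ℂ) • Xmat par l m) + (par.xi : ℂ) • 1

theorem antennaPsi_apply (lam1 : Fin L → Fin K → ℝ) (b c : Fin B) :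
    antennaPsi par lam1 b c = (phaseCorr par.delta (par.tau b) (par.tau c) : ℂ) *
      ∑ l, ∑ m, (lam1 l m : ℂ) * (par.x l m (par.tau b) * conj (par.x l m (par.tau c))) +
      if b = c then ((par.kappa ^ 2 * ∑ l, ∑ m, ‖par.x l m (par.tau b)‖ ^ 2 * lam1 l m +
        par.xi : ℝ) : ℂ) else 0 := by
  unfold antennaPsi Xmat Xbar
  rcases eq_or_ne b c with rfl | hbc
  · simp only [Matrix.add_apply, Matrix.sum_apply, Matrix.smul_apply, Matrix.of_apply,
      Matrix.diagonal_apply_eq, Matrix.one_apply_eq, smul_eq_mul, if_true, mul_one]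
    push_cast
    rw [← add_assoc]
    congr 1
    simp only [mul_add, Finset.sum_add_distrib, Finset.mul_sum]
    congr 1
    · refine Finset.sum_congr rfl fun _ _ => Finset.sum_congr rfl fun _ _ => ?_
      unfold phaseCorr
      push_cast
      ring
    · refine Finset.sum_congr rfl fun _ _ => Finset.sum_congr rfl fun _ _ => ?_
      ring
  · simp only [Matrix.add_apply, Matrix.sum_apply, Matrix.smul_apply, Matrix.of_apply,
      Matrix.diagonal_apply_ne _ hbc, Matrix.one_apply_ne hbc, smul_eq_mul, if_neg hbc, mul_zero,
      add_zero, Finset.mul_sum]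
    refine Finset.sum_congr rfl fun _ _ => Finset.sum_congr rfl fun _ _ => ?_
    unfold phaseCorr
    push_cast
    ring

variable {ι : Type*}

/-- Averaging over the phases replaces the rotation between two pilot uses by `phaseCorr`; the noise
part on the diagonal is unaffected. -/
theorem integral_integral_antennaPilot_mul_conj {osc : Oscillators}
    {μ : Measure (Fin (T + 1) → ι → ℝ)} [IsProbabilityMeasure μ]
    (hμ : IsPhaseLaw par.delta osc μ) (hlam : ∀ l m, 0 ≤ lam1 l m) (b c : Fin B) (n : ι) :
    ∫ φ, ∫ y, antennaPilot par b (fun s => φ s n) y * conj (antennaPilot par c (fun s => φ s n) y)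
      ∂antennaLaw T lam1 par.xi ∂μ = antennaPsi par lam1 b c := by
  simp_rw [fun φ : Fin (T + 1) → ι → ℝ =>
    integral_antennaPilot_mul_conj par hlam par.xi_pos.le b c fun s => φ s n]
  have h := integral_add ((integrable_rotation (μ := μ) (par.tau b) (par.tau c) n).mul_const
    (∑ l, ∑ m, (lam1 l m : ℂ) * (par.x l m (par.tau b) * conj (par.x l m (par.tau c)))))
    (integrable_const (if b = c then ((par.kappa ^ 2 *
      ∑ l, ∑ m, ‖par.x l m (par.tau b)‖ ^ 2 * lam1 l m + par.xi : ℝ) : ℂ) else 0))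
  rw [integral_mul_const, hμ.corr, integral_const, probReal_univ, one_smul,
    ← antennaPsi_apply] at h
  exact h

/-- The filter matrix that acts on each antenna separately. -/
def blockFilter [DecidableEq ι] (w : ι → Fin B → ℂ) : Matrix ι (Fin B × ι) ℂ :=
  Matrix.of fun n q => if q.2 = n then w n q.1 else 0

variable [Fintype ι]

theorem linEst_blockFilter [DecidableEq ι] (w : ι → Fin B → ℂ) (n : ι)
    (ω : CanonicalSpace L K T ι) :
    (canonicalReceiver par ι).linEst par (blockFilter w) n ω =
      antennaFilter par (w n) (fun s => ω.1 s n) (ω.2 n) := by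
  change ∑ q : Fin B × ι, (if q.2 = n then w n q.1 else 0) *
    antennaPilot par q.1 (fun s => ω.1 s q.2) (ω.2 q.2) = _
  simp [Fintype.sum_prod_type, antennaFilter]

/-- The hypothesis `hw` is the system of normal equations at each antenna separately. Its solution
is optimal among all matrices, including those that mix antennas. -/
theorem ae_linEst_eq_antennaFilter {osc : Oscillators} {lam : Fin L → Fin K → ι → ℝ}
    (hlam : ∀ l m n, 0 ≤ lam l m n) {μ : Measure (Fin (T + 1) → ι → ℝ)} [IsProbabilityMeasure μ]
    (hμ : IsPhaseLaw par.delta osc μ) {j : Fin L} {k : Fin K} {t : Fin T}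
    {w : ι → Fin B → ℂ}
    (hw : ∀ n c, ∑ b, w n b * antennaPsi par (fun l m => lam l m n) b c =
      lam j k n * conj (par.x j k (par.tau c)) * phaseCorr par.delta t (par.tau c))
    {W : Matrix ι (Fin B × ι) ℂ}
    (hW : (canonicalReceiver par ι).IsLMMSE par (canonicalLaw μ lam par.xi) j k t W) :
    ∀ᵐ ω ∂canonicalLaw μ lam par.xi, ∀ n, (canonicalReceiver par ι).linEst par W n ω =
      antennaFilter par (w n) (fun s => ω.1 s n) (ω.2 n) := by
  classical
  have hpil : ∀ (c : Fin B) (n : ι), UniformMoments (antennaPilot par c)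
      (antennaLaw T (fun l m => lam l m n) par.xi) := fun c n => uniformMoments_antennaPilot par c
  have hch : ∀ n, UniformMoments (antennaChannel j k t)
      (antennaLaw T (fun l m => lam l m n) par.xi) := fun n => uniformMoments_antennaChannel j k t
  have herr : ∀ n, UniformMoments
      (fun θ y => antennaChannel j k t θ y - antennaFilter par (w n) θ y)
      (antennaLaw T (fun l m => lam l m n) par.xi) := fun n =>
    (hch n).sub (uniformMoments_antennaFilter par (w n))
  have key := ae_eq_of_orthogonal (P := canonicalLaw μ lam par.xi)
    (X := (canonicalReceiver par ι).effChannel j k t)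
    (ψ := (canonicalReceiver par ι).pilotSignal par) (W := W) (W₀ := blockFilter w)
    (fun n => memLp_antenna hch n) (fun q => memLp_antenna (fun n => hpil q.1 n) q.2) ?_
    (hW (blockFilter w))
  · filter_upwards [key] with ω hω n
    rw [← linEst_blockFilter]
    exact hω n
  · rintro n ⟨c, n'⟩
    have h1 : ∀ ω : CanonicalSpace L K T ι, ((canonicalReceiver par ι).effChannel j k t n ω -
        (blockFilter w *ᵥ (canonicalReceiver par ι).pilotSignal par ω) n) *
        conj ((canonicalReceiver par ι).pilotSignal par ω (c, n')) =
        (antennaChannel j k t (fun s => ω.1 s n) (ω.2 n) -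
          antennaFilter par (w n) (fun s => ω.1 s n) (ω.2 n)) *
          conj (antennaPilot par c (fun s => ω.1 s n') (ω.2 n')) := by
      intro ω
      rw [← linEst_blockFilter]
      rfl
    simp_rw [h1]
    -- At the same antenna orthogonality is `hw`, after averaging over the phases. At another
    -- antenna the pilot signal has conditional mean zero.
    rcases eq_or_ne n n' with rfl | hn
    · have h2 := integral_antenna (μ := μ)
        (ν := fun n => antennaLaw T (fun l m => lam l m n) par.xi)
        (fun n => (herr n).mul (hpil c n).conj_comp) n
      refine h2.trans ?_
      have h3 : ∀ θ, ∫ y, (antennaChannel j k t θ y - antennaFilter par (w n) θ y) *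
          conj (antennaPilot par c θ y) ∂antennaLaw T (fun l m => lam l m n) par.xi =
          ∫ y, antennaChannel j k t θ y * conj (antennaPilot par c θ y)
            ∂antennaLaw T (fun l m => lam l m n) par.xi -
          ∑ b, w n b * ∫ y, antennaPilot par b θ y * conj (antennaPilot par c θ y)
            ∂antennaLaw T (fun l m => lam l m n) par.xi := by
        intro θ
        have hi := fun b => (integrable_mul_conj ((hpil b n).hasAllMoments θ).memLp_two
          ((hpil c n).hasAllMoments θ).memLp_two).const_mul (w n b)
        simp_rw [← integral_const_mul]
        rw [← integral_finsetSum _ fun b _ => hi b, ← integral_sub (integrable_mul_conj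
          ((hch n).hasAllMoments θ).memLp_two ((hpil c n).hasAllMoments θ).memLp_two)
          (integrable_finsetSum _ fun b _ => hi b)]
        refine integral_congr_ae (ae_of_all _ fun y => ?_)
        simp only [antennaFilter, sub_mul, Finset.sum_mul, mul_assoc]
      simp_rw [h3]
      have hI : ∀ b, Integrable (fun φ : Fin (T + 1) → ι → ℝ =>
          ∫ y, antennaPilot par b (fun s => φ s n) y *
            conj (antennaPilot par c (fun s => φ s n) y)
            ∂antennaLaw T (fun l m => lam l m n) par.xi) μ := by
        intro b
        simp_rw [fun φ : Fin (T + 1) → ι → ℝ => integral_antennaPilot_mul_conj par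
          (fun l m => hlam l m n) par.xi_pos.le b c fun s => φ s n]
        exact ((integrable_rotation (par.tau b) (par.tau c) n).mul_const _).add
          (integrable_const _)
      have hJ : ∀ φ : Fin (T + 1) → ι → ℝ,
          ∫ y, antennaChannel j k t (fun s => φ s n) y *
            conj (antennaPilot par c (fun s => φ s n) y)
            ∂antennaLaw T (fun l m => lam l m n) par.xi =
          lam j k n * conj (par.x j k (par.tau c)) * rotation t (par.tau c) n φ := fun φ =>
        integral_antennaChannel_mul_conj_antennaPilot par (fun l m => hlam l m n) j k t c _
      simp_rw [hJ]
      rw [integral_sub ((integrable_rotation t (par.tau c) n).const_mul _)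
        (integrable_finsetSum _ fun b _ => (hI b).const_mul _), integral_const_mul, hμ.corr,
        integral_finsetSum _ fun b _ => (hI b).const_mul _]
      simp_rw [integral_const_mul, integral_integral_antennaPilot_mul_conj par hμ
        (fun l m => hlam l m n)]
      rw [hw, sub_self]
    · exact integral_antenna_mul_conj_of_ne herr (hpil c)
        (fun n θ => integral_antennaPilot par c θ) hn

end Filter

/-! ### The estimation weights and the closed-form expressions -/

section Weights

variable {L K B T A : ℕ} (par : Params L K B T)

/-- For each user the channel part is the positive semidefinite form of `sum_phaseCorr_nonneg` at
the vector `conj (z b) * x l m (τ_b)`. Distortion adds a nonnegative diagonal, and receiver noise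
adds `ξ`. -/
theorem re_quadraticForm_antennaPsi {lam1 : Fin L → Fin K → ℝ} (hlam : ∀ l m, 0 ≤ lam1 l m)
    (z : Fin B → ℂ) :
    par.xi * ∑ b, ‖z b‖ ^ 2 ≤ (∑ b, ∑ c, conj (z b) * antennaPsi par lam1 b c * z c).re := by
  have h1 : ∀ b c, conj (z b) * antennaPsi par lam1 b c * z c =
      (∑ l, ∑ m, (lam1 l m : ℂ) * ((conj (z b) * par.x l m (par.tau b)) *
        conj (conj (z c) * par.x l m (par.tau c)) *
          (phaseCorr par.delta (par.tau b) (par.tau c) : ℂ))) +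
      if b = c then (((par.kappa ^ 2 * ∑ l, ∑ m, ‖par.x l m (par.tau b)‖ ^ 2 * lam1 l m +
        par.xi) * ‖z b‖ ^ 2 : ℝ) : ℂ) else 0 := by
    intro b c
    rw [antennaPsi_apply, mul_add, add_mul]
    congr 1
    · simp only [Finset.mul_sum, Finset.sum_mul]
      refine Finset.sum_congr rfl fun _ _ => Finset.sum_congr rfl fun _ _ => ?_
      rw [map_mul, Complex.conj_conj]
      ring
    · split_ifs with h
      · subst h
        rw [Complex.ofReal_mul, ofReal_norm_sq]
        ring
      · simp
  simp_rw [h1, Finset.sum_add_distrib]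
  simp only [Finset.sum_ite_eq, Finset.mem_univ, if_true]
  rw [Complex.add_re, ← Complex.ofReal_sum, Complex.ofReal_re]
  have h2 : 0 ≤ (∑ b, ∑ c, ∑ l, ∑ m, (lam1 l m : ℂ) * ((conj (z b) * par.x l m (par.tau b)) *
        conj (conj (z c) * par.x l m (par.tau c)) *
          (phaseCorr par.delta (par.tau b) (par.tau c) : ℂ))).re := by
    have h3 : (∑ b, ∑ c, ∑ l, ∑ m, (lam1 l m : ℂ) * ((conj (z b) * par.x l m (par.tau b)) *
        conj (conj (z c) * par.x l m (par.tau c)) *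
          (phaseCorr par.delta (par.tau b) (par.tau c) : ℂ))) =
        ∑ l, ∑ m, (lam1 l m : ℂ) * ∑ b, ∑ c, (conj (z b) * par.x l m (par.tau b)) *
        conj (conj (z c) * par.x l m (par.tau c)) *
          (phaseCorr par.delta (par.tau b) (par.tau c) : ℂ) := by
      simp only [Finset.mul_sum]
      simp_rw [Finset.sum_comm (s := (Finset.univ : Finset (Fin B)))
        (t := (Finset.univ : Finset (Fin L))), Finset.sum_comm (s := (Finset.univ : Finset (Fin B)))
        (t := (Finset.univ : Finset (Fin K)))]
    rw [h3, Complex.re_sum]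
    refine Finset.sum_nonneg fun l _ => ?_
    rw [Complex.re_sum]
    refine Finset.sum_nonneg fun m _ => ?_
    rw [Complex.re_ofReal_mul]
    exact mul_nonneg (hlam l m) (sum_phaseCorr_nonneg par.delta_nonneg par.tau
      fun b => conj (z b) * par.x l m (par.tau b))
  have h4 : par.xi * ∑ b, ‖z b‖ ^ 2 ≤ ∑ b, (par.kappa ^ 2 *
      ∑ l, ∑ m, ‖par.x l m (par.tau b)‖ ^ 2 * lam1 l m + par.xi) * ‖z b‖ ^ 2 := by
    rw [Finset.mul_sum]
    refine Finset.sum_le_sum fun b _ => mul_le_mul_of_nonneg_right ?_ (sq_nonneg _)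
    have : 0 ≤ par.kappa ^ 2 * ∑ l, ∑ m, ‖par.x l m (par.tau b)‖ ^ 2 * lam1 l m :=
      mul_nonneg (sq_nonneg _) (Finset.sum_nonneg fun l _ => Finset.sum_nonneg fun m _ =>
        mul_nonneg (sq_nonneg _) (hlam l m))
    linarith
  linarith

/-- A kernel vector would annihilate a quadratic form bounded below by `ξ > 0` times its squared
length. -/
theorem isUnit_det_antennaPsi {lam1 : Fin L → Fin K → ℝ} (hlam : ∀ l m, 0 ≤ lam1 l m) :
    IsUnit (antennaPsi par lam1).det := by
  rw [isUnit_iff_ne_zero]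
  intro h0
  obtain ⟨z, hz, hz0⟩ := Matrix.exists_mulVec_eq_zero_iff.2 h0
  have h1 : ∑ b, ∑ c, conj (z b) * antennaPsi par lam1 b c * z c = 0 := by
    refine Finset.sum_eq_zero fun b _ => ?_
    simp_rw [mul_assoc]
    rw [← Finset.mul_sum]
    have : ∑ c, antennaPsi par lam1 b c * z c = 0 := congrFun hz0 b
    rw [this, mul_zero]
  have h2 := re_quadraticForm_antennaPsi par hlam z
  rw [h1, Complex.zero_re] at h2
  apply hz
  have h3 : ∑ b, ‖z b‖ ^ 2 ≤ 0 := nonpos_of_mul_nonpos_right h2 par.xi_pos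
  have h4 := (Finset.sum_eq_zero_iff_of_nonneg fun b _ => sq_nonneg ‖z b‖).1
    (le_antisymm h3 (Finset.sum_nonneg fun b _ => sq_nonneg _))
  ext b
  simpa using h4 b (Finset.mem_univ b)

theorem isHermitian_antennaPsi (lam1 : Fin L → Fin K → ℝ) : (antennaPsi par lam1).IsHermitian := by
  ext b c
  rw [Matrix.conjTranspose_apply, antennaPsi_apply, antennaPsi_apply, phaseCorr_comm]
  rw [star_add, star_mul', star_sum]
  congr 1
  · congr 1
    · exact Complex.conj_ofReal _
    · refine Finset.sum_congr rfl fun l _ => ?_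
      rw [star_sum]
      refine Finset.sum_congr rfl fun m _ => ?_
      simp only [RCLike.star_def, map_mul, Complex.conj_conj, Complex.conj_ofReal]
      ring
  · rcases eq_or_ne b c with rfl | h
    · rw [if_pos rfl]
      exact Complex.conj_ofReal _
    · rw [if_neg h, if_neg h.symm, star_zero]

/-- The entries of the row `x̃ᴴ D_δ(t)`. -/
def pilotRow (l : Fin L) (m : Fin K) (t : Fin T) (b : Fin B) : ℂ :=
  conj (par.x l m (par.tau b)) * phaseCorr par.delta t (par.tau b)

/-- The row `x̃ᴴ D_δ(t) Ψ⁻¹` for one antenna. -/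
def antennaRow (lam1 : Fin L → Fin K → ℝ) (l : Fin L) (m : Fin K) (t : Fin T) : Fin B → ℂ :=
  pilotRow par l m t ᵥ* (antennaPsi par lam1)⁻¹

/-- The weights of the linear minimum mean-squared error estimate at one antenna. -/
def antennaWeight (lam1 : Fin L → Fin K → ℝ) (l : Fin L) (m : Fin K) (t : Fin T) (b : Fin B) : ℂ :=
  (lam1 l m : ℂ) * antennaRow par lam1 l m t b

/-- These are the normal equations required by `ae_linEst_eq_antennaFilter`. -/
theorem sum_antennaWeight_mul_antennaPsi {lam1 : Fin L → Fin K → ℝ} (hlam : ∀ l m, 0 ≤ lam1 l m)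
    (l : Fin L) (m : Fin K) (t : Fin T) (c : Fin B) :
    ∑ b, antennaWeight par lam1 l m t b * antennaPsi par lam1 b c =
      lam1 l m * conj (par.x l m (par.tau c)) * phaseCorr par.delta t (par.tau c) := by
  have h1 : antennaRow par lam1 l m t ᵥ* antennaPsi par lam1 = pilotRow par l m t := by
    unfold antennaRow
    rw [Matrix.vecMul_vecMul, Matrix.nonsing_inv_mul _ (isUnit_det_antennaPsi par hlam),
      Matrix.vecMul_one]
  have h2 : ∑ b, antennaRow par lam1 l m t b * antennaPsi par lam1 b c = pilotRow par l m t c :=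
    congrFun h1 c
  unfold antennaWeight
  simp_rw [mul_assoc]
  rw [← Finset.mul_sum, h2]
  rfl

theorem inv_antennaPsi_mulVec (lam1 : Fin L → Fin K → ℝ) (l : Fin L) (m : Fin K) (t : Fin T)
    (c : Fin B) : ∑ b, (antennaPsi par lam1)⁻¹ c b * conj (pilotRow par l m t b) =
      conj (antennaRow par lam1 l m t c) := by
  have h : ∀ b, (antennaPsi par lam1)⁻¹ c b = conj ((antennaPsi par lam1)⁻¹ b c) := fun b =>
    (((isHermitian_antennaPsi par lam1).inv).apply c b).symm
  unfold antennaRow Matrix.vecMul dotProduct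
  rw [map_sum]
  refine Finset.sum_congr rfl fun b _ => ?_
  rw [h, map_mul, mul_comm]

theorem rowD_apply (l : Fin L) (m : Fin K) (t : Fin T) (b : Fin B) (i : Unit) :
    rowD par l m t i b = pilotRow par l m t b := by
  unfold rowD Ddelta
  rw [Matrix.mul_diagonal]
  rfl

theorem colD_apply (l : Fin L) (m : Fin K) (t : Fin T) (b : Fin B) (i : Unit) :
    colD par l m t b i = conj (pilotRow par l m t b) := by
  unfold colD Ddelta pilotRow phaseCorr
  rw [Matrix.diagonal_conjTranspose, Matrix.diagonal_mul, map_mul, Complex.conj_conj,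
    Complex.conj_ofReal, mul_comm]
  congr 1
  exact Complex.conj_ofReal _

variable (lamT : Fin L → Fin K → Fin A → ℝ)

theorem PsiT_apply (p q : Fin B × Fin A) : PsiT par lamT p q =
    if p.2 = q.2 then antennaPsi par (fun l m => lamT l m p.2) p.1 q.1 else 0 := by
  obtain ⟨b, a⟩ := p
  obtain ⟨c, a'⟩ := q
  unfold PsiT antennaPsi covMatrix
  simp only [Matrix.add_apply, Matrix.sum_apply, Matrix.kroneckerMap_apply, Matrix.smul_apply,
    Matrix.one_apply, Matrix.diagonal_apply, Prod.mk.injEq, smul_eq_mul]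
  split_ifs with h1 h2 h2
  · simp [mul_comm]
  · simp_all
  · simp_all
  · simp [mul_comm]
  · simp_all
  · simp

/-- All the matrices `Λ̃` are diagonal, so different subarrays do not couple and the inverse is
formed blockwise. -/
theorem inv_PsiT (hlamT : ∀ l m a, 0 ≤ lamT l m a) : (PsiT par lamT)⁻¹ =
    Matrix.of fun p q : Fin B × Fin A =>
      if p.2 = q.2 then (antennaPsi par (fun l m => lamT l m p.2))⁻¹ p.1 q.1 else 0 := by
  refine Matrix.inv_eq_right_inv ?_
  ext ⟨b, a⟩ ⟨c, a'⟩
  rw [Matrix.mul_apply, Fintype.sum_prod_type]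
  simp only [PsiT_apply, Matrix.of_apply, ite_mul, zero_mul, Finset.sum_ite_eq, Finset.mem_univ,
    if_true]
  have h := congrFun (congrFun (Matrix.mul_nonsing_inv _
    (isUnit_det_antennaPsi par fun l m => hlamT l m a)) b) c
  rw [Matrix.mul_apply] at h
  rcases eq_or_ne a a' with rfl | ha
  · simp only [if_true, h, Matrix.one_apply, Prod.mk.injEq, and_true]
  · simp [ha]

theorem rowD_kronecker_mul_inv_PsiT (hlamT : ∀ l m a, 0 ≤ lamT l m a) {α : Type*}
    (M : Matrix α (Fin A) ℂ) (l : Fin L) (m : Fin K) (t : Fin T) (i : Unit × α)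
    (q : Fin B × Fin A) : ((rowD par l m t ⊗ₖ M) * (PsiT par lamT)⁻¹) i q =
      M i.2 q.2 * antennaRow par (fun l m => lamT l m q.2) l m t q.1 := by
  rw [inv_PsiT par lamT hlamT, Matrix.mul_apply, Fintype.sum_prod_type]
  simp only [Matrix.kroneckerMap_apply, Matrix.of_apply, rowD_apply, mul_ite, mul_zero,
    Finset.sum_ite_eq', Finset.mem_univ, if_true]
  unfold antennaRow Matrix.vecMul dotProduct
  rw [Finset.mul_sum]
  exact Finset.sum_congr rfl fun _ _ => by ring

theorem inv_PsiT_mul_colD_kronecker (hlamT : ∀ l m a, 0 ≤ lamT l m a) {α : Type*}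
    (M : Matrix (Fin A) α ℂ) (l : Fin L) (m : Fin K) (t : Fin T) (i : Unit × α)
    (q : Fin B × Fin A) : ((PsiT par lamT)⁻¹ * (colD par l m t ⊗ₖ M)) q i =
      conj (antennaRow par (fun l m => lamT l m q.2) l m t q.1) * M q.2 i.2 := by
  rw [inv_PsiT par lamT hlamT, Matrix.mul_apply, Fintype.sum_prod_type]
  simp only [Matrix.kroneckerMap_apply, Matrix.of_apply, colD_apply, ite_mul, zero_mul,
    Finset.sum_ite_eq, Finset.mem_univ, if_true]
  rw [← inv_antennaPsi_mulVec, Finset.sum_mul]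
  exact Finset.sum_congr rfl fun _ _ => by ring

/-- The coefficients of the phase rotations in the conditional mean gain at one antenna. -/
def gainCoeff (t : Fin T) (j : Fin L) (k : Fin K) (l : Fin L) (m : Fin K) (a : Fin A)
    (b : Fin B) : ℂ :=
  lamT l m a * conj (antennaWeight par (fun l m => lamT l m a) j k t b * par.x l m (par.tau b))

/-- The conjugate appears because the trace contains the weights of `v`, while `gainCoeff` comes
from `vᴴ h`. It disappears in the modulus. -/
theorem crossTrace_eq (hlamT : ∀ l m a, 0 ≤ lamT l m a) (t : Fin T) (j : Fin L) (k : Fin K)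
    (l : Fin L) (m : Fin K) : crossTrace par lamT t j k l m =
      conj (∑ a, ∑ b, gainCoeff par lamT t j k l m a b *
        (phaseCorr par.delta t (par.tau b) : ℂ)) := by
  unfold crossTrace Matrix.trace
  simp only [Matrix.diag_apply, Matrix.mul_apply (M := _ * _), map_sum]
  simp only [rowD_kronecker_mul_inv_PsiT par lamT hlamT, Matrix.kroneckerMap_apply, colD_apply,
    covMatrix, Matrix.diagonal_apply]
  simp only [Fintype.sum_prod_type, Finset.univ_unique, Finset.sum_singleton]
  refine Finset.sum_congr rfl fun a _ => Finset.sum_congr rfl fun b _ => ?_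
  rw [Finset.sum_eq_single a (fun x _ hx => by simp [hx]) (by simp)]
  simp only [if_true]
  simp only [gainCoeff, antennaWeight, pilotRow, map_mul, Complex.conj_conj, Complex.conj_ofReal]
  ring

theorem Sig_eq (hlamT : ∀ l m a, 0 ≤ lamT l m a) (t : Fin T) (j : Fin L) (k : Fin K) :
    Sig par lamT t j k = ‖∑ a, ∑ b, gainCoeff par lamT t j k j k a b *
        (phaseCorr par.delta t (par.tau b) : ℂ)‖ ^ 2 := by
  unfold Sig
  rw [crossTrace_eq par lamT hlamT, RCLike.norm_conj]

theorem Interf_eq (hlamT : ∀ l m a, 0 ≤ lamT l m a) (t : Fin T) (j : Fin L) (k : Fin K)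
    (l : Fin L) (m : Fin K) (osc : Oscillators) : Interf par lamT t j k l m osc =
      rotationLimit par.delta par.tau t (gainCoeff par lamT t j k l m) osc := by
  cases osc with
  | separate =>
    unfold Interf rotationLimit
    simp only
    rw [crossTrace_eq par lamT hlamT, RCLike.norm_conj]
  | common =>
    unfold Interf rotationLimit
    simp only
    -- Conjugation in `gainCoeff` exchanges the roles of the two subarrays and of the two pilot
    -- indices: `a₁` corresponds to `a'` in `rotationLimit`, and `a₂` to `a`.
    rw [Finset.sum_comm]
    congr 1
    refine Finset.sum_congr rfl fun a _ => Finset.sum_congr rfl fun a' _ => ?_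
    rw [Finset.sum_comm]
    have h : Matrix.trace ((rowD par j k t ⊗ₖ (unitCol a')ᴴ) * (PsiT par lamT)⁻¹ *
            (Xbar par l m ⊗ₖ (unitCol a' * (unitCol a)ᴴ)) * (PsiT par lamT)⁻¹ *
            (colD par j k t ⊗ₖ unitCol a)) =
        ∑ c, ∑ b, antennaRow par (fun l m => lamT l m a') j k t c * Xbar par l m c b *
          conj (antennaRow par (fun l m => lamT l m a) j k t b) := by
      rw [Matrix.mul_assoc (_ * (Xbar par l m ⊗ₖ _))]
      unfold Matrix.trace
      simp only [Matrix.diag_apply, Matrix.mul_apply (M := _ * (Xbar par l m ⊗ₖ _))]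
      simp only [Matrix.mul_apply (N := Xbar par l m ⊗ₖ _),
        rowD_kronecker_mul_inv_PsiT par lamT hlamT,
        inv_PsiT_mul_colD_kronecker par lamT hlamT, Matrix.kroneckerMap_apply,
        Fintype.sum_prod_type, Finset.univ_unique, Finset.sum_singleton]
      simp only [unitCol, Matrix.mul_apply, Matrix.conjTranspose_apply,
        Matrix.replicateCol_apply, Finset.univ_unique, Finset.sum_singleton, Pi.single_apply]
      simp only [apply_ite (star : ℂ → ℂ), star_one, star_zero, ite_mul, zero_mul, mul_ite,
        mul_zero, one_mul, mul_one, Finset.sum_ite_eq', Finset.mem_univ, if_true]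
      simp only [Finset.sum_mul]
      rw [Finset.sum_comm]
    rw [h, Finset.mul_sum]
    refine Finset.sum_congr rfl fun c _ => ?_
    rw [Finset.mul_sum]
    refine Finset.sum_congr rfl fun b _ => ?_
    simp only [gainCoeff, antennaWeight, Xbar, phaseCorr, Matrix.of_apply, map_mul,
      Complex.conj_conj, Complex.conj_ofReal]
    push_cast
    ring

end Weights

/-! ### Performance with many antennas -/

section Performance

variable {L K B T A : ℕ} (par : Params L K B T) (lamT : Fin L → Fin K → Fin A → ℝ)

/-- The average attenuations of antennas in subarrays. -/
def subarrayLam (n : ℕ) (l : Fin L) (m : Fin K) (q : Fin A × Fin n) : ℝ := lamT l m q.1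

/-- The law of the random quantities at the antennas of a subarray. -/
abbrev subarrayLaw (a : Fin A) : Measure (AntennaSpace L K T) :=
  antennaLaw T (fun l m => lamT l m a) par.xi

/-- The linear minimum mean-squared error estimate at an antenna of a subarray. -/
abbrev subarrayFilter (j : Fin L) (k : Fin K) (t : Fin T) (a : Fin A) :
    (Fin (T + 1) → ℝ) → AntennaSpace L K T → ℂ :=
  antennaFilter par (antennaWeight par (fun l m => lamT l m a) j k t)

variable {lamT} {osc : Oscillators} {j : Fin L} {k : Fin K} {t : Fin T}

theorem ae_linEst_eq_subarrayFilter (hlamT : ∀ l m a, 0 ≤ lamT l m a)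
    {n : ℕ} {μ : Measure (Fin (T + 1) → Fin A × Fin n → ℝ)}
    [IsProbabilityMeasure μ] (hμ : IsPhaseLaw par.delta osc μ)
    {W : Matrix (Fin A × Fin n) (Fin B × (Fin A × Fin n)) ℂ}
    (hW : (canonicalReceiver par (Fin A × Fin n)).IsLMMSE par
      (canonicalLaw μ (subarrayLam lamT n) par.xi) j k t W) :
    ∀ᵐ ω ∂canonicalLaw μ (subarrayLam lamT n) par.xi, ∀ q,
      (canonicalReceiver par (Fin A × Fin n)).linEst par W q ω =
        subarrayFilter par lamT j k t q.1 (fun s => ω.1 s q) (ω.2 q) :=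
  ae_linEst_eq_antennaFilter par (lam := subarrayLam lamT n)
    (w := fun q => antennaWeight par (fun l m => lamT l m q.1) j k t)
    (fun l m q => hlamT l m q.1) hμ
    (fun q c => sum_antennaWeight_mul_antennaPsi par (lam1 := fun l m => lamT l m q.1)
      (fun l m => hlamT l m q.1) j k t c) hW

/-- Exact for both kinds of oscillators: the expectation is linear, each term involves a single
antenna, and the `n` antennas of a subarray contribute equally. -/
theorem meanGain_canonical (hlamT : ∀ l m a, 0 ≤ lamT l m a)
    {n : ℕ} {μ : Measure (Fin (T + 1) → Fin A × Fin n → ℝ)}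
    [IsProbabilityMeasure μ] (hμ : IsPhaseLaw par.delta osc μ)
    {W : Matrix (Fin A × Fin n) (Fin B × (Fin A × Fin n)) ℂ}
    (hW : (canonicalReceiver par (Fin A × Fin n)).IsLMMSE par
      (canonicalLaw μ (subarrayLam lamT n) par.xi) j k t W) :
    ‖(canonicalReceiver par (Fin A × Fin n)).meanGain (canonicalLaw μ (subarrayLam lamT n) par.xi)
      ((canonicalReceiver par (Fin A × Fin n)).linEst par W) j k t‖ ^ 2 =
      (n : ℝ) ^ 2 * Sig par lamT t j k := by
  have hg : ∀ q : Fin A × Fin n, UniformMoments (fun θ y =>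
      conj (subarrayFilter par lamT j k t q.1 θ y) * antennaChannel j k t θ y)
      (subarrayLaw par lamT q.1) := fun q =>
    (uniformMoments_antennaFilter par _).conj_comp.mul (uniformMoments_antennaChannel j k t)
  have h1 : (canonicalReceiver par (Fin A × Fin n)).meanGain
      (canonicalLaw μ (subarrayLam lamT n) par.xi)
      ((canonicalReceiver par (Fin A × Fin n)).linEst par W) j k t =
      ∫ ω : CanonicalSpace L K T (Fin A × Fin n),
        ∑ q, conj (subarrayFilter par lamT j k t q.1 (fun s => ω.1 s q) (ω.2 q)) *
          antennaChannel j k t (fun s => ω.1 s q) (ω.2 q)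
        ∂μ.prod (Measure.pi fun q => subarrayLaw par lamT q.1) := by
    refine integral_congr_ae ?_
    filter_upwards [ae_linEst_eq_subarrayFilter par hlamT hμ hW] with ω hω
    exact Finset.sum_congr rfl fun q _ => by rw [hω q]; rfl
  have h2 : ∀ q : Fin A × Fin n, ∫ ω : CanonicalSpace L K T (Fin A × Fin n),
      conj (subarrayFilter par lamT j k t q.1 (fun s => ω.1 s q) (ω.2 q)) *
          antennaChannel j k t (fun s => ω.1 s q) (ω.2 q)
        ∂μ.prod (Measure.pi fun q => subarrayLaw par lamT q.1) =
      ∑ b, gainCoeff par lamT t j k j k q.1 b * (phaseCorr par.delta t (par.tau b) : ℂ) := by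
    intro q
    rw [← integral_sum_rotation hμ par.tau t _ q]
    refine (integral_antenna hg q).trans (integral_congr_ae (ae_of_all _ fun φ => ?_))
    exact integral_conj_antennaFilter_mul_antennaChannel par (fun l m => hlamT l m q.1) _ j k t _
  rw [h1, integral_finsetSum _ fun q _ => (memLp_antenna hg q).integrable one_le_two]
  simp_rw [h2]
  rw [Sig_eq par lamT hlamT]
  simp only [Fintype.sum_prod_type, Finset.sum_const, Finset.card_univ, Fintype.card_fin,
    nsmul_eq_mul]
  rw [← Finset.mul_sum, norm_mul, mul_pow, Complex.norm_natCast]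

/-- Two errors of order `n` add up: `C₁` from replacing each term by its conditional mean given the
phases, `C₂` from averaging the phase rotations. -/
theorem exists_bound_interference (hlamT : ∀ l m a, 0 ≤ lamT l m a)
    (osc : Oscillators) (j : Fin L) (k : Fin K) (t : Fin T)
    (l : Fin L) (m : Fin K) :
    ∃ C : ℝ, ∀ (n : ℕ) (μ : Measure (Fin (T + 1) → Fin A × Fin n → ℝ)) [IsProbabilityMeasure μ]
      (_ : IsPhaseLaw par.delta osc μ)
      (W : Matrix (Fin A × Fin n) (Fin B × (Fin A × Fin n)) ℂ)
      (_ : (canonicalReceiver par (Fin A × Fin n)).IsLMMSE par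
        (canonicalLaw μ (subarrayLam lamT n) par.xi) j k t W),
      |(canonicalReceiver par (Fin A × Fin n)).interference
        (canonicalLaw μ (subarrayLam lamT n) par.xi)
        ((canonicalReceiver par (Fin A × Fin n)).linEst par W) l m t -
        (n : ℝ) ^ 2 * Interf par lamT t j k l m osc| ≤ C * n := by
  have hg : ∀ a : Fin A, UniformMoments (fun θ y =>
      conj (subarrayFilter par lamT j k t a θ y) * antennaChannel l m t θ y)
      (subarrayLaw par lamT a) := fun a =>
    (uniformMoments_antennaFilter par _).conj_comp.mul (uniformMoments_antennaChannel l m t)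
  obtain ⟨C₁, h₁⟩ := exists_bound_integral_norm_sum_sq hg
  obtain ⟨C₂, h₂⟩ := exists_bound_integral_rotation_sums par.delta par.tau t
    (gainCoeff par lamT t j k l m) osc
  refine ⟨C₁ + C₂, fun n μ _ hμ W hW => ?_⟩
  have h1 : (canonicalReceiver par (Fin A × Fin n)).interference
      (canonicalLaw μ (subarrayLam lamT n) par.xi)
      ((canonicalReceiver par (Fin A × Fin n)).linEst par W) l m t =
      ∫ ω : CanonicalSpace L K T (Fin A × Fin n),
        ‖∑ q, conj (subarrayFilter par lamT j k t q.1 (fun s => ω.1 s q) (ω.2 q)) *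
          antennaChannel l m t (fun s => ω.1 s q) (ω.2 q)‖ ^ 2
        ∂μ.prod (Measure.pi fun q => subarrayLaw par lamT q.1) := by
    refine integral_congr_ae ?_
    filter_upwards [ae_linEst_eq_subarrayFilter par hlamT hμ hW] with ω hω
    have : herm ((canonicalReceiver par (Fin A × Fin n)).linEst par W)
        ((canonicalReceiver par (Fin A × Fin n)).effChannel l m t) ω =
        ∑ q, conj (subarrayFilter par lamT j k t q.1 (fun s => ω.1 s q) (ω.2 q)) *
          antennaChannel l m t (fun s => ω.1 s q) (ω.2 q) :=
      Finset.sum_congr rfl fun q _ => by rw [hω q]; rfl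
    simp only [this]
  have h2 : ∀ (φ : Fin (T + 1) → Fin A × Fin n → ℝ) (q : Fin A × Fin n),
      ∫ y, conj (subarrayFilter par lamT j k t q.1 (fun s => φ s q) y) *
        antennaChannel l m t (fun s => φ s q) y ∂subarrayLaw par lamT q.1 =
      ∑ b, gainCoeff par lamT t j k l m q.1 b * rotation t (par.tau b) q φ := fun φ q =>
    integral_conj_antennaFilter_mul_antennaChannel par (fun l m => hlamT l m q.1) _ l m t _
  have h3 := h₁ n μ
  simp_rw [h2] at h3
  rw [h1, Interf_eq par lamT hlamT, add_mul]
  exact (abs_sub_le _ _ _).trans (add_le_add h3 (h₂ n μ hμ))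

/-- All conditional means vanish, so only the fluctuation of order `n` is left. -/
theorem exists_bound_distortionPower (hlamT : ∀ l m a, 0 ≤ lamT l m a)
    (osc : Oscillators) (j : Fin L) (k : Fin K) {t : Fin T}
    (ht : t ∉ Set.range par.tau) :
    ∃ C : ℝ, ∀ (n : ℕ) (μ : Measure (Fin (T + 1) → Fin A × Fin n → ℝ)) [IsProbabilityMeasure μ]
      (_ : IsPhaseLaw par.delta osc μ)
      (W : Matrix (Fin A × Fin n) (Fin B × (Fin A × Fin n)) ℂ)
      (_ : (canonicalReceiver par (Fin A × Fin n)).IsLMMSE par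
        (canonicalLaw μ (subarrayLam lamT n) par.xi) j k t W),
      |(canonicalReceiver par (Fin A × Fin n)).distortionPower
        (canonicalLaw μ (subarrayLam lamT n) par.xi)
        ((canonicalReceiver par (Fin A × Fin n)).linEst par W) t| ≤ C * n := by
  have hg : ∀ a : Fin A, UniformMoments (fun θ y =>
      conj (subarrayFilter par lamT j k t a θ y) * antennaDistortion par t y)
      (subarrayLaw par lamT a) := fun a =>
    (uniformMoments_antennaFilter par _).conj_comp.mul (uniformMoments_antennaDistortion par t)
  obtain ⟨C, hC⟩ := exists_bound_integral_norm_sum_sq hg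
  refine ⟨C, fun n μ _ hμ W hW => ?_⟩
  have h1 : (canonicalReceiver par (Fin A × Fin n)).distortionPower
      (canonicalLaw μ (subarrayLam lamT n) par.xi)
      ((canonicalReceiver par (Fin A × Fin n)).linEst par W) t =
      ∫ ω : CanonicalSpace L K T (Fin A × Fin n),
        ‖∑ q, conj (subarrayFilter par lamT j k t q.1 (fun s => ω.1 s q) (ω.2 q)) *
          antennaDistortion par t (ω.2 q)‖ ^ 2
        ∂μ.prod (Measure.pi fun q => subarrayLaw par lamT q.1) := by
    refine integral_congr_ae ?_
    filter_upwards [ae_linEst_eq_subarrayFilter par hlamT hμ hW] with ω hω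
    have : herm ((canonicalReceiver par (Fin A × Fin n)).linEst par W)
        ((canonicalReceiver par (Fin A × Fin n)).ups t) ω =
        ∑ q, conj (subarrayFilter par lamT j k t q.1 (fun s => ω.1 s q) (ω.2 q)) *
          antennaDistortion par t (ω.2 q) :=
      Finset.sum_congr rfl fun q _ => by rw [hω q]; rfl
    simp only [this]
  have h2 : ∀ (φ : Fin (T + 1) → Fin A × Fin n → ℝ) (q : Fin A × Fin n),
      ∫ y, conj (subarrayFilter par lamT j k t q.1 (fun s => φ s q) y) *
        antennaDistortion par t y ∂subarrayLaw par lamT q.1 = 0 := fun φ q =>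
    integral_conj_antennaFilter_mul_antennaDistortion par (fun l m => hlamT l m q.1) _ ht _
  have h3 := hC n μ
  simp_rw [h2] at h3
  rw [h1]
  simpa using h3

theorem exists_bound_filterPower (hlamT : ∀ l m a, 0 ≤ lamT l m a)
    (osc : Oscillators) (j : Fin L) (k : Fin K) (t : Fin T) :
    ∃ C : ℝ, ∀ (n : ℕ) (μ : Measure (Fin (T + 1) → Fin A × Fin n → ℝ)) [IsProbabilityMeasure μ]
      (_ : IsPhaseLaw par.delta osc μ)
      (W : Matrix (Fin A × Fin n) (Fin B × (Fin A × Fin n)) ℂ)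
      (_ : (canonicalReceiver par (Fin A × Fin n)).IsLMMSE par
        (canonicalLaw μ (subarrayLam lamT n) par.xi) j k t W),
      |filterPower (canonicalLaw μ (subarrayLam lamT n) par.xi)
        ((canonicalReceiver par (Fin A × Fin n)).linEst par W)| ≤ C * n := by
  obtain ⟨C, hC⟩ := exists_bound_integral_sum_norm_sq
    (g := fun a => subarrayFilter par lamT j k t a) (ν := subarrayLaw par lamT)
    fun a => uniformMoments_antennaFilter par _
  refine ⟨C, fun n μ _ hμ W hW => ?_⟩
  convert hC n μ using 2
  refine integral_congr_ae ?_
  filter_upwards [ae_linEst_eq_subarrayFilter par hlamT hμ hW] with ω hω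
  exact Finset.sum_congr rfl fun q _ => by rw [hω q]

/-- Signal, interference and noise powers of the filter given by the linear minimum mean-squared
error estimate, up to terms of the order of the subarray size. -/
theorem exists_bound_performance (hlamT : ∀ l m a, 0 ≤ lamT l m a)
    (osc : Oscillators) (j : Fin L) (k : Fin K) {t : Fin T}
    (ht : t ∉ Set.range par.tau) :
    ∃ C : ℝ, 0 ≤ C ∧ ∀ (n : ℕ) {Ω : Type*} [MeasurableSpace Ω] (P : Measure Ω)
      [IsProbabilityMeasure P] (R : Receiver L K T (Fin A × Fin n) Ω)
      (_ : R.IsUplink par osc (subarrayLam lamT n) P)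
      (W : Matrix (Fin A × Fin n) (Fin B × (Fin A × Fin n)) ℂ) (_ : R.IsLMMSE par P j k t W),
      ‖R.meanGain P (R.linEst par W) j k t‖ ^ 2 = (n : ℝ) ^ 2 * Sig par lamT t j k ∧
      (∀ l m, |R.interference P (R.linEst par W) l m t -
        (n : ℝ) ^ 2 * Interf par lamT t j k l m osc| ≤ C * n) ∧
      |R.distortionPower P (R.linEst par W) t| ≤ C * n ∧
      |filterPower P (R.linEst par W)| ≤ C * n := by
  choose C₁ h₁ using exists_bound_interference par hlamT osc j k t
  obtain ⟨C₂, h₂⟩ := exists_bound_distortionPower par hlamT osc j k ht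
  obtain ⟨C₃, h₃⟩ := exists_bound_filterPower par hlamT osc j k t
  have hs : 0 ≤ ∑ l, ∑ m, |C₁ l m| :=
    Finset.sum_nonneg fun l _ => Finset.sum_nonneg fun m _ => abs_nonneg _
  -- A sum of absolute values dominates every one of the constants.
  refine ⟨∑ l, ∑ m, |C₁ l m| + |C₂| + |C₃|, by positivity,
    fun n Ω _ P _ R hR W hW => ?_⟩
  have hphi : AEMeasurable (fun ω s n => R.phi s n ω) P :=
    aemeasurable_pi_lambda _ fun s => aemeasurable_pi_lambda _ fun n => hR.phase_aemeasurable s n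
  have := Measure.isProbabilityMeasure_map hphi
  have hμ := hR.isPhaseLaw
  have hJ := hR.map_joint
  -- The canonical model is taken with the phase law of the given receiver, so the joint laws agree
  -- and minimality of `W` carries over.
  have hJ' := hasLaw_joint_canonicalReceiver par (P.map fun ω s n => R.phi s n ω)
    (subarrayLam lamT n)
  have hW' := hW.of_hasLaw par W j k t hJ hJ'
  have hle₁ : ∀ l m, C₁ l m ≤ ∑ l, ∑ m, |C₁ l m| + |C₂| + |C₃| := by
    intro l m
    have h1 := Finset.single_le_sum (f := fun m => |C₁ l m|) (fun m _ => abs_nonneg _)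
      (Finset.mem_univ m)
    have h2 := Finset.single_le_sum (f := fun l => ∑ m, |C₁ l m|)
      (fun l _ => Finset.sum_nonneg fun m _ => abs_nonneg _) (Finset.mem_univ l)
    linarith [le_abs_self (C₁ l m), abs_nonneg C₂, abs_nonneg C₃]
  have hle₂ : C₂ ≤ ∑ l, ∑ m, |C₁ l m| + |C₂| + |C₃| := by
    linarith [le_abs_self C₂, abs_nonneg C₃]
  have hle₃ : C₃ ≤ ∑ l, ∑ m, |C₁ l m| + |C₂| + |C₃| := by
    linarith [le_abs_self C₃, abs_nonneg C₂]
  have hn : (0 : ℝ) ≤ n := Nat.cast_nonneg n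
  refine ⟨?_, fun l m => ?_, ?_, ?_⟩
  · rw [meanGain_eq_of_hasLaw par W j k t hJ, ← meanGain_eq_of_hasLaw par W j k t hJ']
    exact meanGain_canonical par hlamT hμ hW'
  · rw [interference_eq_of_hasLaw par W l m t hJ, ← interference_eq_of_hasLaw par W l m t hJ']
    exact (h₁ l m n _ hμ W hW').trans (mul_le_mul_of_nonneg_right (hle₁ l m) hn)
  · rw [distortionPower_eq_of_hasLaw par W t hJ, ← distortionPower_eq_of_hasLaw par W t hJ']
    exact (h₂ n _ hμ W hW').trans (mul_le_mul_of_nonneg_right hle₂ hn)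
  · rw [filterPower_eq_of_hasLaw par W hJ, ← filterPower_eq_of_hasLaw par W hJ']
    exact (h₃ n _ hμ W hW').trans (mul_le_mul_of_nonneg_right hle₃ hn)

end Performance

/-! ### From bounds in the subarray size to orders in the number of antennas -/

theorem isBigO_one_div_of_abs_le {A : ℕ} (hA : 0 < A) {f : ℕ → ℝ} {C : ℝ}
    (h : ∀ n : ℕ, 0 < n → |f n| ≤ C / n) : f =O[atTop] fun n : ℕ => 1 / ((A * n : ℕ) : ℝ) := by
  refine IsBigO.of_bound (C * A) ?_
  filter_upwards [eventually_gt_atTop 0] with n hn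
  have hA' : (0 : ℝ) < A := by exact_mod_cast hA
  have hn' : (0 : ℝ) < n := by exact_mod_cast hn
  refine (h n hn).trans (le_of_eq ?_)
  rw [Real.norm_of_nonneg (by positivity)]
  push_cast
  field_simp

theorem isBigO_one_div_of_abs_le_mul {A : ℕ} (hA : 0 < A) {f : ℕ → ℝ} {C : ℝ}
    (h : ∀ n : ℕ, |f n| ≤ C * n) :
    (fun n : ℕ => f n / (n : ℝ) ^ 2) =O[atTop] fun n : ℕ => 1 / ((A * n : ℕ) : ℝ) := by
  refine isBigO_one_div_of_abs_le hA (C := C) fun n hn => ?_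
  have hn' : (0 : ℝ) < n := by exact_mod_cast hn
  rw [abs_div, abs_of_nonneg (sq_nonneg (n : ℝ)), div_le_div_iff₀ (by positivity) hn']
  nlinarith [mul_le_mul_of_nonneg_right (h n) hn'.le]

theorem tendsto_one_div_mul {A : ℕ} (hA : 0 < A) :
    Tendsto (fun n : ℕ => 1 / ((A * n : ℕ) : ℝ)) atTop (𝓝 0) := by
  simp_rw [one_div]
  exact tendsto_inv_atTop_zero.comp
    (tendsto_natCast_atTop_atTop.comp (tendsto_id.const_mul_atTop' hA))

end

end MassiveMIMO

/-! ### The SINR formula and its limit -/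

theorem corollary3 {L K B T A : ℕ} (hA : 0 < A) (par : MassiveMIMO.Params L K B T)
    (osc : MassiveMIMO.Oscillators) (j : Fin L) (k : Fin K)
    (t : Fin T) (ht : t ∉ Set.range par.tau)
    (lamT : Fin L → Fin K → Fin A → ℝ) (hlamT : ∀ l m a, 0 ≤ lamT l m a)
    -- `n` antennas in each of the `A` subarrays, `N = A * n` in total
    (lam : (n : ℕ) → Fin L → Fin K → Fin A × Fin n → ℝ)
    (hfactor : ∀ n l m, MassiveMIMO.covMatrix (lam n l m) =
      MassiveMIMO.covMatrix (lamT l m) ⊗ₖ (1 : Matrix (Fin n) (Fin n) ℂ))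
    {Ω : ℕ → Type*} [∀ n, MeasurableSpace (Ω n)] (P : (n : ℕ) → Measure (Ω n))
    [∀ n, IsProbabilityMeasure (P n)]
    (R : (n : ℕ) → MassiveMIMO.Receiver L K T (Fin A × Fin n) (Ω n))
    (hR : ∀ n, (R n).IsUplink par osc (lam n) (P n))
    -- maximum ratio combining: the filter is the LMMSE estimate of the own effective channel
    (W : (n : ℕ) → Matrix (Fin A × Fin n) (Fin B × (Fin A × Fin n)) ℂ)
    (hW : ∀ n, (R n).IsLMMSE par (P n) j k t (W n))
    (v : (n : ℕ) → Fin A × Fin n → Ω n → ℂ) (hv : ∀ n, v n = (R n).linEst par (W n)) :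
    -- the SINR formula
    (∃ ε : ℕ → ℝ, ε =O[atTop] (fun n => 1 / ((A * n : ℕ) : ℝ)) ∧
      ∀ n, 0 < n → (R n).sinr par (P n) (v n) j k t =
        par.p j k * MassiveMIMO.Sig par lamT t j k /
          ((∑ l, ∑ m, par.p l m * MassiveMIMO.Interf par lamT t j k l m osc)
            - par.p j k * MassiveMIMO.Sig par lamT t j k + ε n)) ∧
    -- distortion noise and receiver noise vanish, relative to the scale `(N / A)²` of the signal
    (fun n => (R n).distortionPower (P n) (v n) t / (n : ℝ) ^ 2) =O[atTop]
      (fun n => 1 / ((A * n : ℕ) : ℝ)) ∧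
    (fun n => par.xi * MassiveMIMO.filterPower (P n) (v n) / (n : ℝ) ^ 2) =O[atTop]
      (fun n => 1 / ((A * n : ℕ) : ℝ)) ∧
    -- the limit
    ((∑ l, ∑ m, par.p l m * MassiveMIMO.Interf par lamT t j k l m osc)
        - par.p j k * MassiveMIMO.Sig par lamT t j k ≠ 0 →
      Tendsto (fun n => (R n).sinr par (P n) (v n) j k t) atTop
        (𝓝 (par.p j k * MassiveMIMO.Sig par lamT t j k /
          ((∑ l, ∑ m, par.p l m * MassiveMIMO.Interf par lamT t j k l m osc)
            - par.p j k * MassiveMIMO.Sig par lamT t j k)))) := by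
  -- The diagonal entries of the Kronecker factorization determine the attenuations.
  obtain rfl : lam = fun n => MassiveMIMO.subarrayLam lamT n := by
    funext n l m q
    have h := congrFun (congrFun (hfactor n l m) q) q
    simpa [MassiveMIMO.covMatrix, MassiveMIMO.subarrayLam, Matrix.kroneckerMap_apply] using h
  obtain ⟨C, hC0, hC⟩ := MassiveMIMO.exists_bound_performance par hlamT osc j k ht
  have hperf := fun n => hC n (P n) (R n) (hR n) (W n) (hW n)
  simp_rw [← hv] at hperf
  set S : ℝ := (∑ l, ∑ m, par.p l m * MassiveMIMO.Interf par lamT t j k l m osc)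
    - par.p j k * MassiveMIMO.Sig par lamT t j k with hS
  have hdist := MassiveMIMO.isBigO_one_div_of_abs_le_mul hA fun n => (hperf n).2.2.1
  have hfilt : ∀ n, |par.xi * MassiveMIMO.filterPower (P n) (v n)| ≤ par.xi * C * n := by
    intro n
    rw [abs_mul, abs_of_pos par.xi_pos, mul_assoc]
    exact mul_le_mul_of_nonneg_left (hperf n).2.2.2 par.xi_pos.le
  have hsinr : ∃ ε : ℕ → ℝ, ε =O[atTop] (fun n => 1 / ((A * n : ℕ) : ℝ)) ∧
      ∀ n, 0 < n → (R n).sinr par (P n) (v n) j k t =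
        par.p j k * MassiveMIMO.Sig par lamT t j k / (S + ε n) := by
    let D : ℕ → ℝ := fun n =>
      (∑ l, ∑ m, par.p l m * (R n).interference (P n) (v n) l m t) -
        par.p j k * ‖(R n).meanGain (P n) (v n) j k t‖ ^ 2 +
        (R n).distortionPower (P n) (v n) t + par.xi * MassiveMIMO.filterPower (P n) (v n)
    -- This choice makes `S + ε n` equal to the SINR denominator divided by `n²`.
    refine ⟨fun n => (D n - (n : ℝ) ^ 2 * S) / (n : ℝ) ^ 2,
      MassiveMIMO.isBigO_one_div_of_abs_le_mul hA
        (C := (∑ l, ∑ m, par.p l m * C) + C + par.xi * C) fun n => ?_, fun n hn => ?_⟩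
    -- The signal terms cancel because the mean gain is exact; interference errors and the two noise
    -- powers remain, each at most a constant times `n`.
    · have h1 : D n - (n : ℝ) ^ 2 * S =
          (∑ l, ∑ m, par.p l m * ((R n).interference (P n) (v n) l m t -
            (n : ℝ) ^ 2 * MassiveMIMO.Interf par lamT t j k l m osc)) +
          (R n).distortionPower (P n) (v n) t +
          par.xi * MassiveMIMO.filterPower (P n) (v n) := by
        simp only [D, hS, (hperf n).1, mul_sub, Finset.sum_sub_distrib]
        have h2 : ∑ l, ∑ m, par.p l m * ((n : ℝ) ^ 2 *
            MassiveMIMO.Interf par lamT t j k l m osc) =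
            (n : ℝ) ^ 2 * ∑ l, ∑ m, par.p l m * MassiveMIMO.Interf par lamT t j k l m osc := by
          simp only [Finset.mul_sum]
          exact Finset.sum_congr rfl fun _ _ => Finset.sum_congr rfl fun _ _ => by ring
        rw [h2]
        ring
      have h3 : |∑ l, ∑ m, par.p l m * ((R n).interference (P n) (v n) l m t -
            (n : ℝ) ^ 2 * MassiveMIMO.Interf par lamT t j k l m osc)| ≤
          (∑ l, ∑ m, par.p l m * C) * n := by
        simp only [Finset.sum_mul]
        refine (Finset.abs_sum_le_sum_abs _ _).trans (Finset.sum_le_sum fun l _ => ?_)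
        refine (Finset.abs_sum_le_sum_abs _ _).trans (Finset.sum_le_sum fun m _ => ?_)
        rw [abs_mul, abs_of_nonneg (par.p_nonneg l m), mul_assoc]
        exact mul_le_mul_of_nonneg_left ((hperf n).2.1 l m) (par.p_nonneg l m)
      rw [h1, add_mul, add_mul]
      exact (abs_add_three _ _ _).trans
        (add_le_add (add_le_add h3 (hperf n).2.2.1) (hfilt n))
    · have hn' : (n : ℝ) ^ 2 ≠ 0 := pow_ne_zero 2 (Nat.cast_ne_zero.2 hn.ne')
      have h1 : S + (D n - (n : ℝ) ^ 2 * S) / (n : ℝ) ^ 2 = D n / (n : ℝ) ^ 2 := by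
        field_simp
        ring
      have h2 : (R n).sinr par (P n) (v n) j k t =
          par.p j k * ‖(R n).meanGain (P n) (v n) j k t‖ ^ 2 / D n := rfl
      -- The numerator is exactly `n²` times its limit value, so all of the error sits in the
      -- denominator.
      rw [h1, h2, (hperf n).1, mul_left_comm, div_div_eq_mul_div, mul_comm ((n : ℝ) ^ 2)]
  refine ⟨hsinr, hdist, MassiveMIMO.isBigO_one_div_of_abs_le_mul hA hfilt, fun hne => ?_⟩
  obtain ⟨ε, hε, hεn⟩ := hsinr
  have h0 : Tendsto ε atTop (𝓝 0) := hε.trans_tendsto (MassiveMIMO.tendsto_one_div_mul hA)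
  have h1 : Tendsto (fun n => par.p j k * MassiveMIMO.Sig par lamT t j k / (S + ε n)) atTop
      (𝓝 (par.p j k * MassiveMIMO.Sig par lamT t j k / S)) := by
    refine tendsto_const_nhds.div ?_ hne
    simpa using h0.const_add S
  refine h1.congr' ?_
  filter_upwards [eventually_gt_atTop 0] with n hn
  exact (hεn n hn).symm
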